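/- **Setting.** Let $W$ be a random variable with $W>0$ almost surely, $\mathbb E[W^3]<\infty$ and $\mathbb E[W^2]=\mathbb E[W]$. For each $n$ let $w_1\ge w_2\ge\dots\ge w_n>0$ be weights (depending on $n$), and put $\ell_n=\sum_{k=1}^n w_k$. Assume that, as $n\to\infty$, the weight of a uniformly chosen index converges weakly to $W$, and $$\ell_n=\mathbb E[W]\,n+o(n^{2/3}),\quad \sum_{k=1}^n w_k^2=\mathbb E[W^2]\,n+o(n^{2/3}),\quad \sum_{k=1}^n w_k^3=\mathbb E[W^3]\,n+o(n),\quad \max_{k\le n}w_k=o(n^{1/3}).$$ Let $v(1),\dots,v(n)$ be the indices $1,\dots,n$ in size-biased order without replacement: $\mathbb P(v(1)=j)=w_j/\ell_n$, and for $1\le i\le n-1$, $$\mathbb P\big(v(i+1)=j\mid v(1),\dots,v(i)\big)=\frac{w_j\,\mathbf 1\{j\notin\{v(1),\dots,v(i)\}\}}{\ell_n-\sum_{k=1}^i w_{v(k)}}.$$ By convention $w_{v(0)}=0$. For a constant $\bar A>0$, a pair $(a(n),b(n))$ of real sequences is said to satisfy $\mathcal C(\bar A)$ if $\exp\!\big(-b(n)^2/(\bar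 A(b(n)n^{1/3}+a(n)))\big)<1/4$ for all large $n$, $a(n)\to\infty$, $b(n)\to\infty$, $a(n)=o(n)$, $b(n)=O(a(n))$, $a(n)=O(b(n)\ell_n^{1/3})$ and $a(n)^2=O(b(n)\ell_n)$. **Theorem.** There is a constant $A>0$, depending only on the distribution of $W$, such that for every $\bar A>0$ and all weights as above the following hold. (1) If $m=m(n)$ (nonnegative integers) and $y=y(n)$ are such that $(m,y)$ satisfies $\mathcal C(\bar A)$, then for all $n$ large enough $$\mathbb P\Big[\sup_{0\le i\le j\le m}\Big|\sum_{k=i}^j w_{v(k)}-\mathbb E\Big[\sum_{k=i}^j w_{v(k)}\Big]\Big|\ge y\Big]\le A\exp\Big(\frac{-y^2}{A(yn^{1/3}+m)}\Big).$$ (2) If $l=l(n)$ and $m=m(n)$ are integers with $1\le l\le m\le n$ for all large $n$, $\big(\sqrt{m(m-l)},y\big)$ satisfies $\mathcal C(\bar A)$, $m-l\to\infty$ and $y=O(m-l)$, then for all $n$ large enough $$\mathbb P\Big[\sup_{l\le i\le j\le m}\Big|\sum_{k=i}^j w_{v(k)}-\mathbb E\Big[\sum_{k=i}^j w_{v(k)}\Big]\Big|\ge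 y\Big]\le A\exp\Big(\frac{-y^2}{A(yn^{1/3}+(m-l))}\Big).$$ -/

import Mathlib

open MeasureTheory Filter Asymptotics Topology

noncomputable section

namespace SizeBiased

/-- Total weight `ℓ = w₁ + ⋯ + wₙ`. -/
def totalWeight {n : ℕ} (w : Fin n → ℝ) : ℝ := ∑ i, w i

/-- The assumptions on the law `ν` of the limiting random variable `W`: `W > 0` almost surely,
`E[W³] < ∞` and `E[W²] = E[W]`. -/
structure IsLimitLaw (ν : Measure ℝ) : Prop where
  prob : IsProbabilityMeasure ν
  pos : ∀ᵐ x ∂ν, 0 < x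
  third_moment : Integrable (fun x : ℝ => x ^ 3) ν
  second_eq_first : ∫ x, x ^ 2 ∂ν = ∫ x, x ∂ν

/-- The assumptions on a triangular array of weights `w n 0 ≥ w n 1 ≥ ⋯ ≥ w n (n-1) > 0`
with limit law `ν`. -/
structure WeightConditions (ν : Measure ℝ) (w : (n : ℕ) → Fin n → ℝ) : Prop where
  pos : ∀ n i, 0 < w n i
  antitone : ∀ n, Antitone (w n)
  /-- A uniformly chosen weight converges weakly to `ν`. -/
  weak : ∀ f : BoundedContinuousFunction ℝ ℝ,
    Tendsto (fun n : ℕ => (∑ i, f (w n i)) / (n : ℝ)) atTop (𝓝 (∫ x, f x ∂ν))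
  first : (fun n : ℕ => totalWeight (w n) - (∫ x, x ∂ν) * (n : ℝ))
    =o[atTop] (fun n : ℕ => (n : ℝ) ^ (2 / 3 : ℝ))
  second : (fun n : ℕ => ∑ i, w n i ^ 2 - (∫ x, x ^ 2 ∂ν) * (n : ℝ))
    =o[atTop] (fun n : ℕ => (n : ℝ) ^ (2 / 3 : ℝ))
  third : (fun n : ℕ => ∑ i, w n i ^ 3 - (∫ x, x ^ 3 ∂ν) * (n : ℝ))
    =o[atTop] (fun n : ℕ => (n : ℝ))
  max : (fun n : ℕ => ⨆ i, w n i) =o[atTop] (fun n : ℕ => (n : ℝ) ^ (1 / 3 : ℝ))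

/-- The regime of pairs `(a(n), b(n))`, with respect to a constant `Abar` and the total
weights `ℓ(n)`. -/
structure Regime (Abar : ℝ) (ℓ a b : ℕ → ℝ) : Prop where
  exp_lt : ∀ᶠ n : ℕ in atTop,
    Real.exp (-(b n) ^ 2 / (Abar * (b n * (n : ℝ) ^ (1 / 3 : ℝ) + a n))) < 1 / 4
  tendsto_a : Tendsto a atTop atTop
  tendsto_b : Tendsto b atTop atTop
  a_isLittleO : a =o[atTop] (fun n : ℕ => (n : ℝ))
  b_isBigO : b =O[atTop] a
  a_isBigO : a =O[atTop] (fun n => b n * ℓ n ^ (1 / 3 : ℝ))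
  a_sq_isBigO : (fun n => a n ^ 2) =O[atTop] (fun n => b n * ℓ n)

/-- The random indices `v 0, v 1, …, v (n-1)` (the first, second, …, `n`-th drawn index) are
drawn in size-biased order without replacement: given the first `i` drawn indices, the next one
is `j` with probability `w j / (ℓ - sum of the weights already drawn)` if `j` has not been drawn
yet, and with probability `0` otherwise. The conditional probability is written as
`P(past, next) = P(past) * P(next | past)`; for `i = 0` the past is the sure event. -/
structure IsSizeBiasedOrder {n : ℕ} (w : Fin n → ℝ) {Ω : Type*} [MeasurableSpace Ω]
    (P : Measure Ω) (v : Fin n → Ω → Fin n) : Prop where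
  measurable : ∀ i, Measurable (v i)
  law : ∀ (i : Fin n) (a : Fin n → Fin n) (j : Fin n),
    P.real {ω | (∀ k, k < i → v k ω = a k) ∧ v i ω = j} =
      P.real {ω | ∀ k, k < i → v k ω = a k} *
        (open Classical in
          if ∃ k, k < i ∧ a k = j then 0
          else w j / (totalWeight w - ∑ k ∈ Finset.Iio i, w (a k)))

/-- `drawnWeight w v k` is the weight of the `k`-th drawn index (`1 ≤ k ≤ n`), with the
convention that it is `0` for `k = 0` (and for `k > n`, which is never used). -/
def drawnWeight {n : ℕ} (w : Fin n → ℝ) {Ω : Type*} (v : Fin n → Ω → Fin n) : ℕ → Ω → ℝ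
  | 0, _ => 0
  | k + 1, ω => if h : k < n then w (v ⟨k, h⟩ ω) else 0

/-- The centred window sum `∑_{k=i}^j w_{v(k)} - E[∑_{k=i}^j w_{v(k)}]`. -/
def centredSum {n : ℕ} (w : Fin n → ℝ) {Ω : Type*} [MeasurableSpace Ω] (P : Measure Ω)
    (v : Fin n → Ω → Fin n) (i j : ℕ) (ω : Ω) : ℝ :=
  ∑ k ∈ Finset.Icc i j, drawnWeight w v k ω
    - ∫ ω', ∑ k ∈ Finset.Icc i j, drawnWeight w v k ω' ∂P

/-- `sup_{l ≤ i ≤ j ≤ m} |∑_{k=i}^j w_{v(k)} - E[∑_{k=i}^j w_{v(k)}]|`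
(a supremum of a finite family). -/
def maxDeviation {n : ℕ} (w : Fin n → ℝ) {Ω : Type*} [MeasurableSpace Ω] (P : Measure Ω)
    (v : Fin n → Ω → Fin n) (l m : ℕ) (ω : Ω) : ℝ :=
  ⨆ p : {p : ℕ × ℕ // l ≤ p.1 ∧ p.1 ≤ p.2 ∧ p.2 ≤ m}, |centredSum w P v p.1.1 p.1.2 ω|

end SizeBiased

end

/-! All estimates take place on the space of paths `Fin n → Fin n` under the law of the drawn order
(`IsSizeBiasedOrder.map_path`). A window sum is a difference of two sums started at the left end, so
a deviation `y` in some window forces a deviation `y / 2` of a window started there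
(`IsSizeBiasedOrder.maxDeviation_le`). Write `L` for the total weight, `m` for the end of the window
and `k` for its length. Two mechanisms are needed, according to whether `m ≤ δ n` for a small
constant `δ`.

Early windows. The increment of the drawn weight is a martingale increment plus a sum of drifts `(Q
- q) / (L - S)`, where `Q` is the total of the squares and `S`, `q` are the sums of weights and of
squares already drawn. To first order the drift is affine in `S` and `q`, and these are again
compensator plus martingale. Hence the drift is deterministic, plus martingales divided by `L`, plus
an error of order `η m / L` (`SmallSets.drift_expansion`); here `η` is as small as desired because
few indices carry little of the sum of cubes. Over the window the errors add up to `η m k / L`,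
which is at most a small multiple of `y` because the regime gives `m k = O(y L)`. The martingales
have bounded conditional variance per draw and, after scaling, jumps at most `n ^ (1/3)`; the
Freedman-type bound `IsSizeBiasedOrder.mart_tail` then yields the exponent `y² / (y n ^ (1/3) + k)`.

Late windows. If `m > δ n`, then `m k = O(y L)` forces `k = O(y)`, while `y = O(k)` is assumed: the
deviation is proportional to the length, and a bound of order `exp (-y / n ^ (1/3))` suffices. It is
trivial for `y < n ^ (1/3)`. Otherwise each weight is at most a bounded part, plus a small constant
`θ`, plus the excess over a level `B`. For the bounded part, independent exponential clocks with the
weights as rates ring in size-biased order (`IsSizeBiasedOrder.real_le_clock`). At fixed times,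
counts and sums are then sums of independent terms; Chernoff bounds and a union bound over a grid of
times give `exists_bounded_window_mean`. For the excess, a later window is dominated by an initial
one in exponential moment (`biasedMean_nextProd_le`), and the parameter `1 / b` with `b` a small
multiple of `n ^ (1/3)` gives the required rate. -/

namespace SizeBiased

/-! ### Paths of draws and the conditional law of the next draw. -/

section Path

variable {n : ℕ}

/-- The conditional probability that the next drawn index is `j`, given the past `a k`, `k < i`. -/
noncomputable def stepProb (w : Fin n → ℝ) (i : Fin n) (a : Fin n → Fin n) (j : Fin n) : ℝ :=
  open Classical in
    if ∃ k, k < i ∧ a k = j then 0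
    else w j / (totalWeight w - ∑ k ∈ Finset.Iio i, w (a k))

/-- The set of the first `i` drawn indices. -/
def drawn (i : ℕ) (a : Fin n → Fin n) : Finset (Fin n) :=
  (Finset.univ.filter fun k : Fin n => (k : ℕ) < i).image a

/-- The sum of `g` over the first `i` drawn indices. -/
def cum (g : Fin n → ℝ) (i : ℕ) (a : Fin n → Fin n) : ℝ := ∑ j ∈ drawn i a, g j

/-- The size-biased mean of `g` over the set `U`. -/
noncomputable def biasedMean (w g : Fin n → ℝ) (U : Finset (Fin n)) : ℝ :=
  (∑ j ∈ U, w j * g j) / ∑ j ∈ U, w j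

/-- The conditional mean of `g` at the draw following the first `i` draws. -/
noncomputable def drift (w g : Fin n → ℝ) (i : ℕ) (a : Fin n → Fin n) : ℝ :=
  biasedMean w g (drawn i a)ᶜ

/-- The martingale part of `cum g`. -/
noncomputable def mart (w g : Fin n → ℝ) (i : ℕ) (a : Fin n → Fin n) : ℝ :=
  cum g i a - ∑ k ∈ Finset.range i, drift w g k a

/-- A function of the path depends on the first `i` draws only. -/
def Adapted {β : Type*} (i : ℕ) (f : (Fin n → Fin n) → β) : Prop :=
  ∀ a b : Fin n → Fin n, (∀ k : Fin n, (k : ℕ) < i → a k = b k) → f a = f b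

theorem Adapted.mono {β : Type*} {i j : ℕ} (hij : i ≤ j) {f : (Fin n → Fin n) → β}
    (h : Adapted i f) : Adapted j f :=
  fun a b hab => h a b fun k hk => hab k (hk.trans_le hij)

theorem adapted_drawn (i : ℕ) : Adapted (n := n) i (drawn i) := by
  intro a b h
  unfold drawn
  apply Finset.image_congr
  intro k hk
  simpa using h k (by simpa using hk)

theorem adapted_cum (g : Fin n → ℝ) (i : ℕ) : Adapted i (cum g i) := by
  intro a b h
  unfold cum
  rw [adapted_drawn i a b h]

theorem adapted_drift (w g : Fin n → ℝ) (i : ℕ) : Adapted i (drift w g i) := by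
  intro a b h
  unfold drift
  rw [adapted_drawn i a b h]

theorem adapted_mart (w g : Fin n → ℝ) (i : ℕ) : Adapted i (mart w g i) := by
  intro a b h
  unfold mart
  rw [adapted_cum g i a b h]
  congr 1
  apply Finset.sum_congr rfl
  intro k hk
  exact (adapted_drift w g k).mono (Finset.mem_range.1 hk).le a b h

@[simp] theorem drawn_zero (a : Fin n → Fin n) : drawn 0 a = ∅ := by simp [drawn]

@[simp] theorem cum_zero (g : Fin n → ℝ) (a : Fin n → Fin n) : cum g 0 a = 0 := by simp [cum]

@[simp] theorem mart_zero (w g : Fin n → ℝ) (a : Fin n → Fin n) : mart w g 0 a = 0 := by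
  simp [mart]

theorem drawn_succ (i : Fin n) (a : Fin n → Fin n) :
    drawn ((i : ℕ) + 1) a = insert (a i) (drawn i a) := by
  ext j
  simp only [drawn, Finset.mem_image, Finset.mem_filter, Finset.mem_univ, true_and,
    Finset.mem_insert]
  constructor
  · rintro ⟨k, hk, rfl⟩
    rcases Nat.lt_succ_iff_lt_or_eq.1 hk with h | h
    · exact Or.inr ⟨k, h, rfl⟩
    · exact Or.inl (by rw [Fin.ext h])
  · rintro (rfl | ⟨k, hk, rfl⟩)
    · exact ⟨i, Nat.lt_succ_self _, rfl⟩
    · exact ⟨k, Nat.lt_succ_of_lt hk, rfl⟩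

theorem drawn_mono (a : Fin n → Fin n) : Monotone fun i => drawn i a := by
  intro i j hij
  apply Finset.image_subset_image
  intro k hk
  simp only [Finset.mem_filter, Finset.mem_univ, true_and] at hk ⊢
  omega

theorem notMem_drawn {a : Fin n → Fin n} (ha : Function.Injective a) (i : Fin n) :
    a i ∉ drawn i a := by
  simp only [drawn, Finset.mem_image, Finset.mem_filter, Finset.mem_univ, true_and, not_exists,
    not_and]
  intro k hk h
  rw [ha h] at hk
  exact lt_irrefl _ hk

theorem card_drawn {a : Fin n → Fin n} (ha : Function.Injective a) {i : ℕ} (hi : i ≤ n) :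
    (drawn i a).card = i := by
  rw [drawn, Finset.card_image_of_injective _ ha]
  rw [Fin.card_filter_val_lt, min_eq_right hi]

theorem card_drawn_le (a : Fin n → Fin n) (i : ℕ) : (drawn i a).card ≤ i := by
  refine Finset.card_image_le.trans ?_
  rw [Fin.card_filter_val_lt]
  exact min_le_right _ _

theorem cum_eq_sum {a : Fin n → Fin n} (ha : Function.Injective a) (g : Fin n → ℝ) (i : ℕ) :
    cum g i a = ∑ k ∈ Finset.univ.filter (fun k : Fin n => (k : ℕ) < i), g (a k) := by
  rw [cum, drawn, Finset.sum_image fun x _ y _ h => ha h]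

theorem cum_succ {a : Fin n → Fin n} (ha : Function.Injective a) (g : Fin n → ℝ) (i : Fin n) :
    cum g ((i : ℕ) + 1) a = cum g i a + g (a i) := by
  rw [cum, drawn_succ, Finset.sum_insert (notMem_drawn ha i), cum, add_comm]

theorem mart_succ {a : Fin n → Fin n} (ha : Function.Injective a) (w g : Fin n → ℝ) (i : Fin n) :
    mart w g ((i : ℕ) + 1) a = mart w g i a + (g (a i) - drift w g i a) := by
  rw [mart, mart, cum_succ ha, Finset.sum_range_succ]
  ring

theorem integrable_path {μ : Measure (Fin n → Fin n)} [IsFiniteMeasure μ]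
    (F : (Fin n → Fin n) → ℝ) : Integrable F μ := Integrable.of_finite

/-- On a finite path space the elementary law determines the conditional law of the next draw:
integrate separately over each possible past. -/
theorem IsSizeBiasedOrder.integral_step {w : Fin n → ℝ} {μ : Measure (Fin n → Fin n)}
    [IsProbabilityMeasure μ] (h : IsSizeBiasedOrder w μ fun k a => a k) (i : Fin n)
    (Ψ : (Fin n → Fin n) → Fin n → ℝ) (hΨ : Adapted (i : ℕ) Ψ) :
    ∫ a, Ψ a (a i) ∂μ = ∫ a, ∑ j, stepProb w i a j * Ψ a j ∂μ := by
  classical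
  -- The retraction `r` keeps the past and overwrites the rest by a fixed filler, so its fibres are
  -- exactly the events that prescribe the past.
  let r : (Fin n → Fin n) → Fin n → Fin n := fun a k => if k < i then a k else k
  have hr : ∀ a, ∀ k : Fin n, (k : ℕ) < i → r a k = a k := fun a k hk => if_pos hk
  have hΨr : ∀ a, Ψ (r a) = Ψ a := fun a => hΨ _ _ (hr a)
  have hqr : ∀ a j, stepProb w i (r a) j = stepProb w i a j := by
    intro a j
    have h1 : (∃ k, k < i ∧ r a k = j) ↔ ∃ k, k < i ∧ a k = j := by
      constructor
      · rintro ⟨k, hk, h⟩; exact ⟨k, hk, by rw [← hr a k hk]; exact h⟩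
      · rintro ⟨k, hk, h⟩; exact ⟨k, hk, by rw [hr a k hk]; exact h⟩
    have h2 : ∑ k ∈ Finset.Iio i, w (r a k) = ∑ k ∈ Finset.Iio i, w (a k) :=
      Finset.sum_congr rfl fun k hk => by rw [hr a k (by simpa using hk)]
    simp only [stepProb, h1, h2]
  have key : ∀ b j, μ.real {a | r a = b ∧ a i = j} = μ.real {a | r a = b} * stepProb w i b j := by
    intro b j
    by_cases hb : r b = b
    · have h1 : ∀ a, r a = b ↔ ∀ k, k < i → a k = b k := by
        intro a
        constructor
        · rintro rfl k hk; exact (hr a k hk).symm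
        · intro hab
          rw [← hb]
          funext k
          simp only [r]
          split_ifs with hk
          · exact hab k hk
          · rfl
      simp only [h1]
      exact h.law i b j
    · have h1 : ∀ a, r a ≠ b := by
        rintro a rfl
        apply hb
        funext k
        simp only [r]
        split_ifs <;> rfl
      simp [h1]
  have e1 : ∀ F : (Fin n → Fin n) → Fin n → ℝ,
      ∫ a, F (r a) (a i) ∂μ = ∑ b, ∑ j, μ.real {a | r a = b ∧ a i = j} * F b j := by
    intro F
    have : ∀ a, F (r a) (a i) =
        ∑ b, ∑ j, Set.indicator {a | r a = b ∧ a i = j} (fun _ => F b j) a := by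
      intro a
      simp [Set.indicator_apply, ite_and]
    simp_rw [this]
    rw [integral_finsetSum _ fun _ _ => integrable_path _]
    refine Finset.sum_congr rfl fun b _ => ?_
    rw [integral_finsetSum _ fun _ _ => integrable_path _]
    refine Finset.sum_congr rfl fun j _ => ?_
    rw [integral_indicator_const _ (Set.toFinite _).measurableSet, smul_eq_mul]
  have e2 : ∀ F : (Fin n → Fin n) → ℝ,
      ∫ a, F (r a) ∂μ = ∑ b, μ.real {a | r a = b} * F b := by
    intro F
    have : ∀ a, F (r a) = ∑ b, Set.indicator {a | r a = b} (fun _ => F b) a := by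
      intro a
      simp [Set.indicator_apply]
    simp_rw [this]
    rw [integral_finsetSum _ fun _ _ => integrable_path _]
    refine Finset.sum_congr rfl fun b _ => ?_
    rw [integral_indicator_const _ (Set.toFinite _).measurableSet, smul_eq_mul]
  have l1 : ∫ a, Ψ a (a i) ∂μ = ∫ a, Ψ (r a) (a i) ∂μ := by simp_rw [hΨr]
  have l2 : ∫ a, ∑ j, stepProb w i a j * Ψ a j ∂μ
      = ∫ a, ∑ j, stepProb w i (r a) j * Ψ (r a) j ∂μ := by simp_rw [hΨr, hqr]
  rw [l1, l2, e1, e2 fun a => ∑ j, stepProb w i a j * Ψ a j]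
  refine Finset.sum_congr rfl fun b _ => ?_
  rw [Finset.mul_sum]
  refine Finset.sum_congr rfl fun j _ => ?_
  rw [key]; ring

/-- The one-step formula is applied to the indicator of a repetition, on which the step probability
vanishes. -/
theorem IsSizeBiasedOrder.ae_injective {w : Fin n → ℝ} {μ : Measure (Fin n → Fin n)}
    [IsProbabilityMeasure μ] (h : IsSizeBiasedOrder w μ fun k a => a k) :
    ∀ᵐ a ∂μ, Function.Injective a := by
  classical
  have h1 : ∀ i : Fin n, ∀ᵐ a ∂μ, ¬ ∃ k, k < i ∧ a k = a i := by
    intro i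
    have := h.integral_step i (fun a j => if ∃ k, k < i ∧ a k = j then 1 else 0) (by
      intro a b hab
      funext j
      have h1 : (∃ k, k < i ∧ a k = j) ↔ ∃ k, k < i ∧ b k = j := by
        constructor
        · rintro ⟨k, hk, h⟩; exact ⟨k, hk, by rw [← hab k hk]; exact h⟩
        · rintro ⟨k, hk, h⟩; exact ⟨k, hk, by rw [hab k hk]; exact h⟩
      simp only [h1])
    have h0 : ∀ a, ∑ j, stepProb w i a j * (if ∃ k, k < i ∧ a k = j then (1 : ℝ) else 0) = 0 := by
      intro a
      refine Finset.sum_eq_zero fun j _ => ?_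
      unfold stepProb
      split_ifs <;> simp
    simp only [h0, integral_zero] at this
    rw [integral_eq_zero_iff_of_nonneg (fun a => by dsimp; split_ifs <;> norm_num)
      (integrable_path _)] at this
    filter_upwards [this] with a ha hk
    simp [hk] at ha
  filter_upwards [ae_all_iff.2 h1] with a ha
  intro x y hxy
  rcases lt_trichotomy x y with hl | hl | hl
  · exact absurd ⟨x, hl, hxy⟩ (ha y)
  · exact hl
  · exact absurd ⟨y, hl, hxy.symm⟩ (ha x)

theorem stepProb_of_injective {a : Fin n → Fin n} (ha : Function.Injective a) (w : Fin n → ℝ)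
    (i j : Fin n) :
    stepProb w i a j = if j ∈ (drawn i a)ᶜ then w j / ∑ k ∈ (drawn i a)ᶜ, w k else 0 := by
  classical
  have h1 : (∃ k, k < i ∧ a k = j) ↔ ¬ j ∈ (drawn i a)ᶜ := by
    simp only [drawn, Finset.mem_compl, not_not, Finset.mem_image, Finset.mem_filter,
      Finset.mem_univ, true_and, Fin.lt_def]
  have h2 : totalWeight w - ∑ k ∈ Finset.Iio i, w (a k) = ∑ k ∈ (drawn i a)ᶜ, w k := by
    have h3 : ∑ k ∈ Finset.Iio i, w (a k) = cum w i a := by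
      rw [cum_eq_sum ha]
      have h4 : Finset.Iio i = Finset.univ.filter fun k : Fin n => (k : ℕ) < i := by
        ext k; simp
      rw [h4]
    rw [h3, totalWeight, cum, ← Finset.sum_add_sum_compl (drawn i a) w]
    ring
  simp only [stepProb, h1, h2, ite_not]

/-- This replaces conditional expectation from here on: given the past, the next draw may be
averaged with size bias over the indices left. -/
theorem IsSizeBiasedOrder.integral_next {w : Fin n → ℝ} {μ : Measure (Fin n → Fin n)}
    [IsProbabilityMeasure μ] (h : IsSizeBiasedOrder w μ fun k a => a k) (i : Fin n)
    (Ψ : (Fin n → Fin n) → Fin n → ℝ) (hΨ : Adapted (i : ℕ) Ψ) :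
    ∫ a, Ψ a (a i) ∂μ = ∫ a, biasedMean w (Ψ a) (drawn i a)ᶜ ∂μ := by
  rw [h.integral_step i Ψ hΨ]
  apply integral_congr_ae
  filter_upwards [h.ae_injective] with a ha
  simp only [stepProb_of_injective ha, biasedMean, Finset.sum_div]
  rw [← Finset.sum_filter_add_sum_filter_not Finset.univ (· ∈ (drawn i a)ᶜ)]
  rw [Finset.sum_eq_zero (s := Finset.univ.filter fun x => ¬ x ∈ (drawn i a)ᶜ), add_zero]
  · rw [Finset.filter_mem_eq_inter, Finset.univ_inter]
    refine Finset.sum_congr rfl fun j hj => ?_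
    rw [if_pos hj]; ring
  · intro j hj
    rw [if_neg (by simpa using hj), zero_mul]

/-- The probability of a given order of all indices. -/
noncomputable def orderProb (w : Fin n → ℝ) (a : Fin n → Fin n) : ℝ := ∏ i, stepProb w i a (a i)

/-- Chain rule along the prefixes of `b`. The law is thereby pinned down on atoms, which allows the
comparison with the exponential clocks. -/
theorem IsSizeBiasedOrder.real_singleton {w : Fin n → ℝ} {μ : Measure (Fin n → Fin n)}
    [IsProbabilityMeasure μ] (h : IsSizeBiasedOrder w μ fun k a => a k) (b : Fin n → Fin n) :
    μ.real {b} = orderProb w b := by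
  have h1 : ∀ i : ℕ, i ≤ n → μ.real {a | ∀ k : Fin n, (k : ℕ) < i → a k = b k}
      = ∏ k ∈ Finset.univ.filter (fun k : Fin n => (k : ℕ) < i), stepProb w k b (b k) := by
    intro i
    induction i with
    | zero => intro _; simp
    | succ i ih =>
      intro hi
      have h2 := h.law ⟨i, hi⟩ b (b ⟨i, hi⟩)
      have h3 : {a : Fin n → Fin n | ∀ k : Fin n, (k : ℕ) < i + 1 → a k = b k}
          = {a | (∀ k, k < (⟨i, hi⟩ : Fin n) → a k = b k) ∧ a ⟨i, hi⟩ = b ⟨i, hi⟩} := by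
        ext a
        simp only [Set.mem_ofPred_eq, Fin.lt_def]
        constructor
        · intro hab
          exact ⟨fun k hk => hab k (by omega), hab _ (by simp)⟩
        · rintro ⟨h4, h5⟩ k hk
          rcases Nat.lt_succ_iff_lt_or_eq.1 hk with h | h
          · exact h4 k h
          · have : k = ⟨i, hi⟩ := Fin.ext h
            rw [this, h5]
      rw [h3, h2]
      have h4 := ih (by omega)
      simp only [Fin.lt_def]
      rw [h4]
      have h5 : (Finset.univ.filter fun k : Fin n => (k : ℕ) < i + 1)
          = insert ⟨i, hi⟩ (Finset.univ.filter fun k : Fin n => (k : ℕ) < i) := by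
        ext k
        simp only [Finset.mem_filter, Finset.mem_univ, true_and, Finset.mem_insert, Fin.ext_iff]
        omega
      rw [h5, Finset.prod_insert (by simp), mul_comm]
      rfl
  have h2 := h1 n le_rfl
  rw [Finset.filter_true_of_mem fun k _ => k.is_lt] at h2
  simp only [Fin.is_lt, forall_const] at h2
  rw [orderProb, ← h2]
  congr 1
  ext a
  simp [funext_iff]

/-- This removes the underlying probability space: afterwards only the image law on paths occurs. -/
theorem IsSizeBiasedOrder.map_path {w : Fin n → ℝ} {Ω : Type*} [MeasurableSpace Ω]
    {P : Measure Ω} [IsProbabilityMeasure P] {v : Fin n → Ω → Fin n}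
    (h : IsSizeBiasedOrder w P v) :
    IsSizeBiasedOrder w (P.map fun ω k => v k ω) fun k a => a k := by
  have hm : Measurable fun ω k => v k ω := measurable_pi_lambda _ h.measurable
  refine ⟨fun k => measurable_pi_apply k, fun i a j => ?_⟩
  have := h.law i a j
  rw [map_measureReal_apply hm (Set.toFinite _).measurableSet,
    map_measureReal_apply hm (Set.toFinite _).measurableSet]
  exact this

end Path


/-! ### Exponential supermartingales and a Freedman-type inequality. -/

section Freedman

variable {n : ℕ}

theorem biasedMean_const_mul (w f : Fin n → ℝ) (K : ℝ) (U : Finset (Fin n)) :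
    biasedMean w (fun j => K * f j) U = K * biasedMean w f U := by
  simp only [biasedMean, mul_left_comm _ K, ← Finset.mul_sum, mul_div_assoc]

theorem biasedMean_const {w : Fin n → ℝ} (hw : ∀ i, 0 < w i) (K : ℝ) {U : Finset (Fin n)}
    (hU : U.Nonempty) : biasedMean w (fun _ => K) U = K := by
  have : 0 < ∑ j ∈ U, w j := Finset.sum_pos (fun j _ => hw j) hU
  rw [biasedMean, ← Finset.sum_mul, mul_div_cancel_left₀ _ this.ne']

theorem biasedMean_add (w f g : Fin n → ℝ) (U : Finset (Fin n)) :
    biasedMean w (fun j => f j + g j) U = biasedMean w f U + biasedMean w g U := by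
  simp only [biasedMean, mul_add, Finset.sum_add_distrib, add_div]

theorem biasedMean_mono {w f g : Fin n → ℝ} (hw : ∀ i, 0 < w i) {U : Finset (Fin n)}
    (h : ∀ j ∈ U, f j ≤ g j) : biasedMean w f U ≤ biasedMean w g U := by
  unfold biasedMean
  have h1 : 0 ≤ ∑ j ∈ U, w j := Finset.sum_nonneg fun j _ => (hw j).le
  gcongr with j hj
  · exact (hw j).le
  · exact h j hj

theorem biasedMean_nonneg {w f : Fin n → ℝ} (hw : ∀ i, 0 < w i) {U : Finset (Fin n)}
    (h : ∀ j ∈ U, 0 ≤ f j) : 0 ≤ biasedMean w f U :=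
  div_nonneg (Finset.sum_nonneg fun j hj => mul_nonneg (hw j).le (h j hj))
    (Finset.sum_nonneg fun j _ => (hw j).le)

theorem compl_drawn_nonempty (a : Fin n → Fin n) {i : ℕ} (hi : i < n) :
    (drawn i a)ᶜ.Nonempty := by
  rw [← Finset.card_pos, Finset.card_compl, Fintype.card_fin]
  have := card_drawn_le a i
  omega

/-- A maximal inequality for the exponential supermartingale. -/
theorem IsSizeBiasedOrder.exp_maximal {w : Fin n → ℝ} {μ : Measure (Fin n → Fin n)}
    [IsProbabilityMeasure μ] (h : IsSizeBiasedOrder w μ fun k a => a k) (hw : ∀ i, 0 < w i)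
    (g : Fin n → ℝ) (lam X c : ℝ) (hc : 0 ≤ c) {l m : ℕ} (hlm : l ≤ m) (hmn : m ≤ n)
    (hstep : ∀ a : Fin n → Fin n, Function.Injective a → ∀ i, l ≤ i → i < m →
      biasedMean w (fun j => Real.exp (lam * (g j - drift w g i a))) (drawn i a)ᶜ ≤ Real.exp c) :
    μ.real {a | ∃ j, l ≤ j ∧ j ≤ m ∧ X ≤ lam * (mart w g j a - mart w g l a)}
      ≤ Real.exp (-X + c * ((m : ℝ) - l)) := by
  classical
  let A : ℕ → (Fin n → Fin n) → Prop := fun i a =>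
    ∃ j, l ≤ j ∧ j ≤ i ∧ X ≤ lam * (mart w g j a - mart w g l a)
  -- The compensator still to come, `c * (m - i)`, is added instead of subtracting the past one: `E`
  -- is a supermartingale and is at least 1 at a crossing. `F` freezes it at the value 1 from the
  -- first crossing on.
  let E : ℕ → (Fin n → Fin n) → ℝ := fun i a =>
    Real.exp (lam * (mart w g i a - mart w g l a) - X + c * ((m : ℝ) - i))
  let F : ℕ → (Fin n → Fin n) → ℝ := fun i a => if A i a then 1 else E i a
  have hA : ∀ i, l ≤ i → Adapted i (A i) := by
    intro i hi a b hab
    have : ∀ j, l ≤ j → j ≤ i → mart w g j a - mart w g l a = mart w g j b - mart w g l b := by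
      intro j _ hj'
      rw [(adapted_mart w g j).mono hj' a b hab, (adapted_mart w g l).mono hi a b hab]
    apply propext
    constructor
    · rintro ⟨j, h1, h2, h3⟩; exact ⟨j, h1, h2, by rw [← this j h1 h2]; exact h3⟩
    · rintro ⟨j, h1, h2, h3⟩; exact ⟨j, h1, h2, by rw [this j h1 h2]; exact h3⟩
  have claim : ∀ i, l ≤ i → i ≤ m → ∫ a, F i a ∂μ ≤ Real.exp (-X + c * ((m : ℝ) - l)) := by
    intro i hi
    induction i, hi using Nat.le_induction with
    | base =>
      intro _
      have : ∀ a, F l a ≤ Real.exp (-X + c * ((m : ℝ) - l)) := by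
        intro a
        simp only [F, E]
        split_ifs with hA
        · obtain ⟨j, h1, h2, h3⟩ := hA
          obtain rfl : j = l := le_antisymm h2 h1
          rw [sub_self, mul_zero] at h3
          have : (0 : ℝ) ≤ (m : ℝ) - j := by
            rw [sub_nonneg]; exact_mod_cast hlm
          exact Real.one_le_exp (by nlinarith)
        · apply Real.exp_le_exp.2
          rw [sub_self, mul_zero, zero_sub]
      calc ∫ a, F l a ∂μ ≤ ∫ _, Real.exp (-X + c * ((m : ℝ) - l)) ∂μ :=
            integral_mono (integrable_path _) (integrable_path _) this
        _ = _ := by simp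
    | succ i hi ih =>
      intro him
      refine le_trans ?_ (ih (by omega))
      let k : Fin n := ⟨i, by omega⟩
      let Ψ : (Fin n → Fin n) → Fin n → ℝ := fun a j =>
        if A i a then 1 else
          Real.exp (lam * (mart w g i a + (g j - drift w g i a) - mart w g l a) - X
            + c * ((m : ℝ) - ((i + 1 : ℕ) : ℝ)))
      have hΨ : Adapted (k : ℕ) Ψ := by
        intro a b hab
        funext j
        simp only [Ψ]
        rw [hA i hi a b hab, adapted_mart w g i a b hab, adapted_drift w g i a b hab,
          (adapted_mart w g l).mono hi a b hab]
      calc ∫ a, F (i + 1) a ∂μ ≤ ∫ a, Ψ a (a k) ∂μ := by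
            apply integral_mono_ae (integrable_path _) (integrable_path _)
            filter_upwards [h.ae_injective] with a ha
            have hm : mart w g (i + 1) a = mart w g i a + (g (a k) - drift w g i a) :=
              mart_succ ha w g k
            simp only [F, E, Ψ]
            by_cases h1 : A i a
            · have h2 : A (i + 1) a := by
                obtain ⟨j, h3, h4, h5⟩ := h1
                exact ⟨j, h3, by omega, h5⟩
              rw [if_pos h1, if_pos h2]
            · rw [if_neg h1, ← hm]
              split_ifs with h2
              · obtain ⟨j, h3, h4, h5⟩ := h2
                have hj : j = i + 1 := by
                  by_contra hne
                  exact h1 ⟨j, h3, by omega, h5⟩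
                subst hj
                have : (0 : ℝ) ≤ (m : ℝ) - ((i + 1 : ℕ) : ℝ) := by
                  rw [sub_nonneg]; exact_mod_cast him
                exact Real.one_le_exp (by nlinarith)
              · exact le_rfl
        _ = ∫ a, biasedMean w (Ψ a) (drawn i a)ᶜ ∂μ := h.integral_next k Ψ hΨ
        _ ≤ ∫ a, F i a ∂μ := by
            apply integral_mono_ae (integrable_path _) (integrable_path _)
            filter_upwards [h.ae_injective] with a ha
            have hne := compl_drawn_nonempty a (show i < n by omega)
            by_cases h1 : A i a
            · simp only [F, Ψ, if_pos h1]
              rw [biasedMean_const hw _ hne]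
            · simp only [F, Ψ, E, if_neg h1]
              have e1 : ∀ j, Real.exp (lam * (mart w g i a + (g j - drift w g i a) - mart w g l a)
                  - X + c * ((m : ℝ) - ((i + 1 : ℕ) : ℝ)))
                  = Real.exp (lam * (mart w g i a - mart w g l a) - X
                    + c * ((m : ℝ) - ((i + 1 : ℕ) : ℝ)))
                    * Real.exp (lam * (g j - drift w g i a)) := by
                intro j
                rw [← Real.exp_add]
                congr 1; ring
              simp_rw [e1]
              rw [biasedMean_const_mul]
              calc _ ≤ _ * Real.exp c :=
                    mul_le_mul_of_nonneg_left (hstep a ha i hi (by omega)) (Real.exp_pos _).le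
                _ = _ := by
                    rw [← Real.exp_add]
                    congr 1; push_cast; ring
  refine le_trans ?_ (claim m hlm le_rfl)
  calc μ.real {a | A m a} = ∫ a, Set.indicator {a | A m a} (fun _ => (1 : ℝ)) a ∂μ := by
        rw [integral_indicator_const _ (Set.toFinite _).measurableSet]; simp
    _ ≤ ∫ a, F m a ∂μ := by
        apply integral_mono (integrable_path _) (integrable_path _)
        intro a
        simp only [Set.indicator_apply, Set.mem_ofPred_eq, F, E]
        split_ifs
        · exact le_rfl
        · exact (Real.exp_pos _).le

theorem exp_le_one_add_sq {u : ℝ} (hu : |u| ≤ 1) : Real.exp u ≤ 1 + u + u ^ 2 := by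
  have := (abs_le.1 (Real.abs_exp_sub_one_sub_id_le hu)).2
  linarith

/-- The bound `exp u ≤ 1 + u + u ^ 2` is applied to the uncentred variable. The linear term is
cancelled by the factor `exp (-(lam * R))`, so a second moment suffices. -/
theorem biasedMean_exp_le {w : Fin n → ℝ} (hw : ∀ i, 0 < w i) (g : Fin n → ℝ) {lam V : ℝ}
    {U : Finset (Fin n)} (hU : U.Nonempty) (hg : ∀ j, |lam * g j| ≤ 1)
    (hV : biasedMean w (fun j => g j ^ 2) U ≤ V) :
    biasedMean w (fun j => Real.exp (lam * (g j - biasedMean w g U))) U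
      ≤ Real.exp (lam ^ 2 * V) := by
  set R := biasedMean w g U
  have h1 : ∀ j, Real.exp (lam * (g j - R)) = Real.exp (-(lam * R)) * Real.exp (lam * g j) := by
    intro j; rw [← Real.exp_add]; congr 1; ring
  simp_rw [h1]
  rw [biasedMean_const_mul]
  have h2 : biasedMean w (fun j => Real.exp (lam * g j)) U ≤ Real.exp (lam * R + lam ^ 2 * V) := by
    calc _ ≤ biasedMean w (fun j => (1 + lam * g j) + lam ^ 2 * g j ^ 2) U := by
          apply biasedMean_mono hw
          intro j _
          have := exp_le_one_add_sq (hg j)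
          rw [mul_pow] at this
          exact this
      _ = 1 + lam * R + lam ^ 2 * biasedMean w (fun j => g j ^ 2) U := by
          rw [biasedMean_add, biasedMean_add, biasedMean_const hw _ hU, biasedMean_const_mul,
            biasedMean_const_mul]
      _ ≤ lam * R + lam ^ 2 * V + 1 := by nlinarith [sq_nonneg lam]
      _ ≤ _ := Real.add_one_le_exp _
  calc _ ≤ Real.exp (-(lam * R)) * Real.exp (lam * R + lam ^ 2 * V) :=
        mul_le_mul_of_nonneg_left h2 (Real.exp_pos _).le
    _ = _ := by rw [← Real.exp_add]; congr 1; ring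

/-- A Freedman-type maximal inequality for the martingale part of `cum g`. -/
theorem IsSizeBiasedOrder.mart_tail {w : Fin n → ℝ} {μ : Measure (Fin n → Fin n)}
    [IsProbabilityMeasure μ] (h : IsSizeBiasedOrder w μ fun k a => a k) (hw : ∀ i, 0 < w i)
    (g : Fin n → ℝ) {b V T x : ℝ} (hV : 0 ≤ V) (hb : 0 < b) (hx : 0 < x)
    {l m : ℕ} (hlm : l ≤ m) (hmn : m ≤ n) (hgb : ∀ j, |g j| ≤ b)
    (hVar : ∀ a : Fin n → Fin n, Function.Injective a → ∀ i, l ≤ i → i < m →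
      biasedMean w (fun j => g j ^ 2) (drawn i a)ᶜ ≤ V) (hT : V * ((m : ℝ) - l) ≤ T) :
    μ.real {a | ∃ j, l ≤ j ∧ j ≤ m ∧ x ≤ |mart w g j a - mart w g l a|}
      ≤ 2 * Real.exp (-x ^ 2 / (4 * (T + b * x))) := by
  have hml : (0 : ℝ) ≤ (m : ℝ) - l := by
    rw [sub_nonneg]; exact_mod_cast hlm
  have hT0 : 0 ≤ T := le_trans (mul_nonneg hV hml) hT
  set D := T + b * x
  have hD : 0 < D := by positivity
  -- This minimises `-lam * x + lam ^ 2 * D`. The summand `b * x` in `D` is there to guarantee `lam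
  -- * b ≤ 1`.
  set lam := x / (2 * D)
  have hlam : 0 < lam := by positivity
  have hlb : lam * b ≤ 1 := by
    rw [div_mul_eq_mul_div, div_le_one (by positivity)]
    nlinarith
  have main : ∀ s : ℝ, |s| = lam →
      μ.real {a | ∃ j, l ≤ j ∧ j ≤ m ∧ lam * x ≤ s * (mart w g j a - mart w g l a)}
        ≤ Real.exp (-x ^ 2 / (4 * D)) := by
    intro s hs
    have hs2 : s ^ 2 = lam ^ 2 := by rw [← sq_abs, hs]
    refine (h.exp_maximal hw g s (lam * x) (lam ^ 2 * V) (by positivity) hlm hmn ?_).trans ?_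
    · intro a ha i hi him
      rw [← hs2]
      apply biasedMean_exp_le hw g (compl_drawn_nonempty a (by omega)) _ (hVar a ha i hi him)
      intro j
      rw [abs_mul, hs]
      exact (mul_le_mul_of_nonneg_left (hgb j) hlam.le).trans hlb
    · apply Real.exp_le_exp.2
      have h1 : lam ^ 2 * V * ((m : ℝ) - l) ≤ lam ^ 2 * D := by
        rw [mul_assoc]
        apply mul_le_mul_of_nonneg_left _ (sq_nonneg _)
        have : 0 ≤ b * x := by positivity
        simp only [D]; linarith
      have h2 : -(lam * x) + lam ^ 2 * D = -x ^ 2 / (4 * D) := by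
        simp only [lam]; field_simp; ring
      linarith
  have hsub : {a | ∃ j, l ≤ j ∧ j ≤ m ∧ x ≤ |mart w g j a - mart w g l a|}
      ⊆ {a | ∃ j, l ≤ j ∧ j ≤ m ∧ lam * x ≤ lam * (mart w g j a - mart w g l a)}
        ∪ {a | ∃ j, l ≤ j ∧ j ≤ m ∧ lam * x ≤ (-lam) * (mart w g j a - mart w g l a)} := by
    rintro a ⟨j, h1, h2, h3⟩
    rcases le_abs.1 h3 with h4 | h4
    · exact Or.inl ⟨j, h1, h2, mul_le_mul_of_nonneg_left h4 hlam.le⟩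
    · refine Or.inr ⟨j, h1, h2, ?_⟩
      rw [neg_mul, ← mul_neg]
      exact mul_le_mul_of_nonneg_left h4 hlam.le
  calc _ ≤ _ := measureReal_mono hsub
    _ ≤ _ := measureReal_union_le _ _
    _ ≤ _ := by
      have h1 := main lam (abs_of_pos hlam)
      have h2 := main (-lam) (by rw [abs_neg, abs_of_pos hlam])
      linarith

theorem IsSizeBiasedOrder.integral_mart {w : Fin n → ℝ} {μ : Measure (Fin n → Fin n)}
    [IsProbabilityMeasure μ] (h : IsSizeBiasedOrder w μ fun k a => a k) (hw : ∀ i, 0 < w i)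
    (g : Fin n → ℝ) {i : ℕ} (hi : i ≤ n) : ∫ a, mart w g i a ∂μ = 0 := by
  induction i with
  | zero => simp
  | succ i ih =>
    let k : Fin n := ⟨i, by omega⟩
    have h1 : ∫ a, mart w g (i + 1) a ∂μ = ∫ a, (mart w g i a + (g (a k) - drift w g i a)) ∂μ := by
      apply integral_congr_ae
      filter_upwards [h.ae_injective] with a ha
      exact mart_succ ha w g k
    rw [h1, integral_add (integrable_path _) (integrable_path _), ih (by omega), zero_add,
      h.integral_next k (fun a j => g j - drift w g i a) (fun a b hab => by
        funext j
        change g j - drift w g i a = g j - drift w g i b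
        rw [adapted_drift w g i a b hab])]
    have h2 : ∀ a, biasedMean w (fun j => g j - drift w g i a) (drawn (k : ℕ) a)ᶜ = 0 := by
      intro a
      simp only [sub_eq_add_neg]
      rw [biasedMean_add, biasedMean_const hw _ (compl_drawn_nonempty a (show i < n by omega))]
      exact add_neg_cancel _
    simp [h2]

end Freedman


/-! ### First-order expansion of the drift during the first draws. -/

section Short

variable {n : ℕ}

theorem abs_ratio_sub_le {Q q L s : ℝ} (hL : 0 < L) (hs0 : 0 ≤ s) (hs : s ≤ L / 2)
    (hQ : 0 ≤ Q) (hq : 0 ≤ q) : |(Q - q) / (L - s) - Q / L| ≤ 2 * (Q / L * s + q) / L := by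
  have h1 : 0 < L - s := by linarith
  have h2 : (Q - q) / (L - s) - Q / L = (Q / L * s - q) / (L - s) := by
    field_simp; ring
  have h3 : |Q / L * s - q| ≤ Q / L * s + q := by
    rw [abs_le]
    have : 0 ≤ Q / L * s := by positivity
    constructor <;> linarith
  have h4 : 0 ≤ Q / L * s + q := by positivity
  rw [h2, abs_div, abs_of_pos h1, div_le_div_iff₀ h1 hL]
  calc |Q / L * s - q| * L ≤ (Q / L * s + q) * L := by gcongr
    _ ≤ (Q / L * s + q) * (2 * (L - s)) := by gcongr; linarith
    _ = _ := by ring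

/-- The remainder is kept in exact form as a product of two small factors, so the first-order bound
`abs_ratio_sub_le` alone makes it second order. -/
theorem ratio_expansion {Q q L s : ℝ} (hL : 0 < L) (hs : s ≤ L / 2) :
    (Q - q) / (L - s) = Q / L - q / L + Q * s / L ^ 2 + s / L * ((Q - q) / (L - s) - Q / L) := by
  have h1 : L - s ≠ 0 := by linarith
  field_simp
  ring

theorem drift_eq (w g : Fin n → ℝ) (i : ℕ) (a : Fin n → Fin n) :
    drift w g i a = (∑ j, w j * g j - cum (fun j => w j * g j) i a)
      / (totalWeight w - cum w i a) := by
  rw [drift, biasedMean, cum, cum, totalWeight,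
    ← Finset.sum_add_sum_compl (drawn i a) w,
    ← Finset.sum_add_sum_compl (drawn i a) fun j => w j * g j]
  congr 1 <;> ring

theorem abs_drift_sub_le {w g : Fin n → ℝ} {i : ℕ} {a : Fin n → Fin n} (hw : ∀ j, 0 < w j)
    (hg : ∀ j, 0 ≤ g j) (hL : 0 < totalWeight w) (hs : cum w i a ≤ totalWeight w / 2) :
    |drift w g i a - (∑ j, w j * g j) / totalWeight w|
      ≤ 2 * ((∑ j, w j * g j) / totalWeight w * cum w i a + cum (fun j => w j * g j) i a)
        / totalWeight w := by
  rw [drift_eq]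
  exact abs_ratio_sub_le hL (Finset.sum_nonneg fun j _ => (hw j).le) hs
    (Finset.sum_nonneg fun j _ => mul_nonneg (hw j).le (hg j))
    (Finset.sum_nonneg fun j _ => mul_nonneg (hw j).le (hg j))

/-- The squared weights, restricted to the indices with `w j * m ≤ ℓ`. -/
noncomputable def lightSq (w : Fin n → ℝ) (m : ℕ) (j : Fin n) : ℝ :=
  if w j * m ≤ totalWeight w then w j ^ 2 else 0

theorem lightSq_nonneg (w : Fin n → ℝ) (m : ℕ) (j : Fin n) : 0 ≤ lightSq w m j := by
  unfold lightSq; split_ifs <;> positivity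

theorem lightSq_le (w : Fin n → ℝ) (m : ℕ) (j : Fin n) : lightSq w m j ≤ w j ^ 2 := by
  unfold lightSq; split_ifs
  · exact le_rfl
  · positivity

/-- The smallness of the cube sums over sets of at most `m` indices, together with bounds for the
total sums of squares and cubes. -/
structure SmallSets (w : Fin n → ℝ) (κ η : ℝ) (m : ℕ) : Prop where
  pos : ∀ j, 0 < w j
  total_pos : 0 < totalWeight w
  square_le : ∑ j, w j ^ 2 ≤ 2 * totalWeight w
  cube_le : ∑ j, w j ^ 3 ≤ κ * totalWeight w
  cube_small : ∀ I : Finset (Fin n), I.card ≤ m → ∑ j ∈ I, w j ^ 3 ≤ η * totalWeight w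
  card_small : (m : ℝ) ≤ η * totalWeight w
  eta_le : η ≤ 1 / 4
  eta_nonneg : 0 ≤ η
  kappa_ge : 1 ≤ κ

namespace SmallSets

variable {w : Fin n → ℝ} {κ η : ℝ} {m : ℕ}

/-- Both `w` and `w ^ 2` are at most `1 + w ^ 3`, so smallness of the cardinality and of the cube
sums is enough. -/
theorem sum_le (h : SmallSets w κ η m) {I : Finset (Fin n)} (hI : I.card ≤ m) :
    ∑ j ∈ I, w j ≤ 2 * η * totalWeight w ∧ ∑ j ∈ I, w j ^ 2 ≤ 2 * η * totalWeight w := by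
  have h1 : ∀ f : Fin n → ℝ, (∀ j, f j ≤ 1 + w j ^ 3) →
      ∑ j ∈ I, f j ≤ 2 * η * totalWeight w := by
    intro f hf
    calc ∑ j ∈ I, f j ≤ ∑ j ∈ I, (1 + w j ^ 3) := Finset.sum_le_sum fun j _ => hf j
      _ = (I.card : ℝ) + ∑ j ∈ I, w j ^ 3 := by simp [Finset.sum_add_distrib]
      _ ≤ η * totalWeight w + η * totalWeight w := by
          gcongr
          · exact le_trans (by exact_mod_cast hI) h.card_small
          · exact h.cube_small I hI
      _ = _ := by ring
  have hw := fun j => (h.pos j).le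
  refine ⟨h1 _ fun j => ?_, h1 _ fun j => ?_⟩
  · rcases le_total (w j) 1 with h2 | h2
    · have := pow_nonneg (hw j) 3; linarith
    · have : w j ^ 1 ≤ w j ^ 3 := pow_le_pow_right₀ h2 (by norm_num)
      linarith
  · rcases le_total (w j) 1 with h2 | h2
    · have := pow_nonneg (hw j) 3
      have : w j ^ 2 ≤ 1 := pow_le_one₀ (hw j) h2
      linarith
    · have : w j ^ 2 ≤ w j ^ 3 := pow_le_pow_right₀ h2 (by norm_num)
      linarith

theorem cum_le_half (h : SmallSets w κ η m) (a : Fin n → Fin n) {i : ℕ} (hi : i ≤ m) :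
    cum w i a ≤ totalWeight w / 2 := by
  have := (h.sum_le ((card_drawn_le a i).trans hi)).1
  have h2 := h.eta_le
  have h3 := h.total_pos
  unfold cum
  nlinarith

/-- After at most `m` draws half of the total weight is left, so conditional second moments are
controlled by the ratio of cubes to weights. -/
theorem biasedMean_le (h : SmallSets w κ η m) (a : Fin n → Fin n) {i : ℕ} (hi : i ≤ m)
    {g : Fin n → ℝ} {K : ℝ} (hK : 0 ≤ K) (hg : ∀ j, g j ≤ K * w j ^ 2) :
    biasedMean w g (drawn i a)ᶜ ≤ 2 * κ * K := by
  have hL := h.total_pos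
  have h1 : totalWeight w / 2 ≤ ∑ j ∈ (drawn i a)ᶜ, w j := by
    have := h.cum_le_half a hi
    have h2 := Finset.sum_add_sum_compl (drawn i a) w
    unfold cum at this
    unfold totalWeight at *
    linarith
  have h2 : ∑ j ∈ (drawn i a)ᶜ, w j * g j ≤ K * (κ * totalWeight w) := by
    calc _ ≤ ∑ j ∈ (drawn i a)ᶜ, K * w j ^ 3 := by
          apply Finset.sum_le_sum
          intro j _
          have := mul_le_mul_of_nonneg_left (hg j) (h.pos j).le
          calc _ ≤ _ := this
            _ = _ := by ring
      _ = K * ∑ j ∈ (drawn i a)ᶜ, w j ^ 3 := by rw [Finset.mul_sum]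
      _ ≤ K * ∑ j, w j ^ 3 := by
          gcongr
          · exact fun j _ _ => pow_nonneg (h.pos j).le 3
          · exact Finset.subset_univ _
      _ ≤ _ := by gcongr; exact h.cube_le
  rw [biasedMean, div_le_iff₀ (by linarith)]
  have := h.kappa_ge
  calc _ ≤ _ := h2
    _ = 2 * κ * K * (totalWeight w / 2) := by ring
    _ ≤ _ := by gcongr

/-- The deterministic part of the drift after `i` draws. -/
noncomputable def driftMean (w : Fin n → ℝ) (m i : ℕ) : ℝ :=
  (∑ j, w j ^ 2) / totalWeight w
    - (i * ((∑ j, w j * lightSq w m j) / totalWeight w)) / totalWeight w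
    + (∑ j, w j ^ 2) / totalWeight w ^ 2 * (i * ((∑ j, w j ^ 2) / totalWeight w))

/-- The first-order random part of the drift after `i` draws. -/
noncomputable def driftNoise (w : Fin n → ℝ) (m i : ℕ) (a : Fin n → Fin n) : ℝ :=
  -(mart w (lightSq w m) i a / totalWeight w)
    + (∑ j, w j ^ 2) / totalWeight w ^ 2 * mart w w i a

theorem abs_cum_sub_mart_le {g : Fin n → ℝ} {a : Fin n → Fin n} {i : ℕ} {c e : ℝ}
    (hi : i ≤ m) (he : 0 ≤ e) (hd : ∀ k < i, |drift w g k a - c| ≤ e) :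
    |cum g i a - mart w g i a - i * c| ≤ m * e := by
  have h1 : cum g i a - mart w g i a - i * c = ∑ k ∈ Finset.range i, (drift w g k a - c) := by
    simp [mart]
  rw [h1]
  calc _ ≤ ∑ k ∈ Finset.range i, |drift w g k a - c| := Finset.abs_sum_le_sum_abs _ _
    _ ≤ ∑ k ∈ Finset.range i, e := Finset.sum_le_sum fun k hk => hd k (Finset.mem_range.1 hk)
    _ = i * e := by simp
    _ ≤ _ := by gcongr

/-- The sums of weights and squares drawn so far enter the drift linearly up to a product error.
Each is replaced by its martingale plus `i` times the initial drift. Drifts move by `O(η)`, so this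
costs `O(m η)`, and division by the total weight gives the stated order. Squares are first
restricted to light indices, so that their martingale will have controlled jumps. -/
theorem drift_expansion (h : SmallSets w κ η m) (a : Fin n → Fin n)
    {i : ℕ} (hi : i ≤ m) :
    |drift w w i a - driftMean w m i - driftNoise w m i a|
      ≤ (37 + 4 * κ) * η * m / totalWeight w := by
  have hL := h.total_pos
  have hη := h.eta_nonneg
  have hκ := h.kappa_ge
  have hw := fun j => (h.pos j).le
  set L := totalWeight w with hLdef
  set Q := ∑ j, w j ^ 2 with hQdef
  have hQ0 : 0 ≤ Q := Finset.sum_nonneg fun j _ => sq_nonneg _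
  have hQL : Q / L ≤ 2 := by rw [div_le_iff₀ hL]; exact h.square_le
  have hQL0 : 0 ≤ Q / L := by positivity
  have ecard : ∀ k ≤ m, (drawn k a).card ≤ m := fun k hk => (card_drawn_le a k).trans hk
  have hww : ∑ j, w j * w j = Q := Finset.sum_congr rfl fun j _ => (sq (w j)).symm
  have cww : ∀ k, cum (fun j => w j * w j) k a = cum (fun j => w j ^ 2) k a := fun k =>
    Finset.sum_congr rfl fun j _ => (sq (w j)).symm
  have hS0 : ∀ k, 0 ≤ cum w k a := fun k => Finset.sum_nonneg fun j _ => hw j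
  have hq0 : ∀ k, 0 ≤ cum (fun j => w j ^ 2) k a := fun k =>
    Finset.sum_nonneg fun j _ => sq_nonneg _
  have hS : ∀ k ≤ m, cum w k a ≤ 2 * η * L := fun k hk => (h.sum_le (ecard k hk)).1
  have hq : ∀ k ≤ m, cum (fun j => w j ^ 2) k a ≤ 2 * η * L := fun k hk =>
    (h.sum_le (ecard k hk)).2
  have hc : ∀ k ≤ m, cum (fun j => w j ^ 3) k a ≤ η * L := fun k hk =>
    h.cube_small _ (ecard k hk)
  -- the drift of the weights
  have d1 : ∀ k ≤ m, |drift w w k a - Q / L|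
      ≤ 2 * (2 * cum w k a + cum (fun j => w j ^ 2) k a) / L := by
    intro k hk
    have := abs_drift_sub_le (i := k) (a := a) h.pos hw hL (h.cum_le_half a hk)
    rw [hww, cww, ← hLdef] at this
    refine this.trans ?_
    have := hS0 k
    gcongr
  have d1' : ∀ k ≤ m, |drift w w k a - Q / L| ≤ 12 * η := by
    intro k hk
    refine (d1 k hk).trans ?_
    rw [div_le_iff₀ hL]
    nlinarith [hS k hk, hq k hk]
  have hSM : |cum w i a - mart w w i a - i * (Q / L)| ≤ m * (12 * η) :=
    abs_cum_sub_mart_le hi (by positivity) fun k hk => d1' k (by omega)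
  -- the drift of the light squares
  set Cl := ∑ j, w j * lightSq w m j with hCl
  have hCl0 : 0 ≤ Cl := Finset.sum_nonneg fun j _ => mul_nonneg (hw j) (lightSq_nonneg w m j)
  have hlc : ∀ j, w j * lightSq w m j ≤ w j ^ 3 := fun j => by
    calc _ ≤ w j * w j ^ 2 := mul_le_mul_of_nonneg_left (lightSq_le w m j) (hw j)
      _ = _ := by ring
  have hClL : Cl / L ≤ κ := by
    rw [div_le_iff₀ hL]
    exact (Finset.sum_le_sum fun j _ => hlc j).trans h.cube_le
  have d2 : ∀ k ≤ m, |drift w (lightSq w m) k a - Cl / L| ≤ (4 * κ + 2) * η := by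
    intro k hk
    have := abs_drift_sub_le (i := k) (a := a) h.pos (lightSq_nonneg w m) hL (h.cum_le_half a hk)
    rw [← hLdef] at this
    refine this.trans ?_
    have h1 : cum (fun j => w j * lightSq w m j) k a ≤ η * L :=
      (Finset.sum_le_sum fun j _ => hlc j).trans (hc k hk)
    have h2 : Cl / L * cum w k a ≤ κ * (2 * η * L) := by
      gcongr
      · exact hS0 k
      · exact hS k hk
    rw [div_le_iff₀ hL]
    nlinarith
  have hNl : |cum (lightSq w m) i a - mart w (lightSq w m) i a - i * (Cl / L)|
      ≤ m * ((4 * κ + 2) * η) :=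
    abs_cum_sub_mart_le hi (by positivity) fun k hk => d2 k (by omega)
  -- A heavy index has `w j * m > L`, hence `w j ^ 2 ≤ m / L * w j ^ 3`, and the cube sum over few
  -- indices is small.
  have hheavy : |cum (fun j => w j ^ 2) i a - cum (lightSq w m) i a| ≤ m * η := by
    have h1 : cum (fun j => w j ^ 2) i a - cum (lightSq w m) i a
        = ∑ j ∈ drawn i a, (w j ^ 2 - lightSq w m j) := by
      rw [cum, cum, Finset.sum_sub_distrib]
    rw [h1, abs_of_nonneg (Finset.sum_nonneg fun j _ => sub_nonneg.2 (lightSq_le w m j))]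
    calc _ ≤ ∑ j ∈ drawn i a, m / L * w j ^ 3 := by
          apply Finset.sum_le_sum
          intro j _
          unfold lightSq
          split_ifs with h2
          · rw [sub_self]
            have := pow_nonneg (hw j) 3
            positivity
          · rw [sub_zero, div_mul_eq_mul_div, le_div_iff₀ hL]
            have h3 : L ≤ w j * m := (not_le.1 h2).le
            calc w j ^ 2 * L ≤ w j ^ 2 * (w j * m) := by gcongr
              _ = _ := by ring
      _ = m / L * cum (fun j => w j ^ 3) i a := by rw [← Finset.mul_sum]; rfl
      _ ≤ m / L * (η * L) := by gcongr; exact hc i hi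
      _ = _ := by field_simp
  -- the quadratic error
  have hcast : ((drawn i a).card : ℝ) ≤ m := by exact_mod_cast ecard i hi
  have q1 : cum w i a * cum w i a ≤ m * (2 * η * L) := by
    have h1 := sq_sum_le_card_mul_sum_sq (s := drawn i a) (f := w)
    calc cum w i a * cum w i a = (∑ j ∈ drawn i a, w j) ^ 2 := by rw [sq]; rfl
      _ ≤ _ := h1
      _ ≤ m * (2 * η * L) := by
          have := hq i hi
          have h0 := hq0 i
          unfold cum at this h0
          gcongr
  -- Chebyshev's sum inequality: weights and their squares are similarly ordered, so the product is
  -- at most the cardinality times the sum of cubes.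
  have q2 : cum w i a * cum (fun j => w j ^ 2) i a ≤ m * (η * L) := by
    have hmono : MonovaryOn w (fun j => w j ^ 2) (drawn i a : Set (Fin n)) := by
      intro x _ y _ hxy
      exact (lt_of_pow_lt_pow_left₀ 2 (hw y) hxy).le
    have h1 := hmono.sum_mul_sum_le_card_mul_sum
    calc _ ≤ ((drawn i a).card : ℝ) * ∑ j ∈ drawn i a, w j * w j ^ 2 := h1
      _ = ((drawn i a).card : ℝ) * cum (fun j => w j ^ 3) i a := by
          congr 1; exact Finset.sum_congr rfl fun j _ => by ring
      _ ≤ m * (η * L) := by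
          have h0 : 0 ≤ cum (fun j => w j ^ 3) i a :=
            Finset.sum_nonneg fun j _ => pow_nonneg (hw j) 3
          gcongr
          exact hc i hi
  have hR : drift w w i a = (Q - cum (fun j => w j ^ 2) i a) / (L - cum w i a) := by
    rw [drift_eq, hww, cww]
  have hexp := ratio_expansion (Q := Q) (q := cum (fun j => w j ^ 2) i a) hL
    (h.cum_le_half a hi)
  rw [← hR] at hexp
  set R := drift w w i a
  set S := cum w i a
  set q := cum (fun j => w j ^ 2) i a
  have he1 : |S / L * (R - Q / L)| ≤ 10 * η * m / L := by
    rw [abs_mul, abs_of_nonneg (div_nonneg (hS0 i) hL.le)]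
    calc _ ≤ S / L * (2 * (2 * S + q) / L) :=
          mul_le_mul_of_nonneg_left (d1 i hi) (div_nonneg (hS0 i) hL.le)
      _ = (4 * (S * S) + 2 * (S * q)) / L ^ 2 := by field_simp; ring
      _ ≤ (4 * (m * (2 * η * L)) + 2 * (m * (η * L))) / L ^ 2 := by gcongr
      _ = _ := by field_simp; ring
  have hfin : R - driftMean w m i - driftNoise w m i a
      = S / L * (R - Q / L)
        - ((q - cum (lightSq w m) i a)
            + (cum (lightSq w m) i a - mart w (lightSq w m) i a - i * (Cl / L))) / L
        + Q / L / L * (S - mart w w i a - i * (Q / L)) := by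
    rw [driftMean, driftNoise, ← hLdef, ← hQdef, ← hCl]
    nth_rw 1 [hexp]
    ring
  rw [hfin]
  have t2 : |((q - cum (lightSq w m) i a)
      + (cum (lightSq w m) i a - mart w (lightSq w m) i a - i * (Cl / L))) / L|
      ≤ (m * η + m * ((4 * κ + 2) * η)) / L := by
    rw [abs_div, abs_of_pos hL]
    gcongr
    exact (abs_add_le _ _).trans (add_le_add hheavy hNl)
  have t3 : |Q / L / L * (S - mart w w i a - i * (Q / L))| ≤ 2 / L * (m * (12 * η)) := by
    rw [abs_mul, abs_of_nonneg (div_nonneg hQL0 hL.le)]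
    gcongr
  -- The constant is 10 for the quadratic error, 1 for the heavy indices, `4 * κ + 2` for the light
  -- squares and 24 for the weights.
  calc _ ≤ 10 * η * m / L + (m * η + m * ((4 * κ + 2) * η)) / L + 2 / L * (m * (12 * η)) :=
        (abs_add_le _ _).trans (add_le_add ((abs_sub _ _).trans (add_le_add he1 t2)) t3)
    _ = _ := by ring

end SmallSets

end Short


/-! ### Deviations of windows among the first draws. -/

section ShortTail

variable {n : ℕ} {w : Fin n → ℝ} {κ η : ℝ} {m : ℕ}

namespace SmallSets

/-- The part of the window sum which is neither deterministic nor a martingale increment. -/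
noncomputable def windowError (w : Fin n → ℝ) (m l j : ℕ) (a : Fin n → Fin n) : ℝ :=
  ∑ i ∈ Finset.Ico l j, (drift w w i a - driftMean w m i - driftNoise w m i a)

theorem cum_sub_cum (w : Fin n → ℝ) (m : ℕ) {l j : ℕ} (hlj : l ≤ j) (a : Fin n → Fin n) :
    cum w j a - cum w l a = ∑ i ∈ Finset.Ico l j, driftMean w m i
      + (mart w w j a - mart w w l a) + ∑ i ∈ Finset.Ico l j, driftNoise w m i a
      + windowError w m l j a := by
  have h1 : cum w j a - cum w l a
      = (mart w w j a - mart w w l a) + ∑ i ∈ Finset.Ico l j, drift w w i a := by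
    rw [Finset.sum_Ico_eq_sub _ hlj, mart, mart]; ring
  rw [h1, windowError, Finset.sum_sub_distrib, Finset.sum_sub_distrib]
  ring

theorem abs_windowError_le (h : SmallSets w κ η m) {l j : ℕ} (hlj : l ≤ j) (hjm : j ≤ m)
    (a : Fin n → Fin n) :
    |windowError w m l j a| ≤ ((m : ℝ) - l) * ((37 + 4 * κ) * η * m / totalWeight w) := by
  have h0 : 0 ≤ (37 + 4 * κ) * η * m / totalWeight w := by
    have := h.kappa_ge
    have := h.eta_nonneg
    have := h.total_pos
    positivity
  calc _ ≤ ∑ i ∈ Finset.Ico l j, |drift w w i a - driftMean w m i - driftNoise w m i a| :=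
        Finset.abs_sum_le_sum_abs _ _
    _ ≤ ∑ i ∈ Finset.Ico l j, (37 + 4 * κ) * η * m / totalWeight w :=
        Finset.sum_le_sum fun i hi => h.drift_expansion a (by
          have := (Finset.mem_Ico.1 hi).2; omega)
    _ = ((j : ℝ) - l) * ((37 + 4 * κ) * η * m / totalWeight w) := by
        rw [Finset.sum_const, Nat.card_Ico, nsmul_eq_mul, Nat.cast_sub hlj]
    _ ≤ _ := by
        have : (j : ℝ) ≤ m := by exact_mod_cast hjm
        gcongr

/-- The noise at time `i` involves martingales started at time 0. A window therefore sees their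
maximum over all `m` draws, reduced by the factor length over total weight. -/
theorem abs_sum_driftNoise_le (h : SmallSets w κ η m) {l j : ℕ} (hlj : l ≤ j) (hjm : j ≤ m)
    (a : Fin n → Fin n) {x y : ℝ} (hx : ∀ i < m, |mart w (lightSq w m) i a| ≤ x)
    (hy : ∀ i < m, |mart w w i a| ≤ y) (hx0 : 0 ≤ x) (hy0 : 0 ≤ y) :
    |∑ i ∈ Finset.Ico l j, driftNoise w m i a|
      ≤ ((m : ℝ) - l) * (x / totalWeight w + 2 / totalWeight w * y) := by
  have hL := h.total_pos
  have hQ : (∑ j, w j ^ 2) / totalWeight w ^ 2 ≤ 2 / totalWeight w := by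
    rw [div_le_div_iff₀ (by positivity) hL]
    nlinarith [h.square_le]
  have hQ0 : 0 ≤ (∑ j, w j ^ 2) / totalWeight w ^ 2 := by positivity
  calc _ ≤ ∑ i ∈ Finset.Ico l j, |driftNoise w m i a| := Finset.abs_sum_le_sum_abs _ _
    _ ≤ ∑ i ∈ Finset.Ico l j, (x / totalWeight w + 2 / totalWeight w * y) := by
        apply Finset.sum_le_sum
        intro i hi
        have him : i < m := by have := (Finset.mem_Ico.1 hi).2; omega
        refine (abs_add_le _ _).trans (add_le_add ?_ ?_)
        · rw [abs_neg, abs_div, abs_of_pos hL]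
          gcongr
          exact hx i him
        · rw [abs_mul, abs_of_nonneg hQ0]
          gcongr
          exact hy i him
    _ = ((j : ℝ) - l) * (x / totalWeight w + 2 / totalWeight w * y) := by
        rw [Finset.sum_const, Nat.card_Ico, nsmul_eq_mul, Nat.cast_sub hlj]
    _ ≤ _ := by
        have : (j : ℝ) ≤ m := by exact_mod_cast hjm
        gcongr

/-- The martingale parts are centred, so subtracting the mean removes the deterministic drift and
leaves only the mean of the error. -/
theorem integral_window (h : SmallSets w κ η m) {μ : Measure (Fin n → Fin n)}
    [IsProbabilityMeasure μ] (hμ : IsSizeBiasedOrder w μ fun k a => a k) (hmn : m ≤ n)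
    {l j : ℕ} (hlj : l ≤ j) (hjm : j ≤ m) :
    ∫ a, (cum w j a - cum w l a) ∂μ
      = ∑ i ∈ Finset.Ico l j, driftMean w m i + ∫ a, windowError w m l j a ∂μ := by
  have h0 : ∀ i ≤ n, ∫ a, mart w w i a ∂μ = 0 := fun i hi => hμ.integral_mart h.pos w hi
  have h1 : ∀ i ≤ n, ∫ a, driftNoise w m i a ∂μ = 0 := by
    intro i hi
    unfold driftNoise
    rw [integral_add (integrable_path _) (integrable_path _), integral_neg, integral_div,
      integral_const_mul, h0 i hi, hμ.integral_mart h.pos (lightSq w m) hi]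
    simp
  have h2 : ∫ a, ∑ i ∈ Finset.Ico l j, driftNoise w m i a ∂μ = 0 := by
    rw [integral_finsetSum _ fun _ _ => integrable_path _]
    exact Finset.sum_eq_zero fun i hi => h1 i (by have := (Finset.mem_Ico.1 hi).2; omega)
  simp_rw [cum_sub_cum w m hlj]
  rw [integral_add (integrable_path _) (integrable_path _),
    integral_add (integrable_path _) (integrable_path _),
    integral_add (integrable_path _) (integrable_path _),
    integral_sub (integrable_path _) (integrable_path _), h0 j (by omega), h0 l (by omega), h2]
  simp

/-- The deviation inequality for a window inside the first `m` draws, `m` small. -/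
theorem window_tail (h : SmallSets w κ η m) {μ : Measure (Fin n → Fin n)}
    [IsProbabilityMeasure μ] (hμ : IsSizeBiasedOrder w μ fun k a => a k) (hmn : m ≤ n)
    {l : ℕ} (hlm : l < m) {b y : ℝ} (hb : 0 < b) (hwb : ∀ j, w j ≤ b) (hy : 0 < y)
    (herr : ((m : ℝ) - l) * ((37 + 4 * κ) * η * m / totalWeight w) ≤ y / 16) :
    μ.real {a | ∃ j, l ≤ j ∧ j ≤ m ∧
        y / 2 ≤ |cum w j a - cum w l a - ∫ a', (cum w j a' - cum w l a') ∂μ|}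
      ≤ 6 * Real.exp (-y ^ 2 / (2048 * κ * (y * b + ((m : ℝ) - l)))) := by
  set L := totalWeight w with hLdef
  set k := (m : ℝ) - l with hk
  have hκ := h.kappa_ge
  have hL : 0 < L := h.total_pos
  have hkpos : 0 < k := by
    rw [hk, sub_pos]; exact_mod_cast hlm
  have hm0 : (0 : ℝ) < m := by exact_mod_cast (by omega : 0 < m)
  have hkm : k ≤ m := by
    rw [hk]; have : (0 : ℝ) ≤ l := Nat.cast_nonneg l
    linarith
  have hmL : (m : ℝ) ≤ L := by
    have h1 := h.card_small
    have h2 := h.eta_le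
    rw [← hLdef] at h1
    nlinarith
  -- The budget `y / 2` is split into `y / 8` for the martingale, `y / 4` for the noise (one half
  -- from `E2`, one half from `E3`), and `y / 16` each for the error and its mean.
  let E1 : Set (Fin n → Fin n) := {a | ∃ j, l ≤ j ∧ j ≤ m ∧ y / 8 ≤ |mart w w j a - mart w w l a|}
  let E2 : Set (Fin n → Fin n) := {a | ∃ j, 0 ≤ j ∧ j ≤ m ∧
    y * L / (8 * k) ≤ |mart w (lightSq w m) j a - mart w (lightSq w m) 0 a|}
  let E3 : Set (Fin n → Fin n) := {a | ∃ j, 0 ≤ j ∧ j ≤ m ∧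
    y * L / (16 * k) ≤ |mart w w j a - mart w w 0 a|}
  set D := 2048 * κ * (y * b + k) with hD
  have hDpos : 0 < D := by positivity
  have hww : ∀ j, |w j| ≤ b := fun j => by rw [abs_of_pos (h.pos j)]; exact hwb j
  have hVw : ∀ a : Fin n → Fin n, Function.Injective a → ∀ i, i < m →
      biasedMean w (fun j => w j ^ 2) (drawn i a)ᶜ ≤ 2 * κ := by
    intro a _ i hi
    have := h.biasedMean_le a hi.le (g := fun j => w j ^ 2) zero_le_one (by simp)
    linarith
  have exp_bound : ∀ X G : ℝ, 0 < G → G * y ^ 2 ≤ X * D → 2 * Real.exp (-X / G)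
      ≤ 2 * Real.exp (-y ^ 2 / D) := by
    intro X G hG hX
    have : y ^ 2 / D ≤ X / G := by
      rw [div_le_div_iff₀ hDpos hG]; linarith
    gcongr 2 * Real.exp ?_
    rw [neg_div, neg_div]; linarith
  have p1 : μ.real E1 ≤ 2 * Real.exp (-y ^ 2 / D) := by
    refine (hμ.mart_tail h.pos w (V := 2 * κ) (T := 2 * κ * k) (by positivity) hb
      (by positivity : 0 < y / 8) hlm.le hmn hww (fun a ha i _ hi => hVw a ha i hi) le_rfl).trans ?_
    apply exp_bound _ _ (by positivity)
    have : 4 * (2 * κ * k + b * (y / 8)) ≤ (1 / 8) ^ 2 * D := by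
      rw [hD]; nlinarith [mul_pos hy hb, mul_pos (mul_pos hy hb) (by linarith : 0 < κ)]
    calc _ ≤ (1 / 8) ^ 2 * D * y ^ 2 := by gcongr
      _ = _ := by ring
  have p3 : μ.real E3 ≤ 2 * Real.exp (-y ^ 2 / D) := by
    refine (hμ.mart_tail h.pos w (V := 2 * κ) (T := 2 * κ * m) (x := y * L / (16 * k))
      (by positivity) hb
      (by positivity) (Nat.zero_le m) hmn hww (fun a ha i _ hi => hVw a ha i hi)
      (by simp)).trans ?_
    apply exp_bound _ _ (by positivity)
    -- Variance is accumulated over `m` draws instead of `k`, but the threshold has grown by `L /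
    -- k`; the gain wins because `k ≤ m ≤ L`.
    have e1 : 2 * κ * m ≤ 2 * κ * k * (L / k) ^ 2 := by
      have : (m : ℝ) ≤ k * (L / k) ^ 2 := by
        have : k * (L / k) ^ 2 = L * L / k := by field_simp
        rw [this, le_div_iff₀ hkpos]
        exact mul_le_mul hmL (hkm.trans hmL) hkpos.le hL.le
      calc _ ≤ 2 * κ * (k * (L / k) ^ 2) := by gcongr
        _ = _ := by ring
    have e2 : b * (y * L / (16 * k)) ≤ b * y * (L / k) ^ 2 / 16 := by
      have h1 : 1 ≤ L / k := by rw [le_div_iff₀ hkpos]; linarith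
      have h2 : L / k ≤ (L / k) ^ 2 := by nlinarith
      calc b * (y * L / (16 * k)) = b * y * (L / k) / 16 := by field_simp
        _ ≤ _ := by gcongr
    have e3 : 4 * (2 * κ * k + b * y / 16) ≤ (1 / 16) ^ 2 * D := by
      rw [hD]; nlinarith [mul_pos hy hb, mul_pos (mul_pos hy hb) (by linarith : 0 < κ)]
    calc 4 * (2 * κ * m + b * (y * L / (16 * k))) * y ^ 2
        ≤ 4 * (2 * κ * k * (L / k) ^ 2 + b * y * (L / k) ^ 2 / 16) * y ^ 2 := by gcongr
      _ = 4 * (2 * κ * k + b * y / 16) * (L / k) ^ 2 * y ^ 2 := by ring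
      _ ≤ (1 / 16) ^ 2 * D * (L / k) ^ 2 * y ^ 2 := by gcongr
      _ = _ := by field_simp
  have p2 : μ.real E2 ≤ 2 * Real.exp (-y ^ 2 / D) := by
    -- Lightness bounds the truncated squares by a multiple of the weights, so jumps and variances
    -- are those of the weights scaled by `L / m` and its square.
    have hl1 : ∀ j, lightSq w m j ≤ L / m * w j := by
      intro j
      unfold lightSq
      split_ifs with h1
      · rw [div_mul_eq_mul_div, le_div_iff₀ hm0]
        nlinarith [h.pos j]
      · have := h.pos j; positivity
    have hl2 : ∀ j, lightSq w m j ^ 2 ≤ (L / m) ^ 2 * w j ^ 2 := by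
      intro j
      rw [← mul_pow]
      exact pow_le_pow_left₀ (lightSq_nonneg w m j) (hl1 j) 2
    refine (hμ.mart_tail h.pos (lightSq w m) (V := 2 * κ * (L / m) ^ 2)
      (T := 2 * κ * (L / m) ^ 2 * m) (x := y * L / (8 * k)) (b := L / m * b)
      (by positivity) (by positivity)
      (by positivity) (Nat.zero_le m) hmn (fun j => ?_) (fun a ha i _ hi => ?_)
      (by simp)).trans ?_
    · rw [abs_of_nonneg (lightSq_nonneg w m j)]
      exact (hl1 j).trans (by gcongr; exact hwb j)
    · exact h.biasedMean_le a hi.le (g := fun j => lightSq w m j ^ 2) (sq_nonneg _) hl2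
    apply exp_bound _ _ (by positivity)
    have e1 : 2 * κ * (L / m) ^ 2 * m ≤ 2 * κ * k * (L / k) ^ 2 := by
      have h1 : (L / m) ^ 2 * m = L ^ 2 / m := by field_simp
      have h2 : k * (L / k) ^ 2 = L ^ 2 / k := by field_simp
      calc _ = 2 * κ * (L ^ 2 / m) := by rw [← h1]; ring
        _ ≤ 2 * κ * (L ^ 2 / k) := by gcongr
        _ = _ := by rw [← h2]; ring
    have e2 : L / m * b * (y * L / (8 * k)) ≤ b * y * (L / k) ^ 2 / 8 := by
      calc L / m * b * (y * L / (8 * k)) ≤ L / k * b * (y * L / (8 * k)) := by gcongr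
        _ = _ := by field_simp
    have e3 : 4 * (2 * κ * k + b * y / 8) ≤ (1 / 8) ^ 2 * D := by
      rw [hD]; nlinarith [mul_pos hy hb, mul_pos (mul_pos hy hb) (by linarith : 0 < κ)]
    calc 4 * (2 * κ * (L / m) ^ 2 * m + L / m * b * (y * L / (8 * k))) * y ^ 2
        ≤ 4 * (2 * κ * k * (L / k) ^ 2 + b * y * (L / k) ^ 2 / 8) * y ^ 2 := by gcongr
      _ = 4 * (2 * κ * k + b * y / 8) * (L / k) ^ 2 * y ^ 2 := by ring
      _ ≤ (1 / 8) ^ 2 * D * (L / k) ^ 2 * y ^ 2 := by gcongr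
      _ = _ := by field_simp
  have hsub : {a | ∃ j, l ≤ j ∧ j ≤ m ∧
      y / 2 ≤ |cum w j a - cum w l a - ∫ a', (cum w j a' - cum w l a') ∂μ|} ⊆ E1 ∪ (E2 ∪ E3) := by
    rintro a ⟨j, hlj, hjm, hj⟩
    by_contra hcon
    simp only [Set.mem_union, not_or] at hcon
    obtain ⟨n1, n2, n3⟩ := hcon
    have b1 : |mart w w j a - mart w w l a| < y / 8 := by
      by_contra hc
      exact n1 ⟨j, hlj, hjm, not_lt.1 hc⟩
    have b2 : ∀ i < m, |mart w (lightSq w m) i a| ≤ y * L / (8 * k) := by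
      intro i hi
      by_contra hc
      exact n2 ⟨i, Nat.zero_le _, hi.le, by rw [mart_zero, sub_zero]; exact (not_le.1 hc).le⟩
    have b3 : ∀ i < m, |mart w w i a| ≤ y * L / (16 * k) := by
      intro i hi
      by_contra hc
      exact n3 ⟨i, Nat.zero_le _, hi.le, by rw [mart_zero, sub_zero]; exact (not_le.1 hc).le⟩
    have b4 := h.abs_sum_driftNoise_le hlj hjm a b2 b3 (by positivity) (by positivity)
    have b5 : k * (y * L / (8 * k) / L + 2 / L * (y * L / (16 * k))) = y / 4 := by
      field_simp; ring
    rw [← hLdef, ← hk, b5] at b4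
    have b6 : ∀ a', |windowError w m l j a'| ≤ y / 16 := fun a' =>
      (h.abs_windowError_le hlj hjm a').trans herr
    have b7 : |∫ a', windowError w m l j a' ∂μ| ≤ y / 16 := by
      have := norm_integral_le_of_norm_le_const (μ := μ) (f := fun a' => windowError w m l j a')
        (C := y / 16) (Eventually.of_forall b6)
      simpa using this
    rw [h.integral_window hμ hmn hlj hjm, cum_sub_cum w m hlj] at hj
    have b8 := b6 a
    rw [abs_lt] at b1
    rw [abs_le] at b4 b7 b8
    rcases le_abs.1 hj with h1 | h1 <;> linarith
  calc _ ≤ μ.real (E1 ∪ (E2 ∪ E3)) := measureReal_mono hsub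
    _ ≤ μ.real E1 + (μ.real E2 + μ.real E3) :=
        (measureReal_union_le _ _).trans (add_le_add le_rfl (measureReal_union_le _ _))
    _ ≤ _ := by linarith

end SmallSets

end ShortTail


/-! ### Later draws are dominated by earlier ones. -/

section Domination

variable {n : ℕ}

/-- The mean of the product of `g` over the next `k` draws, if the indices in `U` are left. -/
noncomputable def nextProd (w g : Fin n → ℝ) : ℕ → Finset (Fin n) → ℝ
  | 0, _ => 1
  | k + 1, U => biasedMean w (fun j => g j * nextProd w g k (U.erase j)) U

theorem nextProd_nonneg {w g : Fin n → ℝ} (hw : ∀ i, 0 < w i) (hg : ∀ i, 0 ≤ g i) (k : ℕ)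
    (U : Finset (Fin n)) : 0 ≤ nextProd w g k U := by
  induction k generalizing U with
  | zero => simp [nextProd]
  | succ k ih => exact biasedMean_nonneg hw fun j _ => mul_nonneg (hg j) (ih _)

theorem sum_erase_comm (U : Finset (Fin n)) (F : Fin n → Fin n → ℝ) :
    ∑ v ∈ U, ∑ u ∈ U.erase v, F v u = ∑ v ∈ U, ∑ u ∈ U.erase v, F u v := by
  apply Finset.sum_comm'
  intro x y
  simp only [Finset.mem_erase]
  tauto

/-- The next draws dominate the later ones. -/
theorem biasedMean_nextProd_le {w g : Fin n → ℝ} (hw : ∀ i, 0 < w i) (hg : ∀ i, 0 ≤ g i)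
    (hmono : ∀ i j, 0 ≤ (w i - w j) * (g i - g j)) (k : ℕ) (U : Finset (Fin n)) :
    biasedMean w (fun j => nextProd w g k (U.erase j)) U ≤ nextProd w g k U := by
  induction k generalizing U with
  | zero =>
    simp only [nextProd]
    rcases U.eq_empty_or_nonempty with rfl | hU
    · simp [biasedMean]
    · rw [biasedMean_const hw _ hU]
  | succ k ih =>
    set L := ∑ j ∈ U, w j with hL
    have hL0 : 0 ≤ L := Finset.sum_nonneg fun j _ => (hw j).le
    -- The probability of drawing `v` and then `u`, times the mean product over the next `k` draws.
    -- Shifting the product by one draw puts `g` on `u` (`e1`); the unshifted one has it on `v`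
    -- (`e2`).
    let c : Fin n → Fin n → ℝ := fun v u =>
      w v * w u / (L * (L - w v)) * nextProd w g k ((U.erase v).erase u)
    have hLv : ∀ v ∈ U, ∑ j ∈ U.erase v, w j = L - w v := fun v hv => by
      rw [hL, ← Finset.add_sum_erase U w hv]; ring
    have e1 : biasedMean w (fun j => nextProd w g (k + 1) (U.erase j)) U
        = ∑ v ∈ U, ∑ u ∈ U.erase v, c v u * g u := by
      simp only [nextProd, biasedMean, Finset.sum_div]
      rw [← hL]
      refine Finset.sum_congr rfl fun v hv => ?_
      rw [hLv v hv, Finset.mul_sum, Finset.sum_div]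
      refine Finset.sum_congr rfl fun u _ => ?_
      simp only [c]
      rw [mul_comm L, ← div_div]
      ring
    have e2 : biasedMean w (fun v => g v * biasedMean w
          (fun u => nextProd w g k ((U.erase v).erase u)) (U.erase v)) U
        = ∑ v ∈ U, ∑ u ∈ U.erase v, c v u * g v := by
      simp only [biasedMean, Finset.sum_div]
      rw [← hL]
      refine Finset.sum_congr rfl fun v hv => ?_
      rw [hLv v hv, Finset.mul_sum, Finset.mul_sum, Finset.sum_div]
      refine Finset.sum_congr rfl fun u _ => ?_
      simp only [c]
      rw [mul_comm L, ← div_div]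
      ring
    -- Symmetrise over the two orders: `c v u - c u v` has the sign of `w v - w u`, because drawing
    -- the heavier index first leaves the smaller denominator. This matches the sign of `g v - g u`.
    have hpair : 0 ≤ ∑ v ∈ U, ∑ u ∈ U.erase v, (c v u - c u v) * (g v - g u) := by
      refine Finset.sum_nonneg fun v hv => Finset.sum_nonneg fun u hu => ?_
      have huU : u ∈ U := Finset.mem_of_mem_erase hu
      have huv : u ≠ v := Finset.ne_of_mem_erase hu
      have hvu : v ∈ U.erase u := Finset.mem_erase.2 ⟨huv.symm, hv⟩
      have p1 : 0 < L - w v := by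
        rw [← hLv v hv]; exact Finset.sum_pos (fun j _ => hw j) ⟨u, hu⟩
      have p2 : 0 < L - w u := by
        rw [← hLv u huU]; exact Finset.sum_pos (fun j _ => hw j) ⟨v, hvu⟩
      have p3 : 0 < L := by linarith [hw v]
      have hN := nextProd_nonneg hw hg k ((U.erase v).erase u)
      have hc : (c v u - c u v) * (g v - g u)
          = w v * w u / (L * (L - w v) * (L - w u)) * nextProd w g k ((U.erase v).erase u)
            * ((w v - w u) * (g v - g u)) := by
        simp only [c]
        rw [Finset.erase_right_comm (a := u) (b := v)]
        field_simp
        ring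
      rw [hc]
      have := hw v
      have := hw u
      exact mul_nonneg (by positivity) (hmono v u)
    have hswap : ∑ v ∈ U, ∑ u ∈ U.erase v, c v u * g u ≤ ∑ v ∈ U, ∑ u ∈ U.erase v, c v u * g v := by
      have s1 : ∑ v ∈ U, ∑ u ∈ U.erase v, (c v u - c u v) * (g v - g u)
          = 2 * (∑ v ∈ U, ∑ u ∈ U.erase v, c v u * g v)
            - 2 * ∑ v ∈ U, ∑ u ∈ U.erase v, c v u * g u := by
        have t1 := sum_erase_comm U fun v u => c v u * g v
        have t2 := sum_erase_comm U fun v u => c v u * g u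
        simp only [sub_mul, mul_sub, Finset.sum_sub_distrib]
        linarith
      linarith
    rw [e1]
    refine hswap.trans ?_
    rw [← e2]
    exact biasedMean_mono hw fun v _ => mul_le_mul_of_nonneg_left (ih _) (hg v)

theorem nextProd_le_pow {w g : Fin n → ℝ} (hw : ∀ i, 0 < w i) (hg : ∀ i, 0 ≤ g i) {G : ℝ}
    {K : ℕ} (hG : ∀ U : Finset (Fin n), Uᶜ.card < K → biasedMean w g U ≤ G) (hG0 : 0 ≤ G)
    (k : ℕ) (U : Finset (Fin n)) (hU : Uᶜ.card + k ≤ K) : nextProd w g k U ≤ G ^ k := by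
  induction k generalizing U with
  | zero => simp [nextProd]
  | succ k ih =>
    calc nextProd w g (k + 1) U ≤ biasedMean w (fun j => G ^ k * g j) U := by
          apply biasedMean_mono hw
          intro j hj
          rw [mul_comm]
          refine mul_le_mul_of_nonneg_right (ih _ ?_) (hg j)
          have : (U.erase j)ᶜ = insert j Uᶜ := by
            rw [Finset.compl_erase]
          rw [this]
          have := Finset.card_insert_le j Uᶜ
          omega
      _ = G ^ k * biasedMean w g U := biasedMean_const_mul _ _ _ _
      _ ≤ G ^ k * G := by
          gcongr
          exact hG U (by omega)
      _ = G ^ (k + 1) := (pow_succ _ _).symm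

theorem compl_drawn_succ (i : Fin n) (a : Fin n → Fin n) :
    (drawn ((i : ℕ) + 1) a)ᶜ = (drawn i a)ᶜ.erase (a i) := by
  rw [drawn_succ, Finset.compl_insert]

/-- The factor `ψ` is what makes the induction run: each peeled factor of the product is absorbed
into it as part of the past. -/
theorem IsSizeBiasedOrder.integral_prod_window {w : Fin n → ℝ} {μ : Measure (Fin n → Fin n)}
    [IsProbabilityMeasure μ] (h : IsSizeBiasedOrder w μ fun k a => a k) (g : Fin n → ℝ)
    (k i : ℕ) (hik : i + k ≤ n) (ψ : (Fin n → Fin n) → ℝ) (hψ : Adapted i ψ) :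
    ∫ a, ψ a * ∏ t ∈ Finset.univ.filter (fun t : Fin n => i ≤ (t : ℕ) ∧ (t : ℕ) < i + k), g (a t) ∂μ
      = ∫ a, ψ a * nextProd w g k (drawn i a)ᶜ ∂μ := by
  induction k generalizing i ψ with
  | zero =>
    have : Finset.univ.filter (fun t : Fin n => i ≤ (t : ℕ) ∧ (t : ℕ) < i + 0) = ∅ := by
      ext t; simp
    simp only [this, Finset.prod_empty, nextProd]
  | succ k ih =>
    let p : Fin n := ⟨i, by omega⟩
    have e1 : Finset.univ.filter (fun t : Fin n => i ≤ (t : ℕ) ∧ (t : ℕ) < i + (k + 1))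
        = insert p (Finset.univ.filter
            (fun t : Fin n => i + 1 ≤ (t : ℕ) ∧ (t : ℕ) < i + 1 + k)) := by
      ext t
      simp only [Finset.mem_filter, Finset.mem_univ, true_and, Finset.mem_insert, Fin.ext_iff, p]
      omega
    rw [e1]
    have e2 : ∀ a : Fin n → Fin n, ψ a * ∏ t ∈ insert p (Finset.univ.filter
            (fun t : Fin n => i + 1 ≤ (t : ℕ) ∧ (t : ℕ) < i + 1 + k)), g (a t)
        = (ψ a * g (a p)) * ∏ t ∈ Finset.univ.filter
            (fun t : Fin n => i + 1 ≤ (t : ℕ) ∧ (t : ℕ) < i + 1 + k), g (a t) := by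
      intro a
      rw [Finset.prod_insert (by simp [p]), mul_assoc]
    simp_rw [e2]
    rw [ih (i + 1) (by omega) (fun a => ψ a * g (a p)) (fun a b hab => by
      change ψ a * g (a p) = ψ b * g (b p)
      rw [hψ a b fun t ht => hab t (by omega), hab p (by simp [p])])]
    have e3 : ∀ a : Fin n → Fin n, ψ a * g (a p) * nextProd w g k (drawn (i + 1) a)ᶜ
        = (fun (b : Fin n → Fin n) j => ψ b * (g j * nextProd w g k ((drawn i b)ᶜ.erase j)))
          a (a p) := by
      intro a
      have := compl_drawn_succ p a
      change (drawn (i + 1) a)ᶜ = _ at this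
      rw [this, mul_assoc]
    simp_rw [e3]
    rw [h.integral_next p
      (fun b j => ψ b * (g j * nextProd w g k ((drawn i b)ᶜ.erase j))) (fun a b hab => by
        funext j
        change ψ a * (g j * nextProd w g k ((drawn i a)ᶜ.erase j))
          = ψ b * (g j * nextProd w g k ((drawn i b)ᶜ.erase j))
        rw [hψ a b hab, adapted_drawn i a b hab])]
    congr 1
    funext a
    rw [biasedMean_const_mul]
    rfl

/-- The starting point moves back to 0 one draw at a time, each step by `biasedMean_nextProd_le`. -/
theorem IsSizeBiasedOrder.integral_nextProd_le {w : Fin n → ℝ} {μ : Measure (Fin n → Fin n)}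
    [IsProbabilityMeasure μ] (h : IsSizeBiasedOrder w μ fun k a => a k) {g : Fin n → ℝ}
    (hw : ∀ i, 0 < w i) (hg : ∀ i, 0 ≤ g i)
    (hmono : ∀ i j, 0 ≤ (w i - w j) * (g i - g j)) (k l : ℕ) (hl : l ≤ n) :
    ∫ a, nextProd w g k (drawn l a)ᶜ ∂μ ≤ nextProd w g k Finset.univ := by
  induction l with
  | zero => simp
  | succ l ih =>
    refine le_trans ?_ (ih (by omega))
    let p : Fin n := ⟨l, by omega⟩
    have e3 : ∀ a : Fin n → Fin n, nextProd w g k (drawn (l + 1) a)ᶜ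
        = (fun (b : Fin n → Fin n) j => nextProd w g k ((drawn l b)ᶜ.erase j)) a (a p) := by
      intro a
      have := compl_drawn_succ p a
      change (drawn (l + 1) a)ᶜ = _ at this
      rw [this]
    simp_rw [e3]
    rw [h.integral_next p (fun b j => nextProd w g k ((drawn l b)ᶜ.erase j)) (fun a b hab => by
        funext j
        change nextProd w g k ((drawn l a)ᶜ.erase j) = nextProd w g k ((drawn l b)ᶜ.erase j)
        rw [adapted_drawn l a b hab])]
    exact integral_mono (integrable_path _) (integrable_path _) fun a =>
      biasedMean_nextProd_le hw hg hmono k _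

theorem cum_sub_cum_eq_sum {a : Fin n → Fin n} (ha : Function.Injective a) (g : Fin n → ℝ)
    {l m : ℕ} (hlm : l ≤ m) : cum g m a - cum g l a
      = ∑ t ∈ Finset.univ.filter (fun t : Fin n => l ≤ (t : ℕ) ∧ (t : ℕ) < m), g (a t) := by
  rw [cum_eq_sum ha, cum_eq_sum ha, sub_eq_iff_eq_add, add_comm, ← Finset.sum_union]
  · congr 1
    ext t
    simp only [Finset.mem_filter, Finset.mem_univ, true_and, Finset.mem_union]
    omega
  · rw [Finset.disjoint_filter]
    intro t _ h1 h2
    omega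

/-- The exponential moment of a window sum of an increasing function of the weights is at most the
one of an initial window. -/
theorem IsSizeBiasedOrder.integral_exp_window_le {w : Fin n → ℝ} {μ : Measure (Fin n → Fin n)}
    [IsProbabilityMeasure μ] (h : IsSizeBiasedOrder w μ fun k a => a k) {f : Fin n → ℝ}
    (hw : ∀ i, 0 < w i) (hmono : ∀ i j, w i ≤ w j → f i ≤ f j) {lam G : ℝ} (hlam : 0 ≤ lam)
    {l k : ℕ} (hlk : l + k ≤ n) (hG0 : 0 ≤ G)
    (hG : ∀ U : Finset (Fin n), Uᶜ.card < k →
      biasedMean w (fun j => Real.exp (lam * f j)) U ≤ G) :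
    ∫ a, Real.exp (lam * (cum f (l + k) a - cum f l a)) ∂μ ≤ G ^ k := by
  let g : Fin n → ℝ := fun j => Real.exp (lam * f j)
  have hg : ∀ j, 0 ≤ g j := fun j => (Real.exp_pos _).le
  have hgm : ∀ i j, 0 ≤ (w i - w j) * (g i - g j) := by
    intro i j
    rcases le_total (w i) (w j) with h1 | h1
    · have : g i ≤ g j := Real.exp_le_exp.2 (mul_le_mul_of_nonneg_left (hmono i j h1) hlam)
      nlinarith
    · have : g j ≤ g i := Real.exp_le_exp.2 (mul_le_mul_of_nonneg_left (hmono j i h1) hlam)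
      nlinarith
  have e1 : ∫ a, Real.exp (lam * (cum f (l + k) a - cum f l a)) ∂μ
      = ∫ a, 1 * ∏ t ∈ Finset.univ.filter (fun t : Fin n => l ≤ (t : ℕ) ∧ (t : ℕ) < l + k),
          g (a t) ∂μ := by
    apply integral_congr_ae
    filter_upwards [h.ae_injective] with a ha
    rw [cum_sub_cum_eq_sum ha f (Nat.le_add_right l k), one_mul, Finset.mul_sum, Real.exp_sum]
  rw [e1, h.integral_prod_window g k l hlk (fun _ => 1) fun _ _ _ => rfl]
  simp only [one_mul]
  exact (h.integral_nextProd_le hw hg hgm k l (by omega)).trans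
    (nextProd_le_pow hw hg hG hG0 k Finset.univ (by simp))

end Domination


/-! ### Exponential clocks realise the size-biased order. -/

section Clocks

open ProbabilityTheory

theorem expMeasure_eq (r : ℝ) : expMeasure r = volume.withDensity (exponentialPDF r) := rfl

theorem lintegral_exp_expMeasure {r c K s : ℝ} (hr : 0 < r) (hc : 0 ≤ c) (hK : 0 ≤ K)
    (hs : 0 ≤ s) :
    ∫⁻ t, Set.indicator (Set.Ioi s) (fun t => ENNReal.ofReal (Real.exp (-(c * t)) * K)) t
      ∂(expMeasure r) = ENNReal.ofReal (r / (r + c) * (Real.exp (-((r + c) * s)) * K)) := by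
  have hmeas : Measurable (exponentialPDF r) :=
    (measurable_exponentialPDFReal r).ennreal_ofReal
  have hrc : 0 < r + c := by linarith
  rw [expMeasure_eq, lintegral_withDensity_eq_lintegral_mul _ hmeas
    (Measurable.indicator (by fun_prop) measurableSet_Ioi)]
  have h1 : ∀ t, (exponentialPDF r * Set.indicator (Set.Ioi s)
      (fun t => ENNReal.ofReal (Real.exp (-(c * t)) * K))) t
      = Set.indicator (Set.Ioi s)
        (fun t => ENNReal.ofReal (r * K * Real.exp (-(r + c) * t))) t := by
    intro t
    simp only [Pi.mul_apply, Set.indicator_apply]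
    split_ifs with ht
    · rw [exponentialPDF_of_nonneg (hs.trans (le_of_lt ht)), ← ENNReal.ofReal_mul (by positivity)]
      congr 1
      rw [show -(r + c) * t = -(r * t) + -(c * t) by ring, Real.exp_add]
      ring
    · simp
  simp_rw [h1]
  rw [lintegral_indicator measurableSet_Ioi, ← ofReal_integral_eq_lintegral_ofReal]
  · congr 1
    rw [integral_const_mul, integral_exp_mul_Ioi (by linarith) s]
    field_simp
  · exact (exp_neg_integrableOn_Ioi s hrc).const_mul _
  · exact Eventually.of_forall fun t => by positivity

theorem measurableSet_chain (n : ℕ) : MeasurableSet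
    {p : ℝ × (Fin n → ℝ) | (∀ i, p.1 < p.2 i) ∧ StrictMono p.2} := by
  have h : {p : ℝ × (Fin n → ℝ) | (∀ i, p.1 < p.2 i) ∧ StrictMono p.2}
      = (⋂ i, {p | p.1 < p.2 i}) ∩ ⋂ i, ⋂ j, {p | i < j → p.2 i < p.2 j} := by
    ext p
    simp only [Set.mem_ofPred_eq, Set.mem_inter_iff, Set.mem_iInter]
    exact and_congr Iff.rfl ⟨fun h i j hij => h hij, fun h i j hij => h i j hij⟩
  rw [h]
  refine MeasurableSet.inter (MeasurableSet.iInter fun i => ?_)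
    (MeasurableSet.iInter fun i => MeasurableSet.iInter fun j => ?_)
  · exact measurableSet_lt (by fun_prop) (by fun_prop)
  · by_cases hij : i < j
    · simp only [hij, forall_const]
      exact measurableSet_lt (by fun_prop) (by fun_prop)
    · simp [hij]

/-- The probability that independent exponential variables are in increasing order. -/
theorem pi_expMeasure_chain (n : ℕ) (u : Fin n → ℝ) (hu : ∀ i, 0 < u i) (s : ℝ) (hs : 0 ≤ s) :
    Measure.pi (fun i => expMeasure (u i)) {T | (∀ i, s < T i) ∧ StrictMono T}
      = ENNReal.ofReal (Real.exp (-((∑ i, u i) * s))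
          * ∏ i, u i / ∑ k, if i ≤ k then u k else 0) := by
  induction n generalizing s with
  | zero =>
    have : {T : Fin 0 → ℝ | (∀ i, s < T i) ∧ StrictMono T} = Set.univ := by
      ext T
      simp only [Set.mem_ofPred_eq, Set.mem_univ, iff_true]
      exact ⟨fun i => i.elim0, fun i => i.elim0⟩
    rw [this]
    simp
  | succ n ih =>
    have hp : ∀ i, IsProbabilityMeasure (expMeasure (u i)) := fun i =>
      isProbabilityMeasure_expMeasure (hu i)
    set e := MeasurableEquiv.piFinSuccAbove (fun _ : Fin (n + 1) => ℝ) 0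
    have he := measurePreserving_piFinSuccAbove (fun i : Fin (n + 1) => expMeasure (u i)) 0
    -- Condition on the first variable: once it equals `t > s`, the others form a chain above `t`.
    -- This is why the statement carries a general starting level `s`.
    let A : Set (ℝ × (Fin n → ℝ)) := {p | s < p.1} ∩ {p | (∀ i, p.1 < p.2 i) ∧ StrictMono p.2}
    have hA : MeasurableSet A :=
      (measurableSet_lt measurable_const measurable_fst).inter (measurableSet_chain n)
    have hset : {T : Fin (n + 1) → ℝ | (∀ i, s < T i) ∧ StrictMono T} = e ⁻¹' A := by
      ext T
      have e1 : (e T).1 = T 0 := rfl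
      have e2 : ∀ i, (e T).2 i = T i.succ := fun i => by
        simp [e, MeasurableEquiv.piFinSuccAbove, Fin.insertNthEquiv, Fin.tail]
      simp only [Set.mem_preimage, A, Set.mem_inter_iff, Set.mem_ofPred_eq, e1, e2]
      constructor
      · rintro ⟨h1, h2⟩
        refine ⟨h1 0, fun i => h2 (Fin.succ_pos i), fun i j hij => ?_⟩
        rw [e2, e2]
        exact h2 (Fin.succ_lt_succ_iff.2 hij)
      · rintro ⟨h1, h2, h3⟩
        refine ⟨fun i => ?_, fun i j hij => ?_⟩
        · refine Fin.cases h1 (fun i => h1.trans (h2 i)) i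
        · revert hij
          refine Fin.cases ?_ (fun j => ?_) j
          · intro hij; exact absurd hij (Fin.not_lt_zero i)
          · refine Fin.cases (fun _ => h2 j) (fun i hij => ?_) i
            have := h3 (Fin.succ_lt_succ_iff.1 hij)
            rwa [e2, e2] at this
    rw [hset, he.measure_preimage hA.nullMeasurableSet, Measure.prod_apply hA]
    set c := ∑ i : Fin n, u i.succ
    have hc : 0 ≤ c := Finset.sum_nonneg fun i _ => (hu _).le
    set K := ∏ i : Fin n, u i.succ / ∑ k : Fin n, if i ≤ k then u k.succ else 0
    have hK : 0 ≤ K := Finset.prod_nonneg fun i _ => div_nonneg (hu _).le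
      (Finset.sum_nonneg fun k _ => by split_ifs; exacts [(hu _).le, le_rfl])
    have h1 : ∀ t, Measure.pi (fun j => expMeasure (u (Fin.succAbove 0 j))) (Prod.mk t ⁻¹' A)
        = Set.indicator (Set.Ioi s) (fun t => ENNReal.ofReal (Real.exp (-(c * t)) * K)) t := by
      intro t
      rw [Set.indicator_apply]
      split_ifs with ht
      · have h2 : Prod.mk t ⁻¹' A = {T | (∀ i, t < T i) ∧ StrictMono T} := by
          ext T
          simp only [A, Set.mem_preimage, Set.mem_inter_iff, Set.mem_ofPred_eq]
          exact ⟨fun h => h.2, fun h => ⟨ht, h⟩⟩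
        rw [h2]
        exact ih (fun j => u j.succ) (fun j => hu _) t (hs.trans (le_of_lt ht))
      · have h2 : Prod.mk t ⁻¹' A = ∅ := by
          ext T
          simp only [A, Set.mem_preimage, Set.mem_inter_iff, Set.mem_ofPred_eq,
            Set.mem_empty_iff_false, iff_false]
          exact fun h => ht h.1
        rw [h2, measure_empty]
    simp_rw [h1]
    rw [lintegral_exp_expMeasure (hu 0) hc hK hs]
    congr 1
    have hsum : ∑ i, u i = u 0 + c := Fin.sum_univ_succ u
    have hprod : (∏ i, u i / ∑ k, if i ≤ k then u k else 0) = u 0 / (u 0 + c) * K := by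
      rw [Fin.prod_univ_succ]
      simp only [Fin.sum_univ_succ, Fin.zero_le, if_true, Fin.succ_le_succ_iff]
      congr 1
      refine Finset.prod_congr rfl fun i _ => ?_
      rw [if_neg (by simp), zero_add]
    rw [hsum, hprod]
    ring

variable {n : ℕ}

/-- Independent exponential clocks whose rates are the weights. -/
noncomputable def clock (w : Fin n → ℝ) : Measure (Fin n → ℝ) :=
  Measure.pi fun i => expMeasure (w i)

theorem isProbabilityMeasure_clock {w : Fin n → ℝ} (hw : ∀ i, 0 < w i) :
    IsProbabilityMeasure (clock w) := by
  have hp : ∀ i, IsProbabilityMeasure (expMeasure (w i)) := fun i =>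
    isProbabilityMeasure_expMeasure (hw i)
  unfold clock
  infer_instance

/-- The clocks ring in the order `a`. -/
def ringOrder (a : Fin n → Fin n) : Set (Fin n → ℝ) := {T | (∀ j, 0 < T j) ∧ StrictMono (T ∘ a)}

theorem measurableSet_ringOrder (a : Fin n → Fin n) : MeasurableSet (ringOrder a) := by
  have h : ringOrder a = (⋂ i, {T : Fin n → ℝ | 0 < T i})
      ∩ ⋂ i, ⋂ j, {T | i < j → T (a i) < T (a j)} := by
    ext T
    simp only [ringOrder, Set.mem_ofPred_eq, Set.mem_inter_iff, Set.mem_iInter]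
    exact and_congr Iff.rfl ⟨fun h i j hij => h hij, fun h i j hij => h i j hij⟩
  rw [h]
  refine MeasurableSet.inter (MeasurableSet.iInter fun i => ?_)
    (MeasurableSet.iInter fun i => MeasurableSet.iInter fun j => ?_)
  · exact measurableSet_lt (by fun_prop) (by fun_prop)
  · by_cases hij : i < j
    · simp only [hij, forall_const]
      exact measurableSet_lt (by fun_prop) (by fun_prop)
    · simp [hij]

/-- Relabelling the clocks by the permutation `a` reduces to the chain formula at level 0. Its
denominators are the weights not yet drawn. -/
theorem clock_ringOrder {w : Fin n → ℝ} (hw : ∀ i, 0 < w i) {a : Fin n → Fin n}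
    (ha : Function.Injective a) : (clock w).real (ringOrder a) = orderProb w a := by
  have hp : ∀ i, IsProbabilityMeasure (expMeasure (w i)) := fun i =>
    isProbabilityMeasure_expMeasure (hw i)
  let σ : Equiv.Perm (Fin n) := Equiv.ofBijective a (Finite.injective_iff_bijective.1 ha)
  have hσ : ∀ i, σ i = a i := fun i => rfl
  have hmp := measurePreserving_piCongrLeft (fun i => expMeasure (w i)) σ
  have hpre : (MeasurableEquiv.piCongrLeft (fun _ => ℝ) σ) ⁻¹' ringOrder a
      = {T | (∀ i, 0 < T i) ∧ StrictMono T} := by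
    ext T
    have e1 : ∀ i, (MeasurableEquiv.piCongrLeft (fun _ => ℝ) σ) T (a i) = T i := fun i => by
      rw [← hσ i, MeasurableEquiv.coe_piCongrLeft]
      exact Equiv.piCongrLeft_apply_apply (fun _ => ℝ) σ T i
    have e2 : (MeasurableEquiv.piCongrLeft (fun _ => ℝ) σ) T ∘ a = T := funext e1
    simp only [ringOrder, Set.mem_preimage, Set.mem_ofPred_eq, e2]
    refine and_congr ⟨fun h i => ?_, fun h j => ?_⟩ Iff.rfl
    · rw [← e1 i]; exact h _
    · obtain ⟨i, rfl⟩ := σ.surjective j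
      rw [hσ, e1]; exact h i
  have h1 : clock w (ringOrder a) = ENNReal.ofReal (∏ i, w (a i) /
      ∑ k, if i ≤ k then w (a k) else 0) := by
    unfold clock
    rw [← hmp.measure_preimage (measurableSet_ringOrder a).nullMeasurableSet, hpre]
    have := pi_expMeasure_chain n (fun i => w (a i)) (fun i => hw _) 0 le_rfl
    rw [mul_zero, neg_zero, Real.exp_zero, one_mul] at this
    exact this
  have h2 : (∏ i, w (a i) / ∑ k, if i ≤ k then w (a k) else 0) = orderProb w a := by
    unfold orderProb
    refine Finset.prod_congr rfl fun i _ => ?_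
    rw [stepProb_of_injective ha, if_pos (by simpa using notMem_drawn ha i)]
    congr 1
    have s1 : ∑ k, w (a k) = ∑ k, w k := Equiv.sum_comp σ w
    have s2 := Finset.sum_add_sum_compl (drawn i a) w
    have s3 := cum_eq_sum ha w i
    rw [cum] at s3
    have s4 : ∑ k, w (a k) = (∑ k ∈ Finset.univ.filter (fun k : Fin n => (k : ℕ) < i), w (a k))
        + ∑ k, if i ≤ k then w (a k) else 0 := by
      rw [← Finset.sum_filter, ← Finset.sum_filter_add_sum_filter_not Finset.univ
        (fun k : Fin n => (k : ℕ) < i)]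
      congr 1
      refine Finset.sum_congr ?_ fun _ _ => rfl
      ext k
      simp
    linarith
  rw [← h2, Measure.real, h1, ENNReal.toReal_ofReal]
  exact Finset.prod_nonneg fun i _ => div_nonneg (hw _).le
      (Finset.sum_nonneg fun k _ => by split_ifs; exacts [(hw _).le, le_rfl])

/-- A finite set of reals has only one increasing enumeration, and the ringing times are distinct.
-/
theorem ringOrder_disjoint {a b : Fin n → Fin n} (ha : Function.Injective a)
    (hb : Function.Injective b) (hab : a ≠ b) : Disjoint (ringOrder a) (ringOrder b) := by
  rw [Set.disjoint_left]
  rintro T ⟨_, h1⟩ ⟨_, h2⟩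
  apply hab
  have sa := (Finite.injective_iff_surjective.1 ha)
  have sb := (Finite.injective_iff_surjective.1 hb)
  have hr : Set.range (T ∘ a) = Set.range (T ∘ b) := by
    rw [sa.range_comp, sb.range_comp]
  have h3 : T ∘ a = T ∘ b := (StrictMono.range_inj h1 h2).1 hr
  have hT : Function.Injective T := by
    intro x y hxy
    obtain ⟨i, rfl⟩ := sa x
    obtain ⟨j, rfl⟩ := sa y
    rw [h1.injective hxy]
  funext i
  exact hT (congrFun h3 i)

/-- The order of the rings of the clocks has the size-biased law. -/
theorem IsSizeBiasedOrder.real_le_clock {w : Fin n → ℝ} {μ : Measure (Fin n → Fin n)}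
    [IsProbabilityMeasure μ] (h : IsSizeBiasedOrder w μ fun k a => a k) (hw : ∀ i, 0 < w i)
    (E : Set (Fin n → Fin n)) :
    μ.real E ≤ (clock w).real {T | ∃ a ∈ E, Function.Injective a ∧ T ∈ ringOrder a} := by
  classical
  have := isProbabilityMeasure_clock hw
  let s : Finset (Fin n → Fin n) := Finset.univ.filter fun a => a ∈ E ∧ Function.Injective a
  have h1 : μ.real E = μ.real (s : Set (Fin n → Fin n)) := by
    apply measureReal_congr
    filter_upwards [h.ae_injective] with a ha
    apply propext
    change a ∈ E ↔ a ∈ (s : Set (Fin n → Fin n))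
    simp [s, ha]
  have h2 : {T | ∃ a ∈ E, Function.Injective a ∧ T ∈ ringOrder a} = ⋃ a ∈ s, ringOrder a := by
    ext T
    simp [s, and_assoc]
  -- Both sides become sums over the injective paths in `E`, with the common terms `orderProb w a`.
  rw [h1, h2, ← sum_measureReal_singleton, measureReal_biUnion_finset]
  · refine Finset.sum_le_sum fun a ha => ?_
    rw [h.real_singleton, clock_ringOrder hw (Finset.mem_filter.1 ha).2.2]
  · intro a ha b hb hab
    exact ringOrder_disjoint (Finset.mem_filter.1 ha).2.2 (Finset.mem_filter.1 hb).2.2 hab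
  · exact fun a _ => measurableSet_ringOrder a

end Clocks


/-! ### From counts at fixed times to windows of draws. -/

section Grid

/-- Think of `N i` as the number of rings at the `i`-th grid time. At the next grid index the count
already exceeds `j`, and one grid step adds at most `1 + x`. -/
theorem exists_last_le {n k : ℕ} {N : ℕ → ℕ} (hN0 : N 0 = 0) (hNn : N n = n) {x : ℝ}
    (hx : 0 ≤ x) (hk : 1 ≤ k)
    (h1 : ∀ i i', i ≤ i' → i' ≤ n → i' ≤ i + 4 * k →
      |(N i' : ℝ) - N i - ((i' : ℝ) - i)| ≤ x) {j : ℕ} (hj : j ≤ n) :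
    ∃ p ≤ n, N p ≤ j ∧ (j : ℝ) ≤ N p + 1 + x ∧ ∀ i ≤ n, N i ≤ j → i ≤ p := by
  let p := Nat.findGreatest (fun i => N i ≤ j) n
  have hp : N p ≤ j := Nat.findGreatest_spec (P := fun i => N i ≤ j) (Nat.zero_le n) (by simp [hN0])
  have hpn : p ≤ n := Nat.findGreatest_le n
  have hmax : ∀ i ≤ n, N i ≤ j → i ≤ p := fun i hi h => Nat.le_findGreatest hi h
  refine ⟨p, hpn, hp, ?_, hmax⟩
  rcases hpn.eq_or_lt with h | h
  · rw [h, hNn]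
    have : (j : ℝ) ≤ n := by exact_mod_cast hj
    linarith
  · have h2 : j < N (p + 1) := by
      by_contra hc
      have := hmax (p + 1) h (not_lt.1 hc)
      omega
    have h3 := (abs_le.1 (h1 p (p + 1) (by omega) h (by omega))).2
    have h4 : (j : ℝ) + 1 ≤ N (p + 1) := by exact_mod_cast h2
    push_cast at h3
    linarith

theorem abs_sub_le_of_step {G : ℕ → ℝ} {B : ℝ}
    (hG : ∀ i, |G i - G (i + 1)| ≤ B) (i j : ℕ) : |G i - G j| ≤ B * |(i : ℝ) - j| := by
  have h1 : ∀ i d : ℕ, |G i - G (i + d)| ≤ B * d := by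
    intro i d
    induction d with
    | zero => simp
    | succ d ih =>
      calc |G i - G (i + (d + 1))| ≤ |G i - G (i + d)| + |G (i + d) - G (i + d + 1)| :=
            abs_sub_le _ _ _
        _ ≤ B * d + B := add_le_add ih (hG _)
        _ = _ := by push_cast; ring
  rcases le_total i j with h | h
  · obtain ⟨d, rfl⟩ := Nat.exists_eq_add_of_le h
    have := h1 i d
    have e : |(i : ℝ) - ((i + d : ℕ) : ℝ)| = d := by
      push_cast; rw [sub_add_cancel_left, abs_neg, Nat.abs_cast]
    rw [e]; exact this
  · obtain ⟨d, rfl⟩ := Nat.exists_eq_add_of_le h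
    have := h1 j d
    have e : |((j + d : ℕ) : ℝ) - j| = d := by
      push_cast; rw [add_sub_cancel_left, Nat.abs_cast]
    rw [e, abs_sub_comm]; exact this

/-- If the grid counts `N` and the grid sums of `Φ` are close to their means, then the increments
of `Φ` are close to increments of the mean curve `G`. -/
theorem exists_grid_start {n k l : ℕ} {N : ℕ → ℕ} {Φ G : ℕ → ℝ} {B x : ℝ}
    (hN0 : N 0 = 0) (hNm : Monotone N) (hNn : N n = n) (hx : 1 ≤ x) (hxk : x ≤ k)
    (hk : 2 ≤ k) (hB : 1 ≤ B) (hlk : l + k ≤ n)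
    (hΦ : ∀ i, |Φ i - Φ (i + 1)| ≤ B) (hG : ∀ i, |G i - G (i + 1)| ≤ B)
    (h1 : ∀ i i', i ≤ i' → i' ≤ n → i' ≤ i + 4 * k →
      |(N i' : ℝ) - N i - ((i' : ℝ) - i)| ≤ x)
    (h2 : ∀ i i', i ≤ i' → i' ≤ n → i' ≤ i + 4 * k →
      |Φ (N i') - Φ (N i) - (G i - G i')| ≤ x) :
    ∃ p ≤ n, (∀ i ≤ n, N i ≤ l → i ≤ p) ∧ N p ≤ l ∧
      ∀ u ≤ k, |Φ (l + u) - Φ l - (G p - G (p + u))| ≤ 9 * B * x := by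
  have hx0 : 0 ≤ x := by linarith
  obtain ⟨p, hpn, hp1, hp2, hpmax⟩ :=
    exists_last_le hN0 hNn hx0 (by omega) h1 (show l ≤ n by omega)
  refine ⟨p, hpn, hpmax, hp1, fun u hu => ?_⟩
  obtain ⟨q, hqn, hq1, hq2, hqmax⟩ :=
    exists_last_le hN0 hNn hx0 (by omega) h1 (show l + u ≤ n by omega)
  have hpq : p ≤ q := hqmax p hpn (by omega)
  have hp1' : (N p : ℝ) ≤ l := by exact_mod_cast hp1
  have hq1' : (N q : ℝ) ≤ l + u := by exact_mod_cast hq1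
  push_cast at hq2
  have huk : (u : ℝ) ≤ k := by exact_mod_cast hu
  have hk2 : (2 : ℝ) ≤ k := by exact_mod_cast hk
  -- Otherwise `4 * k` grid steps would add at least `4 * k - x` rings, while at most `1 + x + k`
  -- are available; this is impossible for `x ≤ k` and `2 ≤ k`.
  have hq4 : q ≤ p + 4 * k := by
    by_contra hc
    have h3 := (abs_le.1 (h1 p (p + 4 * k) (by omega) (by omega) le_rfl)).1
    have h4 : (N (p + 4 * k) : ℝ) ≤ N q := by exact_mod_cast hNm (by omega)
    push_cast at h3
    linarith
  have h3 := abs_le.1 (h1 p q hpq hqn hq4)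
  have h4 := h2 p q hpq hqn hq4
  have e1 := abs_sub_le_of_step hΦ (l + u) (N q)
  have e2 := abs_sub_le_of_step hΦ (N p) l
  have e3 := abs_sub_le_of_step hG (p + u) q
  have B0 : 0 ≤ B := by linarith
  have e1' : |Φ (l + u) - Φ (N q)| ≤ B * (1 + x) := by
    refine e1.trans (mul_le_mul_of_nonneg_left ?_ B0)
    push_cast; rw [abs_le]; constructor <;> linarith
  have e2' : |Φ (N p) - Φ l| ≤ B * (1 + x) := by
    refine e2.trans (mul_le_mul_of_nonneg_left ?_ B0)
    rw [abs_le]; constructor <;> linarith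
  have e3' : |G (p + u) - G q| ≤ B * (1 + 2 * x) := by
    refine e3.trans (mul_le_mul_of_nonneg_left ?_ B0)
    push_cast; rw [abs_le]; constructor <;> linarith [h3.1, h3.2]
  have hfin : Φ (l + u) - Φ l - (G p - G (p + u)) = (Φ (l + u) - Φ (N q)) + (Φ (N p) - Φ l)
      + (G (p + u) - G q) + (Φ (N q) - Φ (N p) - (G p - G q)) := by ring
  rw [hfin]
  have hBx : x ≤ B * x := by nlinarith
  have hBx' : B ≤ B * x := by nlinarith
  calc _ ≤ B * (1 + x) + B * (1 + x) + B * (1 + 2 * x) + x :=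
        (abs_add_le _ _).trans (add_le_add ((abs_add_le _ _).trans
          (add_le_add ((abs_add_le _ _).trans (add_le_add e1' e2')) e3')) h4)
    _ ≤ _ := by nlinarith

end Grid

/-! ### Grid times and the mean curves of the surviving sums. -/

section Survival

variable {n : ℕ}

/-- Convexity of `exp` on the segment from `-y` to 0: the slope `(1 - exp (-x)) / x` decreases in
`x`. -/
theorem one_sub_exp_ratio {x y : ℝ} (hx : 0 < x) (hxy : x ≤ y) :
    x * (1 - Real.exp (-y)) ≤ y * (1 - Real.exp (-x)) := by
  have hy : 0 < y := by linarith
  have h := convexOn_exp.2 (Set.mem_univ (-y)) (Set.mem_univ 0) (by positivity : 0 ≤ x / y)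
    (by rw [sub_nonneg, div_le_one hy]; exact hxy : 0 ≤ 1 - x / y) (by ring)
  have e : x / y * -y = -x := by field_simp
  simp only [smul_eq_mul, mul_zero, add_zero, Real.exp_zero, mul_one, e] at h
  have h2 : y * Real.exp (-x) ≤ y * (x / y * Real.exp (-y) + (1 - x / y)) := by gcongr
  have h3 : y * (x / y * Real.exp (-y) + (1 - x / y)) = x * Real.exp (-y) + y - x := by
    field_simp; ring
  linarith

/-- Chebyshev's inequality for size-biased averages. -/
theorem chebyshev_biased {w φ : Fin n → ℝ} (hw : ∀ j, 0 < w j)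
    (hφ : ∀ x y, (w x - w y) * (φ x - φ y) ≤ 0) :
    (∑ j, w j ^ 2 * φ j) * ∑ j, w j ≤ (∑ j, w j ^ 2) * ∑ j, w j * φ j := by
  have h1 : ∑ x, ∑ y, w x * w y * ((w x - w y) * (φ x - φ y)) ≤ 0 :=
    Finset.sum_nonpos fun x _ => Finset.sum_nonpos fun y _ =>
      mul_nonpos_of_nonneg_of_nonpos (mul_nonneg (hw x).le (hw y).le) (hφ x y)
  have h2 : ∑ x, ∑ y, w x * w y * ((w x - w y) * (φ x - φ y))
      = 2 * ((∑ j, w j ^ 2 * φ j) * ∑ j, w j) - 2 * ((∑ j, w j ^ 2) * ∑ j, w j * φ j) := by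
    have e : ∀ x y, w x * w y * ((w x - w y) * (φ x - φ y))
        = (w x ^ 2 * φ x) * w y - w x ^ 2 * (w y * φ y) - (w x * φ x) * w y ^ 2
          + w x * (w y ^ 2 * φ y) := fun x y => by ring
    simp_rw [e, Finset.sum_add_distrib, Finset.sum_sub_distrib, ← Finset.mul_sum,
      ← Finset.sum_mul]
    ring
  linarith

/-- The mean number of surviving clocks decreases continuously from `n` to 0, so it takes every
intermediate value. -/
theorem exists_survival_time {w : Fin n → ℝ} (hw : ∀ j, 0 < w j) {i : ℕ} (hi : i < n) :
    ∃ s : ℝ, 0 ≤ s ∧ ∑ j, Real.exp (-(w j * s)) = (n : ℝ) - i := by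
  have hc : Continuous fun s : ℝ => ∑ j, Real.exp (-(w j * s)) := by fun_prop
  have ht : Tendsto (fun s : ℝ => ∑ j, Real.exp (-(w j * s))) atTop (𝓝 (∑ _j : Fin n, (0 : ℝ))) := by
    refine tendsto_finsetSum _ fun j _ => ?_
    exact Real.tendsto_exp_atBot.comp (tendsto_neg_atTop_atBot.comp
      (tendsto_id.const_mul_atTop (hw j)))
  have hni : (0 : ℝ) < (n : ℝ) - i := by rw [sub_pos]; exact_mod_cast hi
  simp only [Finset.sum_const_zero] at ht
  obtain ⟨S, hS0, hS⟩ := ((eventually_ge_atTop (0 : ℝ)).and (ht.eventually_lt_const hni)).exists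
  have := intermediate_value_Icc' hS0 hc.continuousOn
  obtain ⟨s, hs, hs'⟩ := this ⟨hS.le, by simp⟩
  exact ⟨s, hs.1, hs'⟩

/-- A time at which the mean number of rings is `i`. -/
noncomputable def gridTime (w : Fin n → ℝ) (hw : ∀ j, 0 < w j) (i : ℕ) : ℝ :=
  if hi : i < n then (exists_survival_time hw hi).choose else 0

/-- The probability that the clock `j` has not rung at the `i`-th grid time. -/
noncomputable def surv (w : Fin n → ℝ) (hw : ∀ j, 0 < w j) (i : ℕ) (j : Fin n) : ℝ :=
  if i < n then Real.exp (-(w j * gridTime w hw i)) else 0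

variable {w : Fin n → ℝ} (hw : ∀ j, 0 < w j)

theorem gridTime_nonneg (i : ℕ) : 0 ≤ gridTime w hw i := by
  unfold gridTime
  split_ifs with hi
  · exact (exists_survival_time hw hi).choose_spec.1
  · exact le_rfl

theorem sum_surv (i : ℕ) : ∑ j, surv w hw i j = ((n - i : ℕ) : ℝ) := by
  unfold surv
  split_ifs with hi
  · rw [Nat.cast_sub hi.le]
    have := (exists_survival_time hw hi).choose_spec.2
    simpa only [gridTime, dif_pos hi] using this
  · simp [Nat.sub_eq_zero_of_le (not_lt.1 hi)]

theorem surv_nonneg (i : ℕ) (j : Fin n) : 0 ≤ surv w hw i j := by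
  unfold surv; split_ifs <;> positivity

theorem gridTime_mono {i i' : ℕ} (hii : i ≤ i') (hi' : i' < n) :
    gridTime w hw i ≤ gridTime w hw i' := by
  by_contra hc
  rw [not_le] at hc
  have hi : i < n := by omega
  have h1 := sum_surv hw i
  have h2 := sum_surv hw i'
  have : Nonempty (Fin n) := ⟨⟨i, hi⟩⟩
  have h3 : ∑ j, surv w hw i j < ∑ j, surv w hw i' j := by
    apply Finset.sum_lt_sum_of_nonempty Finset.univ_nonempty
    intro j _
    simp only [surv, if_pos hi, if_pos hi']
    apply Real.exp_lt_exp.2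
    have := mul_lt_mul_of_pos_left hc (hw j)
    linarith
  rw [h1, h2] at h3
  have : n - i < n - i' := by exact_mod_cast h3
  omega

theorem gridTime_zero : gridTime w hw 0 = 0 := by
  by_cases hn : 0 < n
  · by_contra hc
    have h0 : 0 < gridTime w hw 0 := lt_of_le_of_ne (gridTime_nonneg hw 0) (Ne.symm hc)
    have h1 := sum_surv hw 0
    have : Nonempty (Fin n) := ⟨⟨0, hn⟩⟩
    have h3 : ∑ j, surv w hw 0 j < ∑ _j : Fin n, (1 : ℝ) := by
      apply Finset.sum_lt_sum_of_nonempty Finset.univ_nonempty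
      intro j _
      simp only [surv, if_pos hn, Real.exp_lt_one_iff, neg_lt_zero]
      exact mul_pos (hw j) h0
    rw [h1] at h3
    simp at h3
  · simp [gridTime, hn]

theorem surv_antitone (j : Fin n) : Antitone fun i => surv w hw i j := by
  intro i i' hii
  simp only
  by_cases hi' : i' < n
  · have hi : i < n := by omega
    simp only [surv, if_pos hi, if_pos hi']
    apply Real.exp_le_exp.2
    have := mul_le_mul_of_nonneg_left (gridTime_mono hw hii hi') (hw j).le
    linarith
  · rw [show surv w hw i' j = 0 by simp [surv, hi']]
    exact surv_nonneg hw i j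

theorem sum_surv_sub_le {i i' : ℕ} (hii : i ≤ i') :
    ∑ j, (surv w hw i j - surv w hw i' j) ≤ (i' : ℝ) - i := by
  rw [Finset.sum_sub_distrib, sum_surv, sum_surv, sub_le_sub_iff]
  have : n - i + i ≤ i' + (n - i') := by omega
  exact_mod_cast this

theorem sum_surv_sub_eq {i i' : ℕ} (hii : i ≤ i') (hi' : i' ≤ n) :
    ∑ j, (surv w hw i j - surv w hw i' j) = (i' : ℝ) - i := by
  rw [Finset.sum_sub_distrib, sum_surv, sum_surv, Nat.cast_sub hi', Nat.cast_sub (by omega)]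
  ring

/-- The mean over the surviving indices of `f`, at the `i`-th grid time. -/
noncomputable def survSum (f : Fin n → ℝ) (i : ℕ) : ℝ := ∑ j, f j * surv w hw i j

theorem survSum_antitone {f : Fin n → ℝ} (hf : ∀ j, 0 ≤ f j) : Antitone (survSum hw f) :=
  fun _ _ hii => Finset.sum_le_sum fun j _ =>
    mul_le_mul_of_nonneg_left (surv_antitone hw j hii) (hf j)

theorem survSum_nonneg {f : Fin n → ℝ} (hf : ∀ j, 0 ≤ f j) (i : ℕ) : 0 ≤ survSum hw f i :=
  Finset.sum_nonneg fun j _ => mul_nonneg (hf j) (surv_nonneg hw i j)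

theorem survSum_of_le {f : Fin n → ℝ} {i : ℕ} (hi : n ≤ i) : survSum hw f i = 0 := by
  simp [survSum, surv, not_lt.2 hi]

theorem survSum_sub_le {f : Fin n → ℝ} {B : ℝ} (hB : 0 ≤ B)
    (hfB : ∀ j, f j ≤ B) {i i' : ℕ} (hii : i ≤ i') :
    survSum hw f i - survSum hw f i' ≤ B * ((i' : ℝ) - i) := by
  calc _ = ∑ j, f j * (surv w hw i j - surv w hw i' j) := by
        rw [survSum, survSum, ← Finset.sum_sub_distrib]
        exact Finset.sum_congr rfl fun j _ => by ring
    _ ≤ ∑ j, B * (surv w hw i j - surv w hw i' j) := Finset.sum_le_sum fun j _ =>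
        mul_le_mul_of_nonneg_right (hfB j) (sub_nonneg.2 (surv_antitone hw j hii))
    _ = B * ∑ j, (surv w hw i j - surv w hw i' j) := by rw [Finset.mul_sum]
    _ ≤ _ := mul_le_mul_of_nonneg_left (sum_surv_sub_le hw hii) hB

/-- A heavy clock is less likely to have survived so far, and its chance to ring in a time interval
grows less than linearly in its weight. -/
theorem surv_div_antitone {i i' : ℕ} (hii : i ≤ i') {x y : Fin n} (hxy : w x ≤ w y) :
    (surv w hw i y - surv w hw i' y) / w y ≤ (surv w hw i x - surv w hw i' x) / w x := by
  have hx := hw x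
  have hy := hw y
  by_cases hi : i < n
  · have e0 : Real.exp (-(w y * gridTime w hw i)) ≤ Real.exp (-(w x * gridTime w hw i)) := by
      apply Real.exp_le_exp.2
      have := mul_le_mul_of_nonneg_right hxy (gridTime_nonneg hw i)
      linarith
    by_cases hi' : i' < n
    · simp only [surv, if_pos hi, if_pos hi']
      set s := gridTime w hw i
      obtain ⟨h, hh, hs⟩ : ∃ h, 0 ≤ h ∧ gridTime w hw i' = s + h :=
        ⟨gridTime w hw i' - s, sub_nonneg.2 (gridTime_mono hw hii hi'), by ring⟩
      rw [hs]
      have e1 : ∀ z : Fin n, Real.exp (-(w z * s)) - Real.exp (-(w z * (s + h)))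
          = Real.exp (-(w z * s)) * (1 - Real.exp (-(w z * h))) := by
        intro z
        rw [mul_sub, mul_one, ← Real.exp_add]
        congr 2; ring
      rw [e1, e1, mul_div_assoc, mul_div_assoc]
      have e2 : (1 - Real.exp (-(w y * h))) / w y ≤ (1 - Real.exp (-(w x * h))) / w x := by
        rcases hh.eq_or_lt with h0 | h0
        · simp [← h0]
        · rw [div_le_div_iff₀ hy hx]
          have := one_sub_exp_ratio (mul_pos hx h0) (mul_le_mul_of_nonneg_right hxy h0.le)
          nlinarith
      have e3 : 0 ≤ (1 - Real.exp (-(w y * h))) / w y := by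
        apply div_nonneg _ hy.le
        rw [sub_nonneg, Real.exp_le_one_iff, neg_nonpos]
        positivity
      exact mul_le_mul e0 e2 e3 (Real.exp_pos _).le
    · simp only [surv, if_pos hi, if_neg hi', sub_zero]
      exact div_le_div₀ (Real.exp_pos _).le e0 hx hxy
  · have hi' : ¬ i' < n := by omega
    simp [surv, hi, hi']

/-- The surviving total weight decreases at most proportionally to the number of rings. -/
theorem survSum_weight_sub_le (hL : 0 < totalWeight w)
    (hQ : ∑ j, w j ^ 2 ≤ 2 * totalWeight w) {i i' : ℕ} (hii : i ≤ i') :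
    survSum hw w i - survSum hw w i' ≤ 2 * ((i' : ℝ) - i) := by
  -- The ringing probability per unit of weight decreases in the weight. Chebyshev's inequality then
  -- bounds the lost weight per ring by `∑ w ^ 2 / ∑ w ≤ 2`.
  let φ : Fin n → ℝ := fun j => (surv w hw i j - surv w hw i' j) / w j
  have h := chebyshev_biased (φ := φ) hw (fun x y => by
    rcases le_total (w x) (w y) with h | h
    · exact mul_nonpos_of_nonpos_of_nonneg (by linarith)
        (sub_nonneg.2 (surv_div_antitone hw hii h))
    · exact mul_nonpos_of_nonneg_of_nonpos (by linarith)
        (sub_nonpos.2 (surv_div_antitone hw hii h)))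
  have e1 : ∑ j, w j ^ 2 * φ j = survSum hw w i - survSum hw w i' := by
    rw [survSum, survSum, ← Finset.sum_sub_distrib]
    refine Finset.sum_congr rfl fun j _ => ?_
    have := (hw j).ne'
    simp only [φ]; field_simp
  have e2 : ∑ j, w j * φ j = ∑ j, (surv w hw i j - surv w hw i' j) := by
    refine Finset.sum_congr rfl fun j _ => ?_
    have := (hw j).ne'
    simp only [φ]; field_simp
  rw [e1, e2] at h
  have h2 := sum_surv_sub_le hw hii
  have h3 : (0 : ℝ) ≤ (i' : ℝ) - i := by rw [sub_nonneg]; exact_mod_cast hii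
  have h4 : (∑ j, w j ^ 2) * ∑ j, (surv w hw i j - surv w hw i' j)
      ≤ 2 * totalWeight w * ((i' : ℝ) - i) := by
    calc _ ≤ (∑ j, w j ^ 2) * ((i' : ℝ) - i) := by gcongr
      _ ≤ _ := by gcongr
  have h5 : (survSum hw w i - survSum hw w i') * totalWeight w
      ≤ 2 * ((i' : ℝ) - i) * totalWeight w := by
    unfold totalWeight at *; linarith
  exact le_of_mul_le_mul_right h5 hL

theorem surv_sub_bounds {i : ℕ} (hi : i + 1 < n) (j : Fin n) :
    w j * (gridTime w hw (i + 1) - gridTime w hw i) * surv w hw (i + 1) j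
        ≤ surv w hw i j - surv w hw (i + 1) j ∧
      surv w hw i j - surv w hw (i + 1) j
        ≤ w j * (gridTime w hw (i + 1) - gridTime w hw i) * surv w hw i j := by
  simp only [surv, if_pos hi, if_pos (by omega : i < n)]
  set s := gridTime w hw i
  obtain ⟨h, hs⟩ : ∃ h, gridTime w hw (i + 1) = s + h := ⟨gridTime w hw (i + 1) - s, by ring⟩
  rw [hs]
  have e1 : Real.exp (-(w j * (s + h))) = Real.exp (-(w j * s)) * Real.exp (-(w j * h)) := by
    rw [← Real.exp_add]; congr 1; ring
  have e2 : Real.exp (-(w j * s)) = Real.exp (-(w j * (s + h))) * Real.exp (w j * h) := by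
    rw [← Real.exp_add]; congr 1; ring
  constructor
  · rw [e2]
    have := Real.add_one_le_exp (w j * h)
    have := Real.exp_pos (-(w j * (s + h)))
    nlinarith
  · rw [e1]
    have := Real.add_one_le_exp (-(w j * h))
    have := Real.exp_pos (-(w j * s))
    nlinarith

/-- The increments of `survSum f` are close to the quotients of surviving sums. -/
theorem survSum_step_bounds {f : Fin n → ℝ} (hf : ∀ j, 0 ≤ f j) {i : ℕ} (hi : i + 1 < n) :
    survSum hw (fun j => f j * w j) (i + 1) / survSum hw w i
        ≤ survSum hw f i - survSum hw f (i + 1) ∧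
      survSum hw f i - survSum hw f (i + 1)
        ≤ survSum hw (fun j => f j * w j) i / survSum hw w (i + 1) := by
  have : Nonempty (Fin n) := ⟨⟨i, by omega⟩⟩
  have hpos : ∀ i, i < n → 0 < survSum hw w i := by
    intro i hi
    refine Finset.sum_pos (fun j _ => mul_pos (hw j) ?_) Finset.univ_nonempty
    simp only [surv, if_pos hi]; positivity
  have p0 := hpos i (by omega)
  have p1 := hpos (i + 1) hi
  set h := gridTime w hw (i + 1) - gridTime w hw i
  have h1 := sum_surv_sub_eq hw (Nat.le_succ i) hi.le
  push_cast at h1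
  rw [add_sub_cancel_left] at h1
  have hb := fun j => surv_sub_bounds hw hi j
  -- One mean ring per grid step pins the time step `h` between the reciprocals of the surviving
  -- weights at its two ends.
  have u1 : h * survSum hw w (i + 1) ≤ 1 := by
    rw [← h1, survSum, Finset.mul_sum]
    refine Finset.sum_le_sum fun j _ => ?_
    have := (hb j).1; simp only [h]; linarith
  have u2 : 1 ≤ h * survSum hw w i := by
    rw [← h1, survSum, Finset.mul_sum]
    refine Finset.sum_le_sum fun j _ => ?_
    have := (hb j).2; simp only [h]; linarith
  have ed : survSum hw f i - survSum hw f (i + 1)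
      = ∑ j, f j * (surv w hw i j - surv w hw (i + 1) j) := by
    rw [survSum, survSum, ← Finset.sum_sub_distrib]
    exact Finset.sum_congr rfl fun j _ => by ring
  have v1 : h * survSum hw (fun j => f j * w j) (i + 1) ≤ survSum hw f i - survSum hw f (i + 1) := by
    rw [ed, survSum, Finset.mul_sum]
    refine Finset.sum_le_sum fun j _ => ?_
    have := mul_le_mul_of_nonneg_left (hb j).1 (hf j)
    simp only [h]; linarith
  have v2 : survSum hw f i - survSum hw f (i + 1) ≤ h * survSum hw (fun j => f j * w j) i := by
    rw [ed, survSum, Finset.mul_sum]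
    refine Finset.sum_le_sum fun j _ => ?_
    have := mul_le_mul_of_nonneg_left (hb j).2 (hf j)
    simp only [h]; linarith
  have hfw : ∀ j, 0 ≤ f j * w j := fun j => mul_nonneg (hf j) (hw j).le
  have n0 := survSum_nonneg hw hfw i
  have n1 := survSum_nonneg hw hfw (i + 1)
  constructor
  · rw [div_le_iff₀ p0]
    calc survSum hw (fun j => f j * w j) (i + 1)
        ≤ (h * survSum hw w i) * survSum hw (fun j => f j * w j) (i + 1) := by nlinarith
      _ = (h * survSum hw (fun j => f j * w j) (i + 1)) * survSum hw w i := by ring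
      _ ≤ _ := by gcongr
  · rw [le_div_iff₀ p1]
    calc _ ≤ (h * survSum hw (fun j => f j * w j) i) * survSum hw w (i + 1) := by gcongr
      _ = (h * survSum hw w (i + 1)) * survSum hw (fun j => f j * w j) i := by ring
      _ ≤ _ := by nlinarith

/-- On a range of grid indices on which the surviving weight hardly changes, the increments of
`survSum f` hardly change. -/
theorem survSum_step_flat {f : Fin n → ℝ} {B : ℝ} (hf : ∀ j, 0 ≤ f j) (hfB : ∀ j, f j ≤ B)
    {lo hi : ℕ} (hpos : 0 < survSum hw w (hi + 1)) {i i' : ℕ} (h1 : lo ≤ i) (h2 : i ≤ hi)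
    (h1' : lo ≤ i') (h2' : i' ≤ hi) :
    (survSum hw f i - survSum hw f (i + 1)) - (survSum hw f i' - survSum hw f (i' + 1))
      ≤ 2 * B * (survSum hw w lo - survSum hw w (hi + 1)) / survSum hw w (hi + 1) := by
  have hn : hi + 1 < n := by
    by_contra hc
    rw [survSum_of_le hw (not_lt.1 hc)] at hpos
    exact lt_irrefl _ hpos
  have hw0 : ∀ j, 0 ≤ w j := fun j => (hw j).le
  have hfw : ∀ j, 0 ≤ f j * w j := fun j => mul_nonneg (hf j) (hw0 j)
  have ma := survSum_antitone hw hw0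
  have mb := survSum_antitone hw hfw
  set a := survSum hw w
  set b := survSum hw (fun j => f j * w j)
  have apos : ∀ i ≤ hi + 1, 0 < a i := fun i hi => lt_of_lt_of_le hpos (ma hi)
  have bn : ∀ i, 0 ≤ b i := survSum_nonneg hw hfw
  have s1 := (survSum_step_bounds hw hf (show i + 1 < n by omega)).2
  have s2 := (survSum_step_bounds hw hf (show i' + 1 < n by omega)).1
  have t1 : b i / a (i + 1) ≤ b lo / a (hi + 1) :=
    div_le_div₀ (bn lo) (mb h1) hpos (ma (by omega))
  have t2 : b (hi + 1) / a lo ≤ b (i' + 1) / a i' :=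
    div_le_div₀ (bn _) (mb (by omega)) (apos _ (by omega)) (ma h1')
  have hB0 : 0 ≤ B := (hf ⟨0, by omega⟩).trans (hfB _)
  have hbd : b lo - b (hi + 1) ≤ B * (a lo - a (hi + 1)) := by
    simp only [a, b, survSum, ← Finset.sum_sub_distrib, Finset.mul_sum]
    refine Finset.sum_le_sum fun j _ => ?_
    have hd : 0 ≤ surv w hw lo j - surv w hw (hi + 1) j :=
      sub_nonneg.2 (surv_antitone hw j (by omega))
    have := mul_le_mul_of_nonneg_right (hfB j) (mul_nonneg (hw0 j) hd)
    linarith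
  have hbB : b (hi + 1) ≤ B * a (hi + 1) := by
    simp only [a, b, survSum, Finset.mul_sum]
    refine Finset.sum_le_sum fun j _ => ?_
    have := mul_le_mul_of_nonneg_right (hfB j) (mul_nonneg (hw0 j) (surv_nonneg hw (hi + 1) j))
    linarith
  have plo := apos lo (by omega)
  have hle : a (hi + 1) ≤ a lo := ma (by omega)
  -- All increments on the range lie between the two quotients on the left, so their differences are
  -- bounded by the gap.
  have key : b lo / a (hi + 1) - b (hi + 1) / a lo ≤ 2 * B * (a lo - a (hi + 1)) / a (hi + 1) := by
    have e1 : b lo / a (hi + 1) - b (hi + 1) / a lo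
        = (b lo - b (hi + 1)) / a (hi + 1)
          + b (hi + 1) / a lo * ((a lo - a (hi + 1)) / a (hi + 1)) := by
      field_simp; ring
    have e2 : b (hi + 1) / a lo ≤ B := by
      rw [div_le_iff₀ plo]
      exact hbB.trans (by gcongr)
    rw [e1]
    calc _ ≤ B * (a lo - a (hi + 1)) / a (hi + 1) + B * ((a lo - a (hi + 1)) / a (hi + 1)) := by
          gcongr
      _ = _ := by ring
  linarith

end Survival


/-! ### Chernoff bounds for sums of independent indicators. -/

section Concentration

open ProbabilityTheory

variable {n : ℕ}

/-- A centred sum of independent indicators. -/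
noncomputable def centredRings (w c : Fin n → ℝ) (A : Fin n → Set ℝ) (T : Fin n → ℝ) : ℝ :=
  ∑ j, c j * (Set.indicator (A j) (fun _ => (1 : ℝ)) (T j) - (expMeasure (w j)).real (A j))

/-- A Bernoulli variable has only two values; the quadratic bound of `exp` at both gives exactly the
variance `p * (1 - p)`. -/
theorem integral_exp_indicator_le {ν : Measure ℝ} [IsProbabilityMeasure ν] {A : Set ℝ}
    (hA : MeasurableSet A) {s : ℝ} (hs : |s| ≤ 1) :
    ∫ t, Real.exp (s * (Set.indicator A (fun _ => (1 : ℝ)) t - ν.real A)) ∂ν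
      ≤ Real.exp (s ^ 2 * (ν.real A * (1 - ν.real A))) := by
  set p := ν.real A
  have hp0 : 0 ≤ p := measureReal_nonneg
  have hp1 : p ≤ 1 := measureReal_le_one
  have h1 : ∀ t, Real.exp (s * (Set.indicator A (fun _ => (1 : ℝ)) t - p))
      = Set.indicator A (fun _ => Real.exp (s * (1 - p)) - Real.exp (s * (0 - p))) t
        + Real.exp (s * (0 - p)) := by
    intro t
    by_cases ht : t ∈ A
    · simp [ht]
    · simp [ht]
  refine (integral_congr_ae (Eventually.of_forall h1)).le.trans ?_
  rw [integral_add ((integrable_const _).indicator hA) (integrable_const _),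
    integral_indicator_const _ hA]
  simp only [integral_const, probReal_univ, smul_eq_mul, one_mul]
  have e1 : Real.exp (s * (1 - p)) ≤ 1 + s * (1 - p) + (s * (1 - p)) ^ 2 := by
    apply exp_le_one_add_sq
    rw [abs_mul, abs_of_nonneg (by linarith : 0 ≤ 1 - p)]
    nlinarith [abs_nonneg s]
  have e2 : Real.exp (s * (0 - p)) ≤ 1 + s * (0 - p) + (s * (0 - p)) ^ 2 := by
    apply exp_le_one_add_sq
    rw [abs_mul, zero_sub, abs_neg, abs_of_nonneg hp0]
    nlinarith [abs_nonneg s]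
  have e3 := Real.add_one_le_exp (s ^ 2 * (p * (1 - p)))
  have q : 0 ≤ 1 - p := by linarith
  calc p * (Real.exp (s * (1 - p)) - Real.exp (s * (0 - p))) + Real.exp (s * (0 - p))
      = p * Real.exp (s * (1 - p)) + (1 - p) * Real.exp (s * (0 - p)) := by ring
    _ ≤ p * (1 + s * (1 - p) + (s * (1 - p)) ^ 2) + (1 - p) * (1 + s * (0 - p) + (s * (0 - p)) ^ 2) := by
        gcongr
    _ = s ^ 2 * (p * (1 - p)) + 1 := by ring
    _ ≤ _ := e3

theorem centredRings_tail {w c : Fin n → ℝ} {A : Fin n → Set ℝ} (hw : ∀ j, 0 < w j)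
    (hA : ∀ j, MeasurableSet (A j)) {lam b v x : ℝ} (hlam : 0 ≤ lam) (hb : lam * b ≤ 1)
    (hcb : ∀ j, |c j| ≤ b)
    (hv : ∑ j, c j ^ 2 * ((expMeasure (w j)).real (A j) * (1 - (expMeasure (w j)).real (A j))) ≤ v) :
    (clock w).real {T | x ≤ |centredRings w c A T|} ≤ 2 * Real.exp (-(lam * x) + lam ^ 2 * v) := by
  classical
  have hp : ∀ i, IsProbabilityMeasure (expMeasure (w i)) := fun i =>
    isProbabilityMeasure_expMeasure (hw i)
  have := isProbabilityMeasure_clock hw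
  have main : ∀ s : ℝ, |s| = lam →
      (clock w).real {T | lam * x ≤ s * centredRings w c A T}
        ≤ Real.exp (-(lam * x) + lam ^ 2 * v) := by
    intro s hs
    have hs2 : s ^ 2 = lam ^ 2 := by rw [← sq_abs, hs]
    have hexp : ∀ T, Real.exp (s * centredRings w c A T) = ∏ j, Real.exp ((s * c j) *
        (Set.indicator (A j) (fun _ => (1 : ℝ)) (T j) - (expMeasure (w j)).real (A j))) := by
      intro T
      rw [centredRings, Finset.mul_sum, Real.exp_sum]
      exact Finset.prod_congr rfl fun j _ => by rw [mul_assoc]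
    have hmeas : Measurable fun T => centredRings w c A T := by
      unfold centredRings
      refine Finset.measurable_sum _ fun j _ => ?_
      refine Measurable.const_mul (Measurable.sub_const ?_ _) _
      exact (measurable_const.indicator (hA j)).comp (measurable_pi_apply j)
    have hint : ∫ T, Real.exp (s * centredRings w c A T) ∂(clock w) ≤ Real.exp (lam ^ 2 * v) := by
      simp_rw [hexp]
      rw [clock, integral_fintype_prod_eq_prod (fun j t => Real.exp ((s * c j) *
        (Set.indicator (A j) (fun _ => (1 : ℝ)) t - (expMeasure (w j)).real (A j))))]
      calc _ ≤ ∏ j, Real.exp ((s * c j) ^ 2 *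
            ((expMeasure (w j)).real (A j) * (1 - (expMeasure (w j)).real (A j)))) := by
            refine Finset.prod_le_prod (fun j _ => integral_nonneg fun t => (Real.exp_pos _).le)
              fun j _ => integral_exp_indicator_le (hA j) ?_
            rw [abs_mul, hs]
            exact (mul_le_mul_of_nonneg_left (hcb j) hlam).trans hb
        _ = Real.exp (lam ^ 2 * ∑ j, c j ^ 2 *
            ((expMeasure (w j)).real (A j) * (1 - (expMeasure (w j)).real (A j)))) := by
            rw [← Real.exp_sum, Finset.mul_sum]
            congr 1
            exact Finset.sum_congr rfl fun j _ => by rw [mul_pow, hs2, mul_assoc]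
        _ ≤ _ := by gcongr
    have hbd : ∀ T, |centredRings w c A T| ≤ ∑ _j : Fin n, b := by
      intro T
      refine (Finset.abs_sum_le_sum_abs _ _).trans (Finset.sum_le_sum fun j _ => ?_)
      rw [abs_mul]
      have h0 : 0 ≤ (expMeasure (w j)).real (A j) := measureReal_nonneg
      have h1 : (expMeasure (w j)).real (A j) ≤ 1 := measureReal_le_one
      have h2 : |Set.indicator (A j) (fun _ => (1 : ℝ)) (T j) - (expMeasure (w j)).real (A j)| ≤ 1 := by
        rw [Set.indicator_apply, abs_le]
        split_ifs <;> constructor <;> linarith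
      calc _ ≤ |c j| * 1 := by gcongr
        _ ≤ b := by rw [mul_one]; exact hcb j
    have hI : Integrable (fun T => Real.exp (s * centredRings w c A T)) (clock w) := by
      refine Integrable.of_bound (hmeas.const_mul s).exp.aestronglyMeasurable
        (Real.exp (lam * ∑ _j : Fin n, b)) (Eventually.of_forall fun T => ?_)
      rw [Real.norm_eq_abs, Real.abs_exp]
      apply Real.exp_le_exp.2
      calc _ ≤ |s * centredRings w c A T| := le_abs_self _
        _ = lam * |centredRings w c A T| := by rw [abs_mul, hs]
        _ ≤ _ := mul_le_mul_of_nonneg_left (hbd T) hlam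
    have hset : {T | lam * x ≤ s * centredRings w c A T}
        = {T | Real.exp (lam * x) ≤ Real.exp (s * centredRings w c A T)} := by
      ext T; simp
    rw [hset]
    have hmk := mul_meas_ge_le_integral_of_nonneg (μ := clock w)
      (Eventually.of_forall fun T => (Real.exp_pos (s * centredRings w c A T)).le) hI
      (Real.exp (lam * x))
    rw [Real.exp_add, Real.exp_neg, ← div_eq_inv_mul, le_div_iff₀ (Real.exp_pos _), mul_comm]
    exact hmk.trans hint
  rcases hlam.eq_or_lt with h0 | h0
  · subst h0
    have := measureReal_le_one (μ := clock w) (s := {T | x ≤ |centredRings w c A T|})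
    simp only [zero_mul, neg_zero, ne_eq, OfNat.ofNat_ne_zero, not_false_eq_true, zero_pow,
      add_zero, Real.exp_zero]
    linarith
  have hsub : {T | x ≤ |centredRings w c A T|} ⊆ {T | lam * x ≤ lam * centredRings w c A T}
      ∪ {T | lam * x ≤ (-lam) * centredRings w c A T} := by
    intro T hT
    rcases le_abs.1 (show x ≤ |centredRings w c A T| from hT) with h4 | h4
    · exact Or.inl (mul_le_mul_of_nonneg_left h4 hlam)
    · refine Or.inr ?_
      change lam * x ≤ -lam * _
      rw [neg_mul, ← mul_neg]
      exact mul_le_mul_of_nonneg_left h4 hlam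
  calc _ ≤ _ := measureReal_mono hsub
    _ ≤ _ := measureReal_union_le _ _
    _ ≤ _ := by
      have h1 := main lam (abs_of_pos h0)
      have h2 := main (-lam) (by rw [abs_neg, abs_of_pos h0])
      linarith

end Concentration

/-! ### Counts and sums over the clocks rung at a grid time. -/

section Rings

open ProbabilityTheory

variable {n : ℕ} {w : Fin n → ℝ} (hw : ∀ j, 0 < w j)

/-- The times before the `i`-th grid time. -/
noncomputable def ringSet (w : Fin n → ℝ) (hw : ∀ j, 0 < w j) (i : ℕ) : Set ℝ :=
  if i < n then Set.Iic (gridTime w hw i) else Set.univ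

theorem measurableSet_ringSet (i : ℕ) : MeasurableSet (ringSet w hw i) := by
  unfold ringSet; split_ifs
  · exact measurableSet_Iic
  · exact MeasurableSet.univ

theorem ringSet_mono : Monotone (ringSet w hw) := by
  intro i i' hii
  by_cases hi' : i' < n
  · simp only [ringSet, if_pos hi', if_pos (show i < n by omega)]
    exact Set.Iic_subset_Iic.2 (gridTime_mono hw hii hi')
  · simp [ringSet, hi']

theorem ringSet_lower (i : ℕ) : IsLowerSet (ringSet w hw i) := by
  unfold ringSet; split_ifs
  · exact isLowerSet_Iic _
  · exact isLowerSet_univ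

theorem real_ringSet (i : ℕ) (j : Fin n) :
    (expMeasure (w j)).real (ringSet w hw i) = 1 - surv w hw i j := by
  have := isProbabilityMeasure_expMeasure (hw j)
  unfold ringSet surv
  split_ifs with hi
  · rw [← cdf_eq_real, cdf_expMeasure_eq (hw j), if_pos (gridTime_nonneg hw i)]
  · simp

theorem real_ringSet_diff {i i' : ℕ} (hii : i ≤ i') (j : Fin n) :
    (expMeasure (w j)).real (ringSet w hw i' \ ringSet w hw i) = surv w hw i j - surv w hw i' j := by
  have := isProbabilityMeasure_expMeasure (hw j)
  rw [measureReal_sdiff (ringSet_mono hw hii) (measurableSet_ringSet hw i), real_ringSet,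
    real_ringSet]
  ring

open Classical in
/-- The clocks which have rung at the `i`-th grid time. -/
noncomputable def rung (w : Fin n → ℝ) (hw : ∀ j, 0 < w j) (i : ℕ) (T : Fin n → ℝ) :
    Finset (Fin n) := Finset.univ.filter fun j => T j ∈ ringSet w hw i

theorem mem_rung (i : ℕ) (T : Fin n → ℝ) (j : Fin n) :
    j ∈ rung w hw i T ↔ T j ∈ ringSet w hw i := by
  simp [rung]

theorem rung_mono (T : Fin n → ℝ) : Monotone fun i => rung w hw i T := by
  intro i i' hii j hj
  rw [mem_rung] at *
  exact ringSet_mono hw hii hj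

theorem rung_zero {T : Fin n → ℝ} (hT : ∀ j, 0 < T j) : rung w hw 0 T = ∅ := by
  ext j
  have hn : 0 < n := by have := j.is_lt; omega
  simp only [mem_rung, ringSet, if_pos hn, gridTime_zero, Set.mem_Iic, Finset.notMem_empty,
    iff_false, not_le]
  exact hT j

theorem rung_last (T : Fin n → ℝ) : rung w hw n T = Finset.univ := by
  ext j; simp [mem_rung, ringSet]

/-- The clocks which have rung are the first drawn indices. -/
theorem rung_eq_drawn {a : Fin n → Fin n} (ha : Function.Injective a) {T : Fin n → ℝ}
    (hT : T ∈ ringOrder a) (i : ℕ) : rung w hw i T = drawn (rung w hw i T).card a := by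
  classical
  have hs := Finite.injective_iff_surjective.1 ha
  let S : Finset (Fin n) := Finset.univ.filter fun t => T (a t) ∈ ringSet w hw i
  have hS : S.image a = rung w hw i T := by
    ext j
    simp only [S, Finset.mem_image, Finset.mem_filter, Finset.mem_univ, true_and, mem_rung]
    constructor
    · rintro ⟨t, ht, rfl⟩; exact ht
    · intro hj
      obtain ⟨t, rfl⟩ := hs j
      exact ⟨t, hj, rfl⟩
  have hcard : (rung w hw i T).card = S.card := by
    rw [← hS, Finset.card_image_of_injective _ ha]
  have hlow : ∀ t ∈ S, ∀ t' ≤ t, t' ∈ S := by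
    intro t ht t' htt
    simp only [S, Finset.mem_filter, Finset.mem_univ, true_and] at ht ⊢
    exact ringSet_lower hw i (hT.2.monotone htt) ht
  have hsub : S ⊆ Finset.univ.filter fun t : Fin n => (t : ℕ) < S.card := by
    intro t ht
    simp only [Finset.mem_filter, Finset.mem_univ, true_and]
    have h1 : Finset.Iic t ⊆ S := fun t' ht' => hlow t ht t' (Finset.mem_Iic.1 ht')
    have h2 := Finset.card_le_card h1
    rw [Fin.card_Iic] at h2
    omega
  have hSeq : S = Finset.univ.filter fun t : Fin n => (t : ℕ) < S.card := by
    apply Finset.eq_of_subset_of_card_le hsub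
    rw [Fin.card_filter_val_lt]
    exact min_le_right _ _
  rw [hcard, drawn, ← hSeq, hS]

theorem centredRings_diff (c : Fin n → ℝ) {i i' : ℕ} (hii : i ≤ i') (T : Fin n → ℝ) :
    centredRings w c (fun _ => ringSet w hw i' \ ringSet w hw i) T
      = ∑ j ∈ rung w hw i' T, c j - ∑ j ∈ rung w hw i T, c j
        - (survSum hw c i - survSum hw c i') := by
  classical
  have e1 : ∀ j, Set.indicator (ringSet w hw i' \ ringSet w hw i) (fun _ => (1 : ℝ)) (T j)
      = (if j ∈ rung w hw i' T then 1 else 0) - (if j ∈ rung w hw i T then 1 else 0) := by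
    intro j
    simp only [Set.indicator_apply, Set.mem_sdiff, mem_rung]
    by_cases h1 : T j ∈ ringSet w hw i
    · have h2 := ringSet_mono hw hii h1
      simp [h1, h2]
    · simp [h1]
  have e2 : ∀ i, ∑ j ∈ rung w hw i T, c j = ∑ j, c j * (if j ∈ rung w hw i T then 1 else 0) := by
    intro i
    simp
  rw [centredRings, e2, e2, survSum, survSum, ← Finset.sum_sub_distrib, ← Finset.sum_sub_distrib,
    ← Finset.sum_sub_distrib]
  refine Finset.sum_congr rfl fun j _ => ?_
  rw [e1, real_ringSet_diff hw hii]
  ring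

theorem variance_diff_le {c : Fin n → ℝ} {B : ℝ} (hc : ∀ j, |c j| ≤ B) {i i' : ℕ} (hii : i ≤ i') :
    ∑ j, c j ^ 2 * ((expMeasure (w j)).real (ringSet w hw i' \ ringSet w hw i)
      * (1 - (expMeasure (w j)).real (ringSet w hw i' \ ringSet w hw i)))
      ≤ B ^ 2 * ((i' : ℝ) - i) := by
  calc _ ≤ ∑ j, B ^ 2 * (surv w hw i j - surv w hw i' j) := by
        refine Finset.sum_le_sum fun j _ => ?_
        rw [real_ringSet_diff hw hii]
        have h0 : 0 ≤ surv w hw i j - surv w hw i' j := sub_nonneg.2 (surv_antitone hw j hii)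
        have h2 : c j ^ 2 ≤ B ^ 2 := by
          rw [← sq_abs]; exact pow_le_pow_left₀ (abs_nonneg _) (hc j) 2
        have h3 : (surv w hw i j - surv w hw i' j) * (1 - (surv w hw i j - surv w hw i' j))
            ≤ surv w hw i j - surv w hw i' j := by nlinarith
        calc _ ≤ c j ^ 2 * (surv w hw i j - surv w hw i' j) := by gcongr
          _ ≤ _ := by gcongr
    _ = B ^ 2 * ∑ j, (surv w hw i j - surv w hw i' j) := by rw [Finset.mul_sum]
    _ ≤ _ := by gcongr; exact sum_surv_sub_le hw hii

/-- The ringing probability is at most `w j * t`, so the variance is controlled by the surviving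
weight. Late in the process this can be much smaller than the number of draws. -/
theorem variance_count_le (i : ℕ) {t : ℝ} (ht : i < n → gridTime w hw i ≤ t) :
    ∑ j, (1 : ℝ) ^ 2 * ((expMeasure (w j)).real (ringSet w hw i)
      * (1 - (expMeasure (w j)).real (ringSet w hw i))) ≤ t * survSum hw w i := by
  rw [survSum, Finset.mul_sum]
  refine Finset.sum_le_sum fun j _ => ?_
  rw [real_ringSet, one_pow, one_mul]
  by_cases hi : i < n
  · have h1 : 1 - surv w hw i j ≤ w j * gridTime w hw i := by
      simp only [surv, if_pos hi]
      have := Real.add_one_le_exp (-(w j * gridTime w hw i))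
      linarith
    have h2 : 1 - surv w hw i j ≤ w j * t :=
      h1.trans (mul_le_mul_of_nonneg_left (ht hi) (hw j).le)
    have h3 := surv_nonneg hw i j
    have := mul_le_mul_of_nonneg_right h2 h3
    linarith
  · simp [surv, hi]

theorem centredRings_count (i : ℕ) (hi : i ≤ n) (T : Fin n → ℝ) :
    centredRings w (fun _ => 1) (fun _ => ringSet w hw i) T = (rung w hw i T).card - (i : ℝ) := by
  classical
  have e1 : ∀ j, Set.indicator (ringSet w hw i) (fun _ => (1 : ℝ)) (T j)
      = if j ∈ rung w hw i T then 1 else 0 := by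
    intro j
    simp only [Set.indicator_apply, mem_rung]
  simp only [centredRings, e1, one_mul, real_ringSet]
  rw [Finset.sum_sub_distrib, Finset.sum_sub_distrib, sum_surv, Nat.cast_sub hi]
  simp

end Rings


/-! ### Concentration of bounded functions over windows of any position. -/

section Core

open ProbabilityTheory

variable {n : ℕ} {w : Fin n → ℝ} (hw : ∀ j, 0 < w j)

theorem abs_cum_step_le {f : Fin n → ℝ} {B : ℝ} (hB : 0 ≤ B) (hf : ∀ j, |f j| ≤ B)
    {a : Fin n → Fin n} (ha : Function.Injective a) (i : ℕ) :
    |cum f i a - cum f (i + 1) a| ≤ B := by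
  by_cases hi : i < n
  · have := cum_succ ha f ⟨i, hi⟩
    simp only at this
    rw [this, sub_add_cancel_left, abs_neg]
    exact hf _
  · have : drawn (i + 1) a = drawn i a := by
      unfold drawn
      congr 1
      ext t
      have := t.is_lt
      simp only [Finset.mem_filter, Finset.mem_univ, true_and]
      omega
    rw [cum, cum, this, sub_self, abs_zero]
    exact hB

theorem survSum_pos {i : ℕ} (hi : i < n) : 0 < survSum hw w i := by
  have : Nonempty (Fin n) := ⟨⟨i, hi⟩⟩
  refine Finset.sum_pos (fun j _ => mul_pos (hw j) ?_) Finset.univ_nonempty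
  simp only [surv, if_pos hi]; positivity

theorem abs_survSum_step_le {f : Fin n → ℝ} {B : ℝ} (hB : 0 ≤ B) (hf : ∀ j, 0 ≤ f j)
    (hfB : ∀ j, f j ≤ B) (i : ℕ) : |survSum hw f i - survSum hw f (i + 1)| ≤ B := by
  rw [abs_of_nonneg (sub_nonneg.2 (survSum_antitone hw hf (Nat.le_succ i)))]
  have := survSum_sub_le hw hB hfB (Nat.le_succ i)
  push_cast at this
  linarith

/-- Moving the start of a window along the grid by at most `Δ` changes the increment of the mean
curve only little. -/
theorem survSum_shift_le (hL : 0 < totalWeight w) (hQ : ∑ j, w j ^ 2 ≤ 2 * totalWeight w)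
    {f : Fin n → ℝ} {B : ℝ} (hB : 1 ≤ B) (hf : ∀ j, 0 ≤ f j) (hfB : ∀ j, f j ≤ B)
    {l k Δ : ℕ} {ε t : ℝ} (hε0 : 0 < ε) (hε1 : ε ≤ 1) (hl : l < n) (ht1 : 1 ≤ t)
    (hx : 1 ≤ ε * k) (ht : 48 * B / ε ^ 3 ≤ t)
    (hΔ : (Δ : ℝ) ≤ max (ε * k) (Real.sqrt (survSum hw w l * k / t)) + 1)
    {p u : ℕ} (hp1 : l ≤ p + Δ) (hp2 : p ≤ l + Δ) (hu : u ≤ k) :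
    |survSum hw f p - survSum hw f (p + u) - (survSum hw f l - survSum hw f (l + u))|
      ≤ 4 * B * (ε * k) := by
  set G := survSum hw f
  set x := ε * k
  set a := survSum hw w l with ha
  have hapos : 0 < a := survSum_pos hw hl
  set r := Real.sqrt (a * k / t) with hr
  have hB0 : 0 ≤ B := by linarith
  have hstep := abs_survSum_step_le hw hB0 hf hfB
  have hp1' : (l : ℝ) ≤ p + Δ := by exact_mod_cast hp1
  have hp2' : (p : ℝ) ≤ l + Δ := by exact_mod_cast hp2
  have huk : (u : ℝ) ≤ k := by exact_mod_cast hu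
  -- If `r ≤ x`, the shift is at most `2 * x` and the Lipschitz bound of `G` at both ends suffices.
  -- If `x < r`, the surviving weight is so large compared with shift and length that the increments
  -- of `G` vary by at most `ε`.
  rcases le_or_gt r x with h | h
  · rw [max_eq_left h] at hΔ
    have hd : |(p : ℝ) - l| ≤ 2 * x := by
      rw [abs_le]; constructor <;> linarith
    have e1 := abs_sub_le_of_step hstep p l
    have e2 := abs_sub_le_of_step hstep (p + u) (l + u)
    have hd2 : |((p + u : ℕ) : ℝ) - ((l + u : ℕ) : ℝ)| ≤ 2 * x := by
      push_cast; rw [add_sub_add_right_eq_sub]; exact hd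
    have e1' : |G p - G l| ≤ B * (2 * x) := e1.trans (by gcongr)
    have e2' : |G (p + u) - G (l + u)| ≤ B * (2 * x) := e2.trans (by gcongr)
    have : G p - G (p + u) - (G l - G (l + u)) = (G p - G l) - (G (p + u) - G (l + u)) := by ring
    rw [this]
    calc _ ≤ _ := abs_sub _ _
      _ ≤ B * (2 * x) + B * (2 * x) := add_le_add e1' e2'
      _ = _ := by ring
  · rw [max_eq_right h.le] at hΔ
    have ht0 : 0 < t := by linarith
    have hk0 : (0 : ℝ) < k := by
      by_contra hc
      have : (k : ℝ) = 0 := le_antisymm (not_lt.1 hc) (Nat.cast_nonneg k)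
      simp only [x, this, mul_zero] at hx
      linarith
    have hr2 : r ^ 2 * t = a * k := by
      rw [hr, Real.sq_sqrt (by positivity)]; field_simp
    have hr1 : 1 < r := lt_of_le_of_lt hx h
    have h3 : ε * r * t ≤ a := by
      have : ε * r * t * k ≤ a * k := by
        rw [← hr2]
        calc ε * r * t * k = x * (r * t) := by simp only [x]; ring
          _ ≤ r * (r * t) := by gcongr
          _ = _ := by ring
      exact le_of_mul_le_mul_right this hk0
    have h4 : ε * (2 * Δ + k + 1) ≤ 6 * r := by
      have : ε * k ≤ r := h.le
      have h5 : ε * (2 * Δ + 1) ≤ 1 * (2 * Δ + 1) := by gcongr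
      nlinarith
    have ht' : 48 * B ≤ t * ε ^ 3 := by
      rwa [div_le_iff₀ (by positivity)] at ht
    -- Here the lower bound `48 * B / ε ^ 3` on `t` is used.
    have hkey : 8 * B * (2 * Δ + k + 1) ≤ ε * a := by
      have h5 : 8 * B * (2 * Δ + k + 1) * (ε ^ 2 * 6) ≤ ε * a * (ε ^ 2 * 6) := by
        calc 8 * B * (2 * Δ + k + 1) * (ε ^ 2 * 6) = 48 * B * (ε * (ε * (2 * Δ + k + 1))) := by ring
          _ ≤ (t * ε ^ 3) * (ε * (6 * r)) := by gcongr
          _ = (ε * r * t) * (ε * (ε ^ 2 * 6)) := by ring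
          _ ≤ a * (ε * (ε ^ 2 * 6)) := by gcongr
          _ = _ := by ring
      exact le_of_mul_le_mul_right h5 (by positivity)
    have hsum0 : (0 : ℝ) ≤ 2 * Δ + k + 1 := by positivity
    have hfar : 4 * (2 * (Δ : ℝ) + k + 1) ≤ a := by nlinarith
    have hΔ0 : (0 : ℝ) ≤ Δ := Nat.cast_nonneg _
    have a1 : survSum hw w (l - Δ) - a ≤ 2 * Δ := by
      refine (survSum_weight_sub_le hw hL hQ (Nat.sub_le l Δ)).trans ?_
      have : (l : ℝ) ≤ (l - Δ : ℕ) + Δ := by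
        have : l ≤ (l - Δ) + Δ := by omega
        exact_mod_cast this
      linarith
    have a2 : a - survSum hw w (l + Δ + k + 1) ≤ 2 * (Δ + k + 1) := by
      have := survSum_weight_sub_le hw hL hQ (show l ≤ l + Δ + k + 1 by omega)
      push_cast at this
      linarith
    have a3 : a / 2 ≤ survSum hw w (l + Δ + k + 1) := by linarith
    have hpos : 0 < survSum hw w (l + Δ + k + 1) := by linarith
    have hflat : 2 * B * (survSum hw w (l - Δ) - survSum hw w (l + Δ + k + 1))
        / survSum hw w (l + Δ + k + 1) ≤ ε := by
      rw [div_le_iff₀ hpos]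
      calc _ ≤ 2 * B * (2 * (2 * Δ + k + 1)) := by gcongr; linarith
        _ ≤ ε * (a / 2) := by linarith
        _ ≤ _ := by gcongr
    have hg : ∀ i < u, |(G (p + i) - G (p + i + 1)) - (G (l + i) - G (l + i + 1))| ≤ ε := by
      intro i hi
      have b1 := (survSum_step_flat hw hf hfB (lo := l - Δ) (hi := l + Δ + k) hpos
        (i := p + i) (i' := l + i) (by omega) (by omega) (by omega) (by omega)).trans hflat
      have b2 := (survSum_step_flat hw hf hfB (lo := l - Δ) (hi := l + Δ + k) hpos
        (i := l + i) (i' := p + i) (by omega) (by omega) (by omega) (by omega)).trans hflat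
      rw [abs_le]
      constructor <;> linarith
    have htel : ∀ q, G q - G (q + u) = ∑ i ∈ Finset.range u, (G (q + i) - G (q + i + 1)) := by
      intro q
      have := Finset.sum_range_sub' (fun i => G (q + i)) u
      simp only [add_zero] at this
      exact this.symm
    rw [htel, htel, ← Finset.sum_sub_distrib]
    calc _ ≤ ∑ i ∈ Finset.range u,
          |(G (p + i) - G (p + i + 1)) - (G (l + i) - G (l + i + 1))| := Finset.abs_sum_le_sum_abs _ _
      _ ≤ ∑ i ∈ Finset.range u, ε := Finset.sum_le_sum fun i hi => hg i (Finset.mem_range.1 hi)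
      _ = u * ε := by simp
      _ ≤ k * ε := by gcongr
      _ = x := by simp only [x]; ring
      _ ≤ _ := by nlinarith

/-- The count variance is at most `t * (α + 2 * Δ)`. The two lower bounds on `Δ` handle the two
terms: `Δ ^ 2 * t ≥ α * k` the first, `Δ ≥ ε * k` the second. -/
theorem count_tail {k Δ : ℕ} {ε t : ℝ} (ht1 : 1 ≤ t) (hε1 : ε ≤ 1)
    (hx : 1 ≤ ε * k) {α : ℝ} (hα : 0 ≤ α) (hΔx : ε * k ≤ Δ) (hΔr : Real.sqrt (α * k / t) ≤ Δ)
    {i : ℕ} (hit : gridTime w hw i ≤ t) (hiα : survSum hw w i ≤ α + 2 * Δ) :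
    (clock w).real {T | (Δ : ℝ) ≤ |centredRings w (fun _ => 1) (fun _ => ringSet w hw i) T|}
      ≤ 2 * Real.exp (-(ε * k / (24 * t ^ 2))) := by
  have ht0 : 0 < t := by linarith
  have hΔ1 : (1 : ℝ) ≤ Δ := hx.trans hΔx
  set v := t * (α + 2 * Δ) with hv
  have hv0 : 0 ≤ v := by positivity
  have hvar := (variance_count_le hw i fun _ => hit).trans
    (mul_le_mul_of_nonneg_left hiα ht0.le)
  set lam := (Δ : ℝ) / (2 * (v + Δ)) with hlam
  have hden : 0 < v + Δ := by linarith
  have hlam1 : lam * 1 ≤ 1 := by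
    rw [mul_one, hlam, div_le_one (by positivity)]; linarith
  refine (centredRings_tail hw (fun _ => measurableSet_ringSet hw i) (by positivity : 0 ≤ lam)
    hlam1 (fun _ => by simp) hvar).trans ?_
  gcongr 2 * Real.exp ?_
  have e1 : -(lam * Δ) + lam ^ 2 * v ≤ -((Δ : ℝ) ^ 2 / (4 * (v + Δ))) := by
    have h1 : lam ^ 2 * v ≤ lam ^ 2 * (v + Δ) := by gcongr; linarith
    have h2 : -(lam * Δ) + lam ^ 2 * (v + Δ) = -((Δ : ℝ) ^ 2 / (4 * (v + Δ))) := by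
      rw [hlam]; field_simp; ring
    linarith
  have e2 : ε * k / (24 * t ^ 2) ≤ (Δ : ℝ) ^ 2 / (4 * (v + Δ)) := by
    rw [div_le_div_iff₀ (by positivity) (by positivity)]
    have h1 : v + Δ ≤ t * α + 3 * t * Δ := by rw [hv]; nlinarith
    have hr2 : α * k ≤ (Δ : ℝ) ^ 2 * t := by
      have := Real.sqrt_le_left (by positivity : (0 : ℝ) ≤ Δ) |>.1 hΔr
      rwa [div_le_iff₀ ht0] at this
    have hk0 : (0 : ℝ) ≤ k := Nat.cast_nonneg k
    have h2 : ε * k * (t * α) ≤ (Δ : ℝ) ^ 2 * t ^ 2 := by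
      calc ε * k * (t * α) = ε * (t * (α * k)) := by ring
        _ ≤ 1 * (t * ((Δ : ℝ) ^ 2 * t)) := by gcongr
        _ = _ := by ring
    have h3 : ε * k * (t * Δ) ≤ (Δ : ℝ) ^ 2 * t ^ 2 := by
      calc ε * k * (t * Δ) ≤ Δ * (t * Δ) := by gcongr
        _ = (Δ : ℝ) ^ 2 * (t * 1) := by ring
        _ ≤ (Δ : ℝ) ^ 2 * (t * t) := by gcongr
        _ = _ := by ring
    calc ε * k * (4 * (v + Δ)) ≤ ε * k * (4 * (t * α + 3 * t * Δ)) := by gcongr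
      _ = 4 * (ε * k * (t * α)) + 12 * (ε * k * (t * Δ)) := by ring
      _ ≤ _ := by linarith [mul_nonneg (sq_nonneg (Δ : ℝ)) (sq_nonneg t)]
  linarith

theorem window_pair_tail {c : Fin n → ℝ} {B : ℝ} (hB : 1 ≤ B) (hc : ∀ j, |c j| ≤ B) {k : ℕ}
    {ε : ℝ} (hε0 : 0 < ε) (hε1 : ε ≤ 1) {i i' : ℕ} (hii : i ≤ i') (hik : i' ≤ i + 4 * k) :
    (clock w).real {T | ε * k ≤
        |centredRings w c (fun _ => ringSet w hw i' \ ringSet w hw i) T|}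
      ≤ 2 * Real.exp (-(ε ^ 2 * k / (16 * B ^ 2))) := by
  have hB0 : 0 < B := by linarith
  have hik' : (i' : ℝ) - i ≤ 4 * k := by
    have : (i' : ℝ) ≤ i + 4 * k := by exact_mod_cast hik
    linarith
  have hvar := (variance_diff_le hw hc hii).trans
    (mul_le_mul_of_nonneg_left hik' (sq_nonneg B))
  have hlam : ε / (8 * B ^ 2) * B ≤ 1 := by
    rw [div_mul_eq_mul_div, div_le_one (by positivity)]; nlinarith
  refine (centredRings_tail hw (fun _ => (measurableSet_ringSet hw i').diff
    (measurableSet_ringSet hw i)) (by positivity : 0 ≤ ε / (8 * B ^ 2)) hlam hc hvar).trans ?_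
  gcongr 2 * Real.exp ?_
  apply le_of_eq
  field_simp
  ring

/-- Beyond time `t` almost nothing of the bounded function survives, so a window starting later need
not be located: the reference index is stopped at `t`, where the count variance is still controlled.
-/
theorem exists_reference_index (l : ℕ) {t : ℝ} (ht : 0 ≤ t) :
    ∃ l₀ ≤ l, gridTime w hw l₀ ≤ t ∧ (l₀ = l ∨ t < gridTime w hw (l₀ + 1)) := by
  classical
  let p := Nat.findGreatest (fun i => gridTime w hw i ≤ t) l
  have hp : gridTime w hw p ≤ t :=
    Nat.findGreatest_spec (P := fun i => gridTime w hw i ≤ t) (Nat.zero_le l)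
      (by rw [gridTime_zero]; exact ht)
  have hpl : p ≤ l := Nat.findGreatest_le l
  refine ⟨p, hpl, hp, ?_⟩
  rcases hpl.eq_or_lt with h | h
  · exact Or.inl h
  · right
    by_contra hc
    have : p + 1 ≤ p := Nat.le_findGreatest (P := fun i => gridTime w hw i ≤ t) h (not_lt.1 hc)
    omega

/-- Concentration of the window sums of a bounded function of the weights, for windows of any
position. -/
theorem exists_bounded_window_mean {n : ℕ} {w : Fin n → ℝ} (hw : ∀ j, 0 < w j)
    (hL : 0 < totalWeight w)
    (hQ : ∑ j, w j ^ 2 ≤ 2 * totalWeight w)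
    {f : Fin n → ℝ} {B : ℝ} (hB : 1 ≤ B) (hf : ∀ j, 0 ≤ f j) (hfB : ∀ j, f j ≤ B)
    {l k : ℕ} {ε t : ℝ} (hε0 : 0 < ε) (hε1 : ε ≤ 1) (hk : 2 ≤ k) (hlk : l + k ≤ n) (ht1 : 1 ≤ t)
    (hx : 1 ≤ ε * k) (ht : 48 * B / ε ^ 3 ≤ t)
    (htail : ∑ j, f j * Real.exp (-(w j * t)) ≤ ε * k) :
    ∃ d : ℕ → ℝ, (∀ u, 0 ≤ d u) ∧ (∀ u ≤ k, d u ≤ B * k) ∧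
      ∀ (μ : Measure (Fin n → Fin n)) [IsProbabilityMeasure μ],
        IsSizeBiasedOrder w μ (fun k a => a k) →
        μ.real {a | ∃ u ≤ k, 15 * B * (ε * k) < |cum f (l + u) a - cum f l a - d u|}
          ≤ 4 * ((n : ℝ) + 1) ^ 2 * Real.exp (-(ε ^ 2 * k / (16 * B ^ 2)))
            + 4 * Real.exp (-(ε * k / (24 * t ^ 2))) := by
  classical
  obtain ⟨l₀, hl0, hl0t, hl0'⟩ := exists_reference_index hw l (by linarith : 0 ≤ t)
  set G := survSum hw f with hG
  have hGa : Antitone G := survSum_antitone hw hf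
  have hB0 : 0 ≤ B := by linarith
  refine ⟨fun u => G l₀ - G (l₀ + u), fun u => sub_nonneg.2 (hGa (by omega)), fun u hu => ?_, ?_⟩
  · have h1 := survSum_sub_le hw hB0 hfB (show l₀ ≤ l₀ + u by omega)
    push_cast at h1
    rw [add_sub_cancel_left] at h1
    have : (u : ℝ) ≤ k := by exact_mod_cast hu
    exact h1.trans (by gcongr)
  intro μ _ hμ
  have := isProbabilityMeasure_clock hw
  set x := ε * k with hxdef
  set α := survSum hw w l₀ with hα
  have hα0 : 0 ≤ α := survSum_nonneg hw (fun j => (hw j).le) l₀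
  -- The precision of locating the window start: large enough for `count_tail`, small enough for
  -- `survSum_shift_le`.
  set Δ := ⌈max x (Real.sqrt (α * k / t))⌉₊ with hΔ
  have hΔge : max x (Real.sqrt (α * k / t)) ≤ Δ := Nat.le_ceil _
  have hΔlt : (Δ : ℝ) ≤ max x (Real.sqrt (α * k / t)) + 1 :=
    (Nat.ceil_lt_add_one (le_max_of_le_left (by linarith))).le
  have hΔx : x ≤ Δ := (le_max_left _ _).trans hΔge
  have hΔr : Real.sqrt (α * k / t) ≤ Δ := (le_max_right _ _).trans hΔge
  have hΔ1 : 1 ≤ Δ := by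
    have : (1 : ℝ) ≤ Δ := hx.trans hΔx
    exact_mod_cast this
  have hln : l < n := by omega
  have hw0 : ∀ j, 0 ≤ w j := fun j => (hw j).le
  have hfabs : ∀ j, |f j| ≤ B := fun j => by rw [abs_of_nonneg (hf j)]; exact hfB j
  -- the exceptional events
  let E1 : ℕ × ℕ → Set (Fin n → ℝ) := fun q => {T | q.1 ≤ q.2 ∧ q.2 ≤ q.1 + 4 * k ∧ x ≤
    |centredRings w (fun _ => 1) (fun _ => ringSet w hw q.2 \ ringSet w hw q.1) T|}
  let E2 : ℕ × ℕ → Set (Fin n → ℝ) := fun q => {T | q.1 ≤ q.2 ∧ q.2 ≤ q.1 + 4 * k ∧ x ≤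
    |centredRings w f (fun _ => ringSet w hw q.2 \ ringSet w hw q.1) T|}
  let E3 : Set (Fin n → ℝ) := {T | Δ ≤ l₀ ∧
    (Δ : ℝ) ≤ |centredRings w (fun _ => 1) (fun _ => ringSet w hw (l₀ - Δ)) T|}
  let E4 : Set (Fin n → ℝ) := {T | (l₀ + Δ < n ∧ gridTime w hw (l₀ + Δ) ≤ t) ∧
    (Δ : ℝ) ≤ |centredRings w (fun _ => 1) (fun _ => ringSet w hw (l₀ + Δ)) T|}
  set s := Finset.range (n + 1) ×ˢ Finset.range (n + 1)
  set δ1 := Real.exp (-(ε ^ 2 * k / (16 * B ^ 2)))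
  set δ2 := Real.exp (-(ε * k / (24 * t ^ 2)))
  have hδ1 : 0 < δ1 := Real.exp_pos _
  have hδ2 : 0 < δ2 := Real.exp_pos _
  have p1 : ∀ q, (clock w).real (E1 q) ≤ 2 * δ1 := by
    intro q
    by_cases hq : q.1 ≤ q.2 ∧ q.2 ≤ q.1 + 4 * k
    · refine (measureReal_mono ?_).trans
        (window_pair_tail hw hB (c := fun _ => 1) (fun j => by simpa using hB) hε0 hε1 hq.1 hq.2)
      exact fun T hT => hT.2.2
    · have : E1 q = ∅ := by
        ext T
        simp only [E1, Set.mem_ofPred_eq, Set.mem_empty_iff_false, iff_false]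
        exact fun h => hq ⟨h.1, h.2.1⟩
      rw [this, measureReal_empty]; positivity
  have p2 : ∀ q, (clock w).real (E2 q) ≤ 2 * δ1 := by
    intro q
    by_cases hq : q.1 ≤ q.2 ∧ q.2 ≤ q.1 + 4 * k
    · refine (measureReal_mono ?_).trans
        (window_pair_tail hw hB hfabs hε0 hε1 hq.1 hq.2)
      exact fun T hT => hT.2.2
    · have : E2 q = ∅ := by
        ext T
        simp only [E2, Set.mem_ofPred_eq, Set.mem_empty_iff_false, iff_false]
        exact fun h => hq ⟨h.1, h.2.1⟩
      rw [this, measureReal_empty]; positivity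
  have p3 : (clock w).real E3 ≤ 2 * δ2 := by
    by_cases hq : Δ ≤ l₀
    · refine (measureReal_mono ?_).trans (count_tail hw (i := l₀ - Δ) ht1 hε1 hx hα0 hΔx hΔr
        ((gridTime_mono hw (Nat.sub_le _ _) (by omega)).trans hl0t) ?_)
      · exact fun T hT => hT.2
      · have h1 := survSum_weight_sub_le hw hL hQ (Nat.sub_le l₀ Δ)
        rw [Nat.cast_sub hq] at h1
        linarith
    · have : E3 = ∅ := by
        ext T
        simp only [E3, Set.mem_ofPred_eq, Set.mem_empty_iff_false, iff_false]
        exact fun h => hq h.1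
      rw [this, measureReal_empty]; positivity
  have p4 : (clock w).real E4 ≤ 2 * δ2 := by
    by_cases hq : l₀ + Δ < n ∧ gridTime w hw (l₀ + Δ) ≤ t
    · refine (measureReal_mono ?_).trans (count_tail hw ht1 hε1 hx hα0 hΔx hΔr
        hq.2 ?_)
      · exact fun T hT => hT.2
      · have h1 := survSum_antitone hw hw0 (show l₀ ≤ l₀ + Δ by omega)
        have : (0 : ℝ) ≤ Δ := Nat.cast_nonneg _
        linarith
    · have : E4 = ∅ := by
        ext T
        simp only [E4, Set.mem_ofPred_eq, Set.mem_empty_iff_false, iff_false]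
        exact fun h => hq h.1
      rw [this, measureReal_empty]; positivity
  -- the inclusion
  have hsub : {T | ∃ a ∈ {a | ∃ u ≤ k, 15 * B * x < |cum f (l + u) a - cum f l a
        - (G l₀ - G (l₀ + u))|}, Function.Injective a ∧ T ∈ ringOrder a}
      ⊆ ((⋃ q ∈ s, E1 q) ∪ (⋃ q ∈ s, E2 q)) ∪ (E3 ∪ E4) := by
    rintro T ⟨a, ⟨u, hu, hbad⟩, ha, hT⟩
    by_contra hcon
    simp only [Set.mem_union, Set.mem_iUnion, not_or, not_exists] at hcon
    obtain ⟨⟨n1, n2⟩, n3, n4⟩ := hcon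
    let N : ℕ → ℕ := fun i => (rung w hw i T).card
    have hN0 : N 0 = 0 := by simp only [N, rung_zero hw hT.1, Finset.card_empty]
    have hNn : N n = n := by simp only [N, rung_last, Finset.card_univ, Fintype.card_fin]
    have hNm : Monotone N := fun i j hij => Finset.card_le_card (rung_mono hw T hij)
    have hcum : ∀ i, cum f (N i) a = ∑ j ∈ rung w hw i T, f j := by
      intro i
      rw [cum, ← rung_eq_drawn hw ha hT i]
    have hmem : ∀ i i', i ≤ i' → i' ≤ n → (i, i') ∈ s := by
      intro i i' h1 h2
      simp only [s, Finset.mem_product, Finset.mem_range]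
      omega
    have h1 : ∀ i i', i ≤ i' → i' ≤ n → i' ≤ i + 4 * k →
        |(N i' : ℝ) - N i - ((i' : ℝ) - i)| ≤ x := by
      intro i i' hii hi' hik
      by_contra hc
      apply n1 (i, i') (hmem i i' hii hi')
      refine ⟨hii, hik, ?_⟩
      have e : survSum hw (fun _ => 1) i - survSum hw (fun _ => 1) i' = (i' : ℝ) - i := by
        have := sum_surv_sub_eq hw hii hi'
        rw [Finset.sum_sub_distrib] at this
        simpa [survSum] using this
      rw [centredRings_diff hw _ hii, e]
      simpa [N] using (not_le.1 hc).le
    have h2 : ∀ i i', i ≤ i' → i' ≤ n → i' ≤ i + 4 * k →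
        |cum f (N i') a - cum f (N i) a - (G i - G i')| ≤ x := by
      intro i i' hii hi' hik
      by_contra hc
      apply n2 (i, i') (hmem i i' hii hi')
      refine ⟨hii, hik, ?_⟩
      rw [centredRings_diff hw _ hii, ← hcum, ← hcum]
      exact (not_le.1 hc).le
    have hxk : x ≤ k := by
      rw [hxdef]; have : (0 : ℝ) ≤ k := Nat.cast_nonneg _
      nlinarith
    obtain ⟨p, hpn, hpmax, hpl, hp⟩ := exists_grid_start (Φ := fun i => cum f i a) hN0 hNm hNn hx
      hxk hk hB hlk (abs_cum_step_le hB0 hfabs ha) (abs_survSum_step_le hw hB0 hf hfB) h1 h2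
    have hlow : l₀ ≤ p + Δ := by
      by_cases hq : Δ ≤ l₀
      · have hNle : N (l₀ - Δ) ≤ l₀ := by
          by_contra hc
          apply n3
          refine ⟨hq, ?_⟩
          rw [centredRings_count hw _ (by omega), Nat.cast_sub hq]
          refine le_trans ?_ (le_abs_self _)
          have : (l₀ : ℝ) ≤ N (l₀ - Δ) := by exact_mod_cast (not_le.1 hc).le
          simp only [N] at this
          linarith
        have := hpmax (l₀ - Δ) (by omega) (hNle.trans hl0)
        omega
      · omega
    have hBx : x ≤ B * x := by nlinarith
    -- If `p` lies too far right, then the grid time of `l₀ + Δ` exceeds `t` (or is infinite), since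
    -- otherwise `E4` would occur. So `G` is at most `x` from there on, and `p` may be replaced by
    -- `l₀ + Δ`.
    obtain ⟨p', hp'1, hp'2, hp'3⟩ : ∃ p', l₀ ≤ p' + Δ ∧ p' ≤ l₀ + Δ ∧
        |G p - G (p + u) - (G p' - G (p' + u))| ≤ B * x := by
      by_cases hpl0 : p ≤ l₀ + Δ
      · refine ⟨p, hlow, hpl0, ?_⟩
        rw [sub_self, abs_zero]; positivity
      · rw [not_le] at hpl0
        refine ⟨l₀ + Δ, by omega, le_rfl, ?_⟩
        have hnot : ¬ (l₀ + Δ < n ∧ gridTime w hw (l₀ + Δ) ≤ t) := by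
          rintro ⟨hq1, hq2⟩
          have hll : l₀ = l := by
            rcases hl0' with h | h
            · exact h
            · exfalso
              have := gridTime_mono hw (show l₀ + 1 ≤ l₀ + Δ by omega) hq1
              linarith
          have hNgt : l < N (l₀ + Δ) := by
            by_contra hc
            apply n4
            refine ⟨⟨hq1, hq2⟩, ?_⟩
            rw [centredRings_count hw _ hq1.le]
            refine le_trans ?_ (neg_le_abs _)
            have : (N (l₀ + Δ) : ℝ) ≤ l₀ := by rw [hll] at hc ⊢; exact_mod_cast not_lt.1 hc
            simp only [N] at this
            push_cast
            linarith
          have := hNm hpl0.le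
          omega
        have hGs : G (l₀ + Δ) ≤ x := by
          by_cases hq : l₀ + Δ < n
          · have htq : t < gridTime w hw (l₀ + Δ) := by
              by_contra hc
              exact hnot ⟨hq, not_lt.1 hc⟩
            refine le_trans (Finset.sum_le_sum fun j _ => ?_) htail
            simp only [surv, if_pos hq]
            refine mul_le_mul_of_nonneg_left (Real.exp_le_exp.2 ?_) (hf j)
            have := mul_le_mul_of_nonneg_left htq.le (hw0 j)
            linarith
          · rw [hG, survSum_of_le hw (not_lt.1 hq)]; linarith
        have g1 : G p ≤ G (l₀ + Δ) := hGa hpl0.le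
        have g2 : G (p + u) ≤ G p := hGa (by omega)
        have g3 : G (l₀ + Δ + u) ≤ G (l₀ + Δ) := hGa (by omega)
        have g4 : ∀ i, 0 ≤ G i := survSum_nonneg hw hf
        have := g4 (p + u)
        have := g4 (l₀ + Δ + u)
        rw [abs_le]
        constructor <;> linarith
    have hshift := survSum_shift_le hw hL hQ hB hf hfB hε0 hε1 (show l₀ < n by omega) ht1 hx ht
      hΔlt hp'1 hp'2 hu
    rw [← hG, ← hxdef] at hshift
    have h9 := hp u hu
    have hfinal : cum f (l + u) a - cum f l a - (G l₀ - G (l₀ + u))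
        = (cum f (l + u) a - cum f l a - (G p - G (p + u)))
          + (G p - G (p + u) - (G p' - G (p' + u)))
          + (G p' - G (p' + u) - (G l₀ - G (l₀ + u))) := by ring
    -- The three pieces cost `9`, `1` and `4` times `B * x`, less than the 15 allowed.
    rw [hfinal] at hbad
    have := (abs_add_le _ _).trans (add_le_add ((abs_add_le _ _).trans (add_le_add h9 hp'3)) hshift)
    have hx0 : 0 ≤ B * x := by linarith
    linarith
  have hcard : (s.card : ℝ) = ((n : ℝ) + 1) ^ 2 := by
    simp only [s, Finset.card_product, Finset.card_range]
    push_cast; ring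
  have u1 : (clock w).real (⋃ q ∈ s, E1 q) ≤ ((n : ℝ) + 1) ^ 2 * (2 * δ1) := by
    refine (measureReal_biUnion_finset_le s E1).trans ?_
    refine (Finset.sum_le_sum fun q _ => p1 q).trans ?_
    rw [Finset.sum_const, nsmul_eq_mul, hcard]
  have u2 : (clock w).real (⋃ q ∈ s, E2 q) ≤ ((n : ℝ) + 1) ^ 2 * (2 * δ1) := by
    refine (measureReal_biUnion_finset_le s E2).trans ?_
    refine (Finset.sum_le_sum fun q _ => p2 q).trans ?_
    rw [Finset.sum_const, nsmul_eq_mul, hcard]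
  calc _ ≤ _ := hμ.real_le_clock hw _
    _ ≤ _ := measureReal_mono hsub
    _ ≤ ((clock w).real (⋃ q ∈ s, E1 q) + (clock w).real (⋃ q ∈ s, E2 q))
        + ((clock w).real E3 + (clock w).real E4) :=
        (measureReal_union_le _ _).trans (add_le_add (measureReal_union_le _ _)
          (measureReal_union_le _ _))
    _ ≤ _ := by linarith

end Core


/-! ### Short windows of any position: truncation and excess. -/

section LateWindows

variable {n : ℕ} {w : Fin n → ℝ}

/-- Cauchy–Schwarz bounds the squared weight of fewer than `k` indices by `k * 2 * L`, which is at
most `(L / 2) ^ 2`. -/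
theorem half_le_sum_of_card_compl_lt (hL : 0 < totalWeight w)
    (hQ : ∑ j, w j ^ 2 ≤ 2 * totalWeight w) {k : ℕ} (hk : 8 * (k : ℝ) ≤ totalWeight w)
    {U : Finset (Fin n)} (hU : Uᶜ.card < k) : totalWeight w / 2 ≤ ∑ j ∈ U, w j := by
  have h1 : (∑ j ∈ Uᶜ, w j) ^ 2 ≤ (totalWeight w / 2) ^ 2 := by
    calc _ ≤ (Uᶜ.card : ℝ) * ∑ j ∈ Uᶜ, w j ^ 2 := sq_sum_le_card_mul_sum_sq
      _ ≤ k * (2 * totalWeight w) := by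
        gcongr
        exact (Finset.sum_le_univ_sum_of_nonneg fun j => sq_nonneg _).trans hQ
      _ ≤ _ := by nlinarith
  have h2 := (le_abs_self _).trans (abs_le_of_sq_le_sq h1 (by positivity))
  have h3 : ∑ j ∈ Uᶜ, w j = totalWeight w - ∑ j ∈ U, w j := by
    rw [totalWeight, ← Finset.sum_add_sum_compl U w]; ring
  linarith

/-- Exponential moments of the excess of the weights above a level `B` over a window. -/
theorem IsSizeBiasedOrder.integral_exp_excess_le {μ : Measure (Fin n → Fin n)}
    [IsProbabilityMeasure μ] (hμ : IsSizeBiasedOrder w μ (fun k a => a k)) (hw : ∀ j, 0 < w j)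
    (hL : 0 < totalWeight w) (hQ : ∑ j, w j ^ 2 ≤ 2 * totalWeight w) {κ B b : ℝ}
    (hC : ∑ j, w j ^ 3 ≤ κ * totalWeight w) (hB : 0 < B) (hb : 0 < b) (hwb : ∀ j, w j ≤ b)
    {l k : ℕ} (hlk : l + k ≤ n) (hk : 8 * (k : ℝ) ≤ totalWeight w) :
    ∫ a, Real.exp (1 / b * (cum (fun j => max (w j - B) 0) (l + k) a
      - cum (fun j => max (w j - B) 0) l a)) ∂μ ≤ Real.exp (1 / b * (4 * κ * k / B)) := by
  set lam := 1 / b with hlam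
  have hlam0 : 0 < lam := by positivity
  set h : Fin n → ℝ := fun j => max (w j - B) 0 with hh
  have hh0 : ∀ j, 0 ≤ h j := fun j => le_max_right _ _
  have hhw : ∀ j, h j ≤ w j := fun j => max_le (by linarith) (hw j).le
  -- The excess over `B` is at most `w j ^ 2 / B`, so the third moment makes its size-biased mean
  -- small for large `B`.
  have hh3 : ∀ j, w j * h j ≤ w j ^ 3 / B := by
    intro j
    rw [le_div_iff₀ hB]
    have h1 : h j * B ≤ w j ^ 2 := by
      rcases le_total (w j - B) 0 with hc | hc
      · simp only [h, max_eq_right hc, zero_mul]; positivity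
      · simp only [h, max_eq_left hc]; nlinarith [hw j]
    calc w j * h j * B = w j * (h j * B) := by ring
      _ ≤ w j * w j ^ 2 := by gcongr; exact (hw j).le
      _ = _ := by ring
  have hκ : 0 ≤ κ := by
    have : 0 ≤ κ * totalWeight w :=
      (Finset.sum_nonneg fun j _ => pow_nonneg (hw j).le 3).trans hC
    exact nonneg_of_mul_nonneg_left this hL
  have hone : ∀ j, Real.exp (lam * h j) ≤ 1 + 2 * lam * h j := by
    intro j
    have h1 : lam * h j ≤ 1 := by
      rw [hlam, one_div, inv_mul_le_iff₀ hb, mul_one]; exact (hhw j).trans (hwb j)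
    have h0 : 0 ≤ lam * h j := mul_nonneg hlam0.le (hh0 j)
    have := exp_le_one_add_sq (u := lam * h j) (by rw [abs_of_nonneg h0]; exact h1)
    nlinarith
  have hmean : ∀ U : Finset (Fin n), Uᶜ.card < k →
      biasedMean w (fun j => Real.exp (lam * h j)) U ≤ 1 + 4 * lam * κ / B := by
    intro U hU
    have hhalf := half_le_sum_of_card_compl_lt hL hQ hk hU
    have hpos : 0 < ∑ j ∈ U, w j := by linarith
    have hLB : 0 < totalWeight w / 2 := by linarith
    rw [biasedMean, div_le_iff₀ hpos]
    calc _ ≤ ∑ j ∈ U, (w j + 2 * lam * (w j * h j)) := by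
          refine Finset.sum_le_sum fun j _ => ?_
          nlinarith [hone j, hw j]
      _ = ∑ j ∈ U, w j + 2 * lam * ∑ j ∈ U, w j * h j := by
          rw [Finset.sum_add_distrib, Finset.mul_sum]
      _ ≤ ∑ j ∈ U, w j + 2 * lam * (κ * totalWeight w / B) := by
          gcongr
          calc _ ≤ ∑ j, w j * h j :=
                Finset.sum_le_univ_sum_of_nonneg fun j => mul_nonneg (hw j).le (hh0 j)
            _ ≤ ∑ j, w j ^ 3 / B := Finset.sum_le_sum fun j _ => hh3 j
            _ = (∑ j, w j ^ 3) / B := by rw [Finset.sum_div]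
            _ ≤ _ := by gcongr
      _ = ∑ j ∈ U, w j + 4 * lam * κ / B * (totalWeight w / 2) := by ring
      _ ≤ ∑ j ∈ U, w j + 4 * lam * κ / B * ∑ j ∈ U, w j := by gcongr
      _ = _ := by ring
  have hmono : ∀ i j, w i ≤ w j → h i ≤ h j := fun i j hij =>
    max_le_max (by linarith) le_rfl
  refine (hμ.integral_exp_window_le hw hmono hlam0.le hlk (by positivity) hmean).trans ?_
  calc (1 + 4 * lam * κ / B) ^ k ≤ Real.exp (4 * lam * κ / B) ^ k := by
        gcongr; rw [add_comm]; exact Real.add_one_le_exp _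
    _ = _ := by rw [← Real.exp_nat_mul]; congr 1; ring

theorem cum_mono {g : Fin n → ℝ} (hg : ∀ j, 0 ≤ g j) (a : Fin n → Fin n) :
    Monotone fun i => cum g i a := fun _ _ hij =>
  Finset.sum_le_sum_of_subset_of_nonneg (drawn_mono a hij) fun j _ _ => hg j

theorem cum_sub_cum_eq_sum_sdiff (g : Fin n → ℝ) (a : Fin n → Fin n) {i j : ℕ} (hij : i ≤ j) :
    cum g j a - cum g i a = ∑ x ∈ drawn j a \ drawn i a, g x := by
  rw [cum, cum, ← Finset.sum_sdiff (drawn_mono a hij)]; ring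

theorem card_drawn_sdiff_le {a : Fin n → Fin n} (ha : Function.Injective a) {i j : ℕ}
    (hij : i ≤ j) (hj : j ≤ n) : ((drawn j a \ drawn i a).card : ℝ) ≤ (j : ℝ) - i := by
  rw [Finset.card_sdiff_of_subset (drawn_mono a hij), card_drawn ha hj,
    card_drawn ha (hij.trans hj), Nat.cast_sub hij]

set_option maxHeartbeats 1000000 in
/-- Concentration of the window sums of the weights, for short windows of any position. -/
theorem IsSizeBiasedOrder.late_window_tail {μ : Measure (Fin n → Fin n)}
    [IsProbabilityMeasure μ] (hμ : IsSizeBiasedOrder w μ (fun k a => a k)) (hw : ∀ j, 0 < w j)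
    (hL : 0 < totalWeight w) (hQ : ∑ j, w j ^ 2 ≤ 2 * totalWeight w) {κ B b θ t π : ℝ}
    (hC : ∑ j, w j ^ 3 ≤ κ * totalWeight w) (hB : 1 ≤ B) (hb : 0 < b) (hwb : ∀ j, w j ≤ b)
    {l k : ℕ} (hlk : l + k ≤ n) (hk : 8 * (k : ℝ) ≤ totalWeight w) (hθ0 : 0 < θ) (hθ1 : θ ≤ 1)
    (hBθ : 8 * κ / θ ≤ B) (hk2 : 2 ≤ k) (ht1 : 1 ≤ t) (hx : 1 ≤ θ / (15 * B) * k)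
    (ht : 48 * B / (θ / (15 * B)) ^ 3 ≤ t)
    (htail : n * (B * Real.exp (-(θ * t))) ≤ θ / (15 * B) * k)
    (hπ : 4 * ((n : ℝ) + 1) ^ 2 * Real.exp (-((θ / (15 * B)) ^ 2 * k / (16 * B ^ 2)))
            + 4 * Real.exp (-(θ / (15 * B) * k / (24 * t ^ 2))) ≤ π) (hπθ : π ≤ θ / B) :
    μ.real {a | ∃ u ≤ k, 7 * θ * k < |cum w (l + u) a - cum w l a
        - ∫ a', (cum w (l + u) a' - cum w l a') ∂μ|}
      ≤ π + Real.exp (-(θ * k / (2 * b))) := by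
  have hB0 : 0 < B := by linarith
  set ε := θ / (15 * B) with hε
  have hε0 : 0 < ε := by positivity
  have hε1 : ε ≤ 1 := by
    rw [hε, div_le_one (by positivity)]; linarith
  -- Besides being bounded, `f` vanishes for weights up to `θ`, so its survival decays like `exp
  -- (-(θ * t))`. The loss against `w` is at most `θ + h`.
  set f : Fin n → ℝ := fun j => max (min (w j) B - θ) 0 with hf
  set h : Fin n → ℝ := fun j => max (w j - B) 0 with hh
  have hf0 : ∀ j, 0 ≤ f j := fun j => le_max_right _ _
  have hh0 : ∀ j, 0 ≤ h j := fun j => le_max_right _ _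
  have hfB : ∀ j, f j ≤ B := fun j => max_le (by linarith [min_le_right (w j) B]) hB0.le
  have hfw : ∀ j, f j ≤ w j := fun j => max_le (by linarith [min_le_left (w j) B]) (hw j).le
  have hwf : ∀ j, w j ≤ f j + θ + h j := by
    intro j
    have h1 : min (w j) B - θ ≤ f j := le_max_left _ _
    have h2 : w j - B ≤ h j := le_max_left _ _
    rcases le_total (w j) B with hc | hc
    · rw [min_eq_left hc] at h1; linarith [hh0 j]
    · rw [min_eq_right hc] at h1; linarith
  have hftail : ∑ j, f j * Real.exp (-(w j * t)) ≤ ε * k := by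
    refine le_trans ?_ htail
    calc _ ≤ ∑ _j : Fin n, B * Real.exp (-(θ * t)) := by
          refine Finset.sum_le_sum fun j _ => ?_
          rcases le_total (w j) θ with hc | hc
          · have : f j = 0 := max_eq_right (by linarith [min_le_left (w j) B])
            rw [this, zero_mul]; positivity
          · refine mul_le_mul (hfB j) (Real.exp_le_exp.2 ?_) (Real.exp_pos _).le hB0.le
            nlinarith
      _ = _ := by simp
  obtain ⟨d, hd0, hdk, hd⟩ := exists_bounded_window_mean hw hL hQ hB hf0 hfB hε0 hε1 hk2 hlk ht1 hx
    ht hftail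
  have hbad := (hd μ hμ).trans hπ
  set bad := {a | ∃ u ≤ k, 15 * B * (ε * k) < |cum f (l + u) a - cum f l a - d u|} with hbaddef
  have hεθ : 15 * B * (ε * k) = θ * k := by rw [hε]; field_simp
  have hk0 : (0 : ℝ) ≤ k := Nat.cast_nonneg k
  have hκ : 0 ≤ κ := by
    have : 0 ≤ κ * totalWeight w :=
      (Finset.sum_nonneg fun j _ => pow_nonneg (hw j).le 3).trans hC
    exact nonneg_of_mul_nonneg_left this hL
  -- the excess
  let H : (Fin n → Fin n) → ℝ := fun a => cum h (l + k) a - cum h l a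
  set c := 4 * κ * k / B with hc
  have hexp : ∫ a, Real.exp (1 / b * H a) ∂μ ≤ Real.exp (1 / b * c) :=
    hμ.integral_exp_excess_le hw hL hQ hC hB0 hb hwb hlk hk
  have hcθ : c ≤ θ * k / 2 := by
    rw [div_le_iff₀ hθ0] at hBθ
    rw [hc, div_le_div_iff₀ hB0 two_pos]
    nlinarith
  -- Jensen's inequality in the form of the tangent to `exp` at `c / b`: the exponential moment also
  -- bounds the mean.
  have hEH : ∫ a, H a ∂μ ≤ θ * k := by
    have h1 : ∫ a, Real.exp (1 / b * c) * (1 + 1 / b * (H a - c)) ∂μ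
        ≤ ∫ a, Real.exp (1 / b * H a) ∂μ := by
      refine integral_mono (integrable_path _) (integrable_path _) fun a => ?_
      have : Real.exp (1 / b * H a) = Real.exp (1 / b * c) * Real.exp (1 / b * (H a - c)) := by
        rw [← Real.exp_add]; congr 1; ring
      rw [this]
      refine mul_le_mul_of_nonneg_left ?_ (Real.exp_pos _).le
      rw [add_comm]; exact Real.add_one_le_exp _
    have h2 : ∫ a, Real.exp (1 / b * c) * (1 + 1 / b * (H a - c)) ∂μ
        = Real.exp (1 / b * c) * (1 + 1 / b * (∫ a, H a ∂μ - c)) := by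
      rw [integral_const_mul, integral_add (integrable_path _) (integrable_path _),
        integral_const_mul, integral_sub (integrable_path _) (integrable_path _)]
      simp
    have h3 := h2 ▸ h1.trans hexp
    have h4 : 1 + 1 / b * (∫ a, H a ∂μ - c) ≤ 1 := by
      by_contra hcon
      have := mul_lt_mul_of_pos_left (not_le.1 hcon) (Real.exp_pos (1 / b * c))
      linarith
    have h5 : ∫ a, H a ∂μ - c ≤ 0 := by
      by_contra hcon
      have : 0 < 1 / b * (∫ a, H a ∂μ - c) := mul_pos (by positivity) (not_le.1 hcon)
      linarith
    have : 0 ≤ θ * k := by positivity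
    linarith
  have hHtail : μ.real {a | θ * k < H a} ≤ Real.exp (-(θ * k / (2 * b))) := by
    have h1 := mul_meas_ge_le_integral_of_nonneg (μ := μ)
      (f := fun a => Real.exp (1 / b * H a)) (ae_of_all _ fun a => (Real.exp_pos _).le)
      (integrable_path _) (Real.exp (1 / b * (θ * k)))
    have h2 : μ.real {a | θ * k < H a}
        ≤ μ.real {a | Real.exp (1 / b * (θ * k)) ≤ Real.exp (1 / b * H a)} := by
      refine measureReal_mono fun a (ha : θ * k < H a) => ?_
      exact Real.exp_le_exp.2 (mul_le_mul_of_nonneg_left ha.le (by positivity))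
    have h3 : Real.exp (1 / b * (θ * k)) * μ.real {a | θ * k < H a} ≤ Real.exp (1 / b * c) :=
      (mul_le_mul_of_nonneg_left h2 (Real.exp_pos _).le).trans (h1.trans hexp)
    have h4 : μ.real {a | θ * k < H a} ≤ Real.exp (1 / b * c - 1 / b * (θ * k)) := by
      rw [Real.exp_sub, le_div_iff₀ (Real.exp_pos _), mul_comm]; exact h3
    refine h4.trans (Real.exp_le_exp.2 ?_)
    have : 1 / b * c ≤ 1 / b * (θ * k / 2) := mul_le_mul_of_nonneg_left hcθ (by positivity)
    have e : θ * k / (2 * b) = 1 / b * (θ * k / 2) := by field_simp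
    rw [e]; nlinarith
  -- deterministic comparison
  have hcomp : ∀ a, Function.Injective a → ∀ u ≤ k,
      cum f (l + u) a - cum f l a ≤ cum w (l + u) a - cum w l a ∧
      cum w (l + u) a - cum w l a ≤ cum f (l + u) a - cum f l a + θ * k + H a := by
    intro a ha u hu
    have e := fun g => cum_sub_cum_eq_sum_sdiff g a (show l ≤ l + u by omega)
    rw [e, e]
    refine ⟨Finset.sum_le_sum fun j _ => hfw j, ?_⟩
    have h1 : ∑ x ∈ drawn (l + u) a \ drawn l a, h x ≤ H a := by
      rw [← e]
      exact sub_le_sub_right (cum_mono hh0 a (by omega)) _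
    have h2 := card_drawn_sdiff_le ha (show l ≤ l + u by omega) (by omega)
    push_cast at h2
    have huk : (u : ℝ) ≤ k := by exact_mod_cast hu
    calc _ ≤ ∑ x ∈ drawn (l + u) a \ drawn l a, (f x + θ + h x) :=
          Finset.sum_le_sum fun j _ => hwf j
      _ = ∑ x ∈ drawn (l + u) a \ drawn l a, f x + (drawn (l + u) a \ drawn l a).card * θ
          + ∑ x ∈ drawn (l + u) a \ drawn l a, h x := by
          rw [Finset.sum_add_distrib, Finset.sum_add_distrib, Finset.sum_const, nsmul_eq_mul]
      _ ≤ _ := by nlinarith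
  have hfk : ∀ a, Function.Injective a → ∀ u ≤ k, 0 ≤ cum f (l + u) a - cum f l a ∧
      cum f (l + u) a - cum f l a ≤ B * k := by
    intro a ha u hu
    rw [cum_sub_cum_eq_sum_sdiff f a (show l ≤ l + u by omega)]
    refine ⟨Finset.sum_nonneg fun j _ => hf0 j, ?_⟩
    have h2 := card_drawn_sdiff_le ha (show l ≤ l + u by omega) (by omega)
    push_cast at h2
    have huk : (u : ℝ) ≤ k := by exact_mod_cast hu
    refine (Finset.sum_le_card_nsmul _ _ B fun j _ => hfB j).trans ?_
    rw [nsmul_eq_mul]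
    nlinarith
  -- the mean
  have hinj := hμ.ae_injective
  -- The reference curve `d` need not be the mean. Integrating the comparison shows that it is
  -- within `4 * θ * k`: two from the comparison, one from the bad event through `π ≤ θ / B`, one
  -- from the mean excess.
  have hmean : ∀ u ≤ k, |∫ a', (cum w (l + u) a' - cum w l a') ∂μ - d u| ≤ 4 * θ * k := by
    classical
    intro u hu
    have h1 : ∀ᵐ a ∂μ, |cum w (l + u) a - cum w l a - d u|
        ≤ 2 * θ * k + B * k * bad.indicator 1 a + H a := by
      filter_upwards [hinj] with a ha
      obtain ⟨c1, c2⟩ := hcomp a ha u hu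
      have hH0 : 0 ≤ H a := sub_nonneg.2 (cum_mono hh0 a (by omega))
      have h2 : |cum f (l + u) a - cum f l a - d u| ≤ θ * k + B * k * bad.indicator 1 a := by
        by_cases hab : a ∈ bad
        · obtain ⟨f1, f2⟩ := hfk a ha u hu
          rw [Set.indicator_of_mem hab, Pi.one_apply, mul_one]
          have := hd0 u
          have := hdk u hu
          have : 0 ≤ θ * k := by positivity
          rw [abs_le]; constructor <;> linarith
        · rw [Set.indicator_of_notMem hab, mul_zero, add_zero, ← hεθ]
          by_contra hcon
          exact hab ⟨u, hu, not_le.1 hcon⟩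
      rw [abs_le] at h2 ⊢
      constructor <;> linarith [mul_nonneg hθ0.le hk0]
    have h3 : ∫ a', (cum w (l + u) a' - cum w l a') ∂μ - d u
        = ∫ a', (cum w (l + u) a' - cum w l a' - d u) ∂μ := by
      rw [integral_sub (f := fun a' => cum w (l + u) a' - cum w l a') (g := fun _ => d u)
        (integrable_path _) (integrable_path _), integral_const, probReal_univ, one_smul]
    rw [h3]
    refine abs_integral_le_integral_abs.trans
      ((integral_mono_ae (integrable_path _) (integrable_path _) h1).trans ?_)
    rw [integral_add (integrable_path _) (integrable_path _),
      integral_add (integrable_path _) (integrable_path _), integral_const, probReal_univ, one_smul,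
      integral_const_mul, integral_indicator_one (Set.toFinite bad).measurableSet]
    have h4 : B * k * μ.real bad ≤ θ * k := by
      calc B * k * μ.real bad ≤ B * k * (θ / B) := by gcongr; exact hbad.trans hπθ
        _ = _ := by field_simp
    linarith
  -- conclusion
  have hsub : {a | ∃ u ≤ k, 7 * θ * k < |cum w (l + u) a - cum w l a
        - ∫ a', (cum w (l + u) a' - cum w l a') ∂μ|}
      ⊆ (bad ∪ {a | θ * k < H a}) ∪ {a | ¬ Function.Injective a} := by
    rintro a ⟨u, hu, hau⟩
    by_contra hcon
    simp only [Set.mem_union, not_or, Set.mem_ofPred_eq, not_not, not_lt] at hcon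
    obtain ⟨⟨g1, g2⟩, g3⟩ := hcon
    obtain ⟨c1, c2⟩ := hcomp a g3 u hu
    have h2 : |cum f (l + u) a - cum f l a - d u| ≤ θ * k := by
      rw [← hεθ]
      by_contra hcon
      exact g1 ⟨u, hu, not_le.1 hcon⟩
    have h3 := hmean u hu
    have hH0 : 0 ≤ H a := sub_nonneg.2 (cum_mono hh0 a (by omega))
    apply absurd hau
    rw [not_lt]
    rw [abs_le] at h2 h3 ⊢
    constructor <;> linarith [mul_nonneg hθ0.le hk0]
  have hnull : μ.real {a | ¬ Function.Injective a} = 0 := by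
    rw [measureReal_def, ae_iff.1 hinj, ENNReal.toReal_zero]
  calc _ ≤ _ := measureReal_mono hsub
    _ ≤ (μ.real bad + μ.real {a | θ * k < H a}) + μ.real {a | ¬ Function.Injective a} :=
        (measureReal_union_le _ _).trans (add_le_add_left (measureReal_union_le _ _) _)
    _ ≤ _ := by rw [hnull]; linarith

end LateWindows


/-! ### Moments of the limit law. -/

section LimitLaw

variable {ν : Measure ℝ}

theorem IsLimitLaw.integrable_id (hν : IsLimitLaw ν) : Integrable (fun x : ℝ => x) ν := by
  have := hν.prob
  refine Integrable.mono' ((integrable_const (1 : ℝ)).add hν.third_moment)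
    measurable_id.aestronglyMeasurable ?_
  filter_upwards [hν.pos] with x hx
  simp only [Pi.add_apply, Real.norm_eq_abs, abs_of_pos hx]
  nlinarith [sq_nonneg (x - 1), sq_nonneg (x + 1), sq_nonneg x]

theorem IsLimitLaw.mean_pos (hν : IsLimitLaw ν) : 0 < ∫ x, x ∂ν := by
  have := hν.prob
  have h0 : 0 ≤ᵐ[ν] fun x : ℝ => x := hν.pos.mono fun x hx => hx.le
  refine lt_of_le_of_ne (integral_nonneg_of_ae h0) fun h => ?_
  have h1 := (integral_eq_zero_iff_of_nonneg_ae h0 hν.integrable_id).1 h.symm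
  have : ∀ᵐ x ∂ν, False := by
    filter_upwards [hν.pos, h1] with x hx hx'
    simp only [Pi.zero_apply] at hx'
    linarith
  rw [ae_iff] at this
  simp at this

theorem IsLimitLaw.third_nonneg (hν : IsLimitLaw ν) : 0 ≤ ∫ x, x ^ 3 ∂ν :=
  integral_nonneg_of_ae (hν.pos.mono fun x hx => by positivity)

/-- Cubes truncated at the level `B`. -/
noncomputable def truncCube (B : ℕ) : BoundedContinuousFunction ℝ ℝ :=
  BoundedContinuousFunction.ofNormedAddCommGroup (fun x : ℝ => min (max x 0) B ^ 3)
    (by fun_prop) ((B : ℝ) ^ 3) fun x => by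
      have h0 : 0 ≤ min (max x 0) (B : ℝ) := le_min (le_max_right _ _) (Nat.cast_nonneg B)
      rw [Real.norm_eq_abs, abs_of_nonneg (by positivity)]
      gcongr
      exact min_le_right _ _

theorem truncCube_apply (B : ℕ) (x : ℝ) : truncCube B x = min (max x 0) B ^ 3 := rfl

theorem truncCube_nonneg (B : ℕ) (x : ℝ) : 0 ≤ truncCube B x := by
  rw [truncCube_apply]
  have h0 : 0 ≤ min (max x 0) (B : ℝ) := le_min (le_max_right _ _) (Nat.cast_nonneg B)
  positivity

theorem truncCube_le (B : ℕ) (x : ℝ) : truncCube B x ≤ (B : ℝ) ^ 3 := by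
  rw [truncCube_apply]
  have h0 : 0 ≤ min (max x 0) (B : ℝ) := le_min (le_max_right _ _) (Nat.cast_nonneg B)
  gcongr
  exact min_le_right _ _

theorem truncCube_le_cube (B : ℕ) {x : ℝ} (hx : 0 < x) : truncCube B x ≤ x ^ 3 := by
  rw [truncCube_apply, max_eq_left hx.le]
  have h0 : 0 ≤ min x (B : ℝ) := le_min hx.le (Nat.cast_nonneg B)
  gcongr
  exact min_le_left _ _

theorem IsLimitLaw.tendsto_truncCube (hν : IsLimitLaw ν) :
    Tendsto (fun B : ℕ => ∫ x, truncCube B x ∂ν) atTop (𝓝 (∫ x, x ^ 3 ∂ν)) := by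
  have := hν.prob
  refine tendsto_integral_of_dominated_convergence (fun x => |x ^ 3|)
    (fun B => (truncCube B).continuous.aestronglyMeasurable) hν.third_moment.abs ?_ ?_
  · intro B
    filter_upwards [hν.pos] with x hx
    rw [Real.norm_eq_abs, abs_of_nonneg (truncCube_nonneg B x), abs_of_pos (by positivity)]
    exact truncCube_le_cube B hx
  · filter_upwards [hν.pos] with x hx
    apply tendsto_const_nhds.congr'
    filter_upwards [eventually_ge_atTop ⌈x⌉₊] with B hB
    rw [truncCube_apply, max_eq_left hx.le, min_eq_left (Nat.ceil_le.1 hB)]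

end LimitLaw

/-! ### Asymptotics of the weights and early windows. -/

section Weights

variable {ν : Measure ℝ} {w : (n : ℕ) → Fin n → ℝ}

theorem eventually_rpow_le_mul {p : ℝ} (hp : p < 1) {ε : ℝ} (hε : 0 < ε) :
    ∀ᶠ n : ℕ in atTop, (n : ℝ) ^ p ≤ ε * n := by
  have h := (tendsto_rpow_neg_atTop (sub_pos.2 hp)).comp tendsto_natCast_atTop_atTop
  filter_upwards [h.eventually (gt_mem_nhds hε), eventually_gt_atTop 0] with n hn hn0
  have hn' : (0 : ℝ) < n := by exact_mod_cast hn0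
  have e : (n : ℝ) ^ p = (n : ℝ) ^ (-(1 - p)) * n := by
    rw [← Real.rpow_add_one hn'.ne']; congr 1; ring
  rw [e]
  exact mul_le_mul_of_nonneg_right hn.le hn'.le

theorem WeightConditions.eventually_abs_total (hw : WeightConditions ν w) {ε : ℝ} (hε : 0 < ε) :
    ∀ᶠ n : ℕ in atTop, |totalWeight (w n) - (∫ x, x ∂ν) * n| ≤ ε * n := by
  filter_upwards [hw.first.bound one_pos, eventually_rpow_le_mul (p := 2 / 3) (by norm_num) hε]
    with n h1 h2
  rw [Real.norm_eq_abs, Real.norm_of_nonneg (by positivity)] at h1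
  linarith

theorem WeightConditions.eventually_abs_square (hw : WeightConditions ν w) {ε : ℝ} (hε : 0 < ε) :
    ∀ᶠ n : ℕ in atTop, |∑ i, w n i ^ 2 - (∫ x, x ^ 2 ∂ν) * n| ≤ ε * n := by
  filter_upwards [hw.second.bound one_pos, eventually_rpow_le_mul (p := 2 / 3) (by norm_num) hε]
    with n h1 h2
  rw [Real.norm_eq_abs, Real.norm_of_nonneg (by positivity)] at h1
  linarith

theorem WeightConditions.eventually_abs_cube (hw : WeightConditions ν w) {ε : ℝ} (hε : 0 < ε) :
    ∀ᶠ n : ℕ in atTop, |∑ i, w n i ^ 3 - (∫ x, x ^ 3 ∂ν) * n| ≤ ε * n := by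
  filter_upwards [hw.third.bound hε] with n h1
  rwa [Real.norm_eq_abs, Real.norm_of_nonneg (by positivity)] at h1

theorem WeightConditions.eventually_le (hw : WeightConditions ν w) {η : ℝ} (hη : 0 < η) :
    ∀ᶠ n : ℕ in atTop, ∀ j, w n j ≤ η * (n : ℝ) ^ (1 / 3 : ℝ) := by
  filter_upwards [hw.max.bound hη] with n h1 j
  rw [Real.norm_eq_abs, Real.norm_of_nonneg (by positivity)] at h1
  exact (le_ciSup (Set.finite_range _).bddAbove j).trans ((le_abs_self _).trans h1)

/-- A bound for the ratio of the sum of cubes to the sum of the weights. -/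
noncomputable def cubeRatio (ν : Measure ℝ) : ℝ := 1 + 2 * ((∫ x, x ^ 3 ∂ν) + 1) / ∫ x, x ∂ν

theorem IsLimitLaw.one_le_cubeRatio (hν : IsLimitLaw ν) : 1 ≤ cubeRatio ν := by
  have h1 := hν.mean_pos
  have h3 := hν.third_nonneg
  have : 0 ≤ 2 * ((∫ x, x ^ 3 ∂ν) + 1) / ∫ x, x ∂ν := by positivity
  rw [cubeRatio]; linarith

theorem WeightConditions.eventually_moments (hν : IsLimitLaw ν) (hw : WeightConditions ν w) :
    ∀ᶠ n : ℕ in atTop, (∫ x, x ∂ν) / 2 * n ≤ totalWeight (w n) ∧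
      totalWeight (w n) ≤ 2 * (∫ x, x ∂ν) * n ∧
      ∑ j, w n j ^ 2 ≤ 2 * totalWeight (w n) ∧
      ∑ j, w n j ^ 3 ≤ cubeRatio ν * totalWeight (w n) := by
  have h1 := hν.mean_pos
  have h3 := hν.third_nonneg
  filter_upwards [hw.eventually_abs_total (ε := (∫ x, x ∂ν) / 4) (by positivity),
    hw.eventually_abs_square (ε := (∫ x, x ∂ν) / 4) (by positivity),
    hw.eventually_abs_cube one_pos] with n a1 a2 a3
  rw [hν.second_eq_first] at a2
  rw [abs_le] at a1 a2 a3
  set μ1 := ∫ x, x ∂ν with hμ1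
  have hn : (0 : ℝ) ≤ n := Nat.cast_nonneg n
  have hmn : 0 ≤ μ1 * n := by positivity
  have e1 : μ1 / 2 * n ≤ totalWeight (w n) := by linarith
  refine ⟨e1, by linarith, by linarith, ?_⟩
  have hcr : cubeRatio ν * (μ1 / 2 * n) = μ1 / 2 * n + ((∫ x, x ^ 3 ∂ν) + 1) * n := by
    rw [cubeRatio, ← hμ1]; field_simp
  have := mul_le_mul_of_nonneg_left e1 (by linarith [hν.one_le_cubeRatio] : 0 ≤ cubeRatio ν)
  rw [hcr] at this
  linarith

/-- Uniform integrability of the cubes of the weights. -/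
theorem WeightConditions.exists_trunc (hν : IsLimitLaw ν) (hw : WeightConditions ν w) {ε : ℝ}
    (hε : 0 < ε) : ∃ B : ℕ, ∀ᶠ n : ℕ in atTop,
      ∑ j, (w n j ^ 3 - truncCube B (w n j)) ≤ ε * n := by
  -- The averages of the cubes converge by assumption, those of the truncated cubes by weak
  -- convergence. The limits differ by little once `B` is large, hence so do the averages.
  obtain ⟨B, hB⟩ := (hν.tendsto_truncCube.eventually
    (lt_mem_nhds (show (∫ x, x ^ 3 ∂ν) - ε / 3 < _ by linarith))).exists
  refine ⟨B, ?_⟩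
  filter_upwards [hw.eventually_abs_cube (ε := ε / 3) (by positivity),
    (hw.weak (truncCube B)).eventually (lt_mem_nhds
      (show (∫ x, truncCube B x ∂ν) - ε / 3 < _ by linarith)), eventually_gt_atTop 0]
    with n a1 a2 hn
  have hn' : (0 : ℝ) < n := by exact_mod_cast hn
  rw [abs_le] at a1
  rw [lt_div_iff₀ hn'] at a2
  rw [Finset.sum_sub_distrib]
  have : ((∫ x, x ^ 3 ∂ν) - ε / 3) * n ≤ (∫ x, truncCube B x ∂ν) * n := by gcongr
  linarith

/-- Over any set of `m` indices, the cubes beyond the truncation are uniformly small by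
`exists_trunc`, and the truncated ones contribute at most `m * B ^ 3`, which is small for `m ≤ δ n`.
-/
theorem WeightConditions.eventually_smallSets (hν : IsLimitLaw ν) (hw : WeightConditions ν w)
    {η : ℝ} (hη0 : 0 < η) (hη1 : η ≤ 1 / 4) :
    ∃ δ : ℝ, 0 < δ ∧ ∀ᶠ n : ℕ in atTop, ∀ m : ℕ, (m : ℝ) ≤ δ * n →
      SmallSets (w n) (cubeRatio ν) η m := by
  have h1 := hν.mean_pos
  set μ1 := ∫ x, x ∂ν with hμ1
  obtain ⟨B, hB⟩ := hw.exists_trunc hν (show 0 < η * μ1 / 4 by positivity)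
  refine ⟨η * μ1 / 4 / ((B : ℝ) ^ 3 + 1), by positivity, ?_⟩
  filter_upwards [hB, hw.eventually_moments hν, eventually_gt_atTop 0] with n hn hmom hn0 m hm
  obtain ⟨e1, -, e2, e3⟩ := hmom
  have hn' : (0 : ℝ) < n := by exact_mod_cast hn0
  have hη : η * (μ1 / 2 * n) ≤ η * totalWeight (w n) := by gcongr
  have hm0 : (0 : ℝ) ≤ m := Nat.cast_nonneg m
  have hmB : m * ((B : ℝ) ^ 3 + 1) ≤ η * μ1 / 4 * n := by
    calc m * ((B : ℝ) ^ 3 + 1) ≤ η * μ1 / 4 / ((B : ℝ) ^ 3 + 1) * n * ((B : ℝ) ^ 3 + 1) := by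
          gcongr
      _ = _ := by field_simp
  have hB0 : (0 : ℝ) ≤ m * (B : ℝ) ^ 3 := by positivity
  have hpos : 0 < η * (μ1 / 2 * n) := by positivity
  refine ⟨hw.pos n, lt_of_lt_of_le (by positivity) e1, e2, e3, fun I hI => ?_, by linarith, hη1,
    hη0.le, hν.one_le_cubeRatio⟩
  calc ∑ j ∈ I, w n j ^ 3 = ∑ j ∈ I, (w n j ^ 3 - truncCube B (w n j))
        + ∑ j ∈ I, truncCube B (w n j) := by rw [← Finset.sum_add_distrib]; simp
    _ ≤ η * μ1 / 4 * n + m * (B : ℝ) ^ 3 := by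
        refine add_le_add ((Finset.sum_le_univ_sum_of_nonneg fun j => ?_).trans hn) ?_
        · exact sub_nonneg.2 (truncCube_le_cube B (hw.pos n j))
        · refine (Finset.sum_le_card_nsmul _ _ _ fun j _ => truncCube_le B _).trans ?_
          rw [nsmul_eq_mul]
          gcongr
    _ ≤ _ := by linarith

/-- Deviations in windows among the first `δ n` draws. -/
theorem WeightConditions.eventually_early_window_tail (hν : IsLimitLaw ν)
    (hw : WeightConditions ν w) {C : ℝ} (hC : 0 < C) :
    ∃ δ : ℝ, 0 < δ ∧ ∀ᶠ n : ℕ in atTop, ∀ (l m : ℕ) (y : ℝ), l < m → m ≤ n → (m : ℝ) ≤ δ * n →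
      0 < y → (m : ℝ) * ((m : ℝ) - l) ≤ C * (y * totalWeight (w n)) →
      ∀ (μ : Measure (Fin n → Fin n)) [IsProbabilityMeasure μ],
        IsSizeBiasedOrder (w n) μ (fun k a => a k) →
        μ.real {a | ∃ j, l ≤ j ∧ j ≤ m ∧
          y / 2 ≤ |cum (w n) j a - cum (w n) l a
            - ∫ a', (cum (w n) j a' - cum (w n) l a') ∂μ|}
        ≤ 6 * Real.exp (-y ^ 2 / (2048 * cubeRatio ν *
            (y * (n : ℝ) ^ (1 / 3 : ℝ) + ((m : ℝ) - l)))) := by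
  have hκ := hν.one_le_cubeRatio
  set κ := cubeRatio ν
  -- The second entry brings the accumulated drift error below `y / 16`, given `m * (m - l) ≤ C * (y
  -- * L)`.
  set η := min (1 / 4) (1 / (16 * C * (37 + 4 * κ))) with hη
  have hη0 : 0 < η := lt_min (by norm_num) (by positivity)
  obtain ⟨δ, hδ0, hδ⟩ := hw.eventually_smallSets hν hη0 (min_le_left _ _)
  refine ⟨δ, hδ0, ?_⟩
  filter_upwards [hδ, hw.eventually_le one_pos, eventually_gt_atTop 0] with n h1 h2 hn
    l m y hlm hmn hm hy hyC μ _ hμ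
  have hs := h1 m hm
  have hL := hs.total_pos
  refine hs.window_tail hμ hmn hlm (by positivity) (by simpa using h2) hy ?_
  have e : η * (16 * C * (37 + 4 * κ)) ≤ 1 := by
    have : η ≤ 1 / (16 * C * (37 + 4 * κ)) := min_le_right _ _
    rwa [le_div_iff₀ (by positivity)] at this
  rw [mul_div_assoc', div_le_iff₀ hL]
  calc ((m : ℝ) - l) * ((37 + 4 * κ) * η * m) = m * (m - l) * ((37 + 4 * κ) * η) := by ring
    _ ≤ C * (y * totalWeight (w n)) * ((37 + 4 * κ) * η) := by gcongr
    _ = η * (16 * C * (37 + 4 * κ)) * (y / 16 * totalWeight (w n)) := by ring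
    _ ≤ 1 * (y / 16 * totalWeight (w n)) := by gcongr
    _ = _ := one_mul _

end Weights


/-! ### Choice of the parameters for late windows. -/

section LateAsymptotics

theorem eventually_pow_mul_exp_neg_le {a ε : ℝ} (ha : 0 < a) (hε : 0 < ε) (k : ℕ) :
    ∀ᶠ t : ℝ in atTop, t ^ k * Real.exp (-(a * t)) ≤ ε := by
  have h := ((Real.tendsto_pow_mul_exp_neg_atTop_nhds_zero k).comp
    (tendsto_id.const_mul_atTop ha)).const_mul ((a ^ k)⁻¹)
  rw [mul_zero] at h
  filter_upwards [h.eventually (gt_mem_nhds hε)] with t ht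
  refine le_trans (le_of_eq ?_) ht.le
  simp only [Function.comp_apply, id]
  rw [mul_pow]
  field_simp

/-- Used with `t = n ^ (1/24)`, so that `t ^ 8 = n ^ (1/3)` and `t ^ 24 = n`. Since `k` is at least
of order `t ^ 8`, both exponents exceed `y / t ^ 8` by a multiple of `t`, which absorbs the
polynomial prefactor. -/
theorem eventually_exponent_bounds {c c' K ρ θ M : ℝ} (hc : 0 < c) (hc' : 0 < c') (hK : 0 < K)
    (hρ : 0 < ρ) (hθ : 0 < θ) :
    ∀ᶠ t : ℝ in atTop, M ≤ t ∧ M * K ≤ t ^ 8 ∧ t ^ 24 * Real.exp (-(θ * t)) ≤ ρ ∧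
      ∀ y k : ℝ, t ^ 8 ≤ y → y ≤ K * k →
        4 * (t ^ 24 + 1) ^ 2 * Real.exp (-(c * k)) + 4 * Real.exp (-(c' * k / t ^ 2))
          ≤ ρ * Real.exp (-(y / t ^ 8)) := by
  filter_upwards [eventually_ge_atTop 1, eventually_ge_atTop M, eventually_ge_atTop (M * K),
    eventually_ge_atTop (2 * K / c), eventually_ge_atTop (2 * K / c'),
    eventually_pow_mul_exp_neg_le hθ hρ 24,
    eventually_pow_mul_exp_neg_le (a := c / (2 * K)) (by positivity)
      (show 0 < ρ / 32 by positivity) 48,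
    eventually_pow_mul_exp_neg_le (a := c' / (2 * K)) (by positivity)
      (show 0 < ρ / 8 by positivity) 0]
    with t h1 hMt hMK hKc hKc' hθt e1 e2
  have ht0 : 0 < t := by linarith
  have t8 : t ≤ t ^ 8 := le_self_pow₀ h1 (by norm_num)
  have t6 : t ≤ t ^ 6 := le_self_pow₀ h1 (by norm_num)
  refine ⟨hMt, hMK.trans t8, hθt, fun y k hy hyk => ?_⟩
  have hk : t ^ 8 / K ≤ k := by rw [div_le_iff₀ hK]; linarith
  have hk0 : 0 < k := lt_of_lt_of_le (by positivity) hk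
  set z := y / t ^ 8 with hz
  have hzk : z * t ^ 8 ≤ K * k := by rw [hz]; field_simp; exact hyk
  have b1 : c / (2 * K) * t + z ≤ c * k := by
    have i1 : c / (2 * K) * t ≤ c * k / 2 := by
      calc _ ≤ c / (2 * K) * t ^ 8 := by gcongr
        _ = c * (t ^ 8 / K) / 2 := by field_simp
        _ ≤ _ := by gcongr
    have i2 : z ≤ c * k / 2 := by
      rw [div_le_iff₀ hc] at hKc
      have : z * t ^ 8 ≤ c * k / 2 * t ^ 8 := by
        calc _ ≤ K * k := hzk
          _ = (2 * K) * (k / 2) := by ring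
          _ ≤ (t * c) * (k / 2) := by gcongr
          _ ≤ (t ^ 8 * c) * (k / 2) := by gcongr
          _ = _ := by ring
      exact le_of_mul_le_mul_right this (by positivity)
    linarith
  have b2 : c' / (2 * K) * t + z ≤ c' * k / t ^ 2 := by
    have i1 : c' / (2 * K) * t ≤ c' * k / t ^ 2 / 2 := by
      calc _ ≤ c' / (2 * K) * t ^ 6 := by gcongr
        _ = c' * (t ^ 8 / K) / t ^ 2 / 2 := by field_simp
        _ ≤ _ := by gcongr
    have i2 : z ≤ c' * k / t ^ 2 / 2 := by
      rw [div_le_iff₀ hc'] at hKc'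
      have : z * t ^ 8 ≤ c' * k / t ^ 2 / 2 * t ^ 8 := by
        calc _ ≤ K * k := hzk
          _ = (2 * K) * (k / 2) := by ring
          _ ≤ (t * c') * (k / 2) := by gcongr
          _ ≤ (t ^ 6 * c') * (k / 2) := by gcongr
          _ = _ := by field_simp
      exact le_of_mul_le_mul_right this (by positivity)
    linarith
  have g1 : 4 * (t ^ 24 + 1) ^ 2 * Real.exp (-(c * k)) ≤ ρ / 2 * Real.exp (-z) := by
    have t24 : 1 ≤ t ^ 24 := one_le_pow₀ h1
    calc _ ≤ 4 * (2 * t ^ 24) ^ 2 * Real.exp (-(c / (2 * K) * t) + -z) := by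
          gcongr
          · linarith
          · linarith
      _ = 16 * (t ^ 48 * Real.exp (-(c / (2 * K) * t))) * Real.exp (-z) := by
          rw [Real.exp_add]; ring
      _ ≤ 16 * (ρ / 32) * Real.exp (-z) := by gcongr
      _ = _ := by ring
  have g2 : 4 * Real.exp (-(c' * k / t ^ 2)) ≤ ρ / 2 * Real.exp (-z) := by
    rw [pow_zero, one_mul] at e2
    calc _ ≤ 4 * Real.exp (-(c' / (2 * K) * t) + -z) := by
          gcongr
          linarith
      _ = 4 * Real.exp (-(c' / (2 * K) * t)) * Real.exp (-z) := by
          rw [Real.exp_add]; ring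
      _ ≤ 4 * (ρ / 8) * Real.exp (-z) := by gcongr
      _ = _ := by ring
  linarith

variable {ν : Measure ℝ} {w : (n : ℕ) → Fin n → ℝ}

/-- Deviations in short windows of any position. -/
theorem WeightConditions.eventually_late_window_tail (hν : IsLimitLaw ν)
    (hw : WeightConditions ν w) {K₁ K₂ : ℝ} (hK₁ : 1 ≤ K₁) (hK₂ : 0 < K₂) :
    ∀ᶠ n : ℕ in atTop, ∀ (l k : ℕ) (y : ℝ), l + k ≤ n → 8 * (k : ℝ) ≤ totalWeight (w n) →
      (n : ℝ) ^ (1 / 3 : ℝ) ≤ y → (k : ℝ) ≤ K₁ * y → y ≤ K₂ * k →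
      ∀ (μ : Measure (Fin n → Fin n)) [IsProbabilityMeasure μ],
        IsSizeBiasedOrder (w n) μ (fun k a => a k) →
        μ.real {a | ∃ u ≤ k, y / 2 ≤ |cum (w n) (l + u) a - cum (w n) l a
            - ∫ a', (cum (w n) (l + u) a' - cum (w n) l a') ∂μ|}
        ≤ 2 * Real.exp (-(y / (n : ℝ) ^ (1 / 3 : ℝ))) := by
  have hκ := hν.one_le_cubeRatio
  set κ := cubeRatio ν
  -- Then `7 * θ * k ≤ 7 / 16 * y < y / 2`.
  set θ := 1 / (16 * K₁) with hθ
  have hθ0 : 0 < θ := by positivity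
  have hθ1 : θ ≤ 1 := by rw [hθ, div_le_one (by positivity)]; linarith
  set B := 8 * κ / θ with hB
  have hB1 : 1 ≤ B := by rw [hB, le_div_iff₀ hθ0]; linarith
  have hB0 : 0 < B := by linarith
  set ε := θ / (15 * B) with hε
  have hε0 : 0 < ε := by positivity
  set M := Max.max (48 * B / ε ^ 3) (Max.max (1 / ε) 2) with hM
  have hM2 : 2 ≤ M := (le_max_right _ _).trans (le_max_right _ _)
  have hMε : 1 / ε ≤ M := (le_max_left _ _).trans (le_max_right _ _)
  have htt : Tendsto (fun n : ℕ => (n : ℝ) ^ (1 / 24 : ℝ)) atTop atTop :=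
    (tendsto_rpow_atTop (by norm_num)).comp tendsto_natCast_atTop_atTop
  have hρθ : θ / B ≤ 1 := by rw [div_le_one hB0]; linarith
  -- The weights are eventually below `b = θ / (2 * K₂) * n ^ (1/3)`, and with this `b` the excess
  -- term is `exp (-(K₂ * k / n ^ (1/3)))`.
  have hη0 : 0 < θ / (2 * K₂) := by positivity
  filter_upwards [htt.eventually (eventually_exponent_bounds (c := ε ^ 2 / (16 * B ^ 2))
      (c' := ε / 24) (K := K₂) (ρ := θ / B) (θ := θ) (M := M) (by positivity) (by positivity) hK₂
      (by positivity) hθ0),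
    hw.eventually_le hη0, hw.eventually_moments hν, eventually_gt_atTop 0]
    with n hn hb hmom hn0 l k y hlk hk hy hkK hyK μ _ hμ
  obtain ⟨hMt, hMK, hθt, hexp⟩ := hn
  have hn' : (0 : ℝ) < n := by exact_mod_cast hn0
  set t := (n : ℝ) ^ (1 / 24 : ℝ) with ht
  have t24 : t ^ 24 = n := by
    rw [ht, ← Real.rpow_natCast, ← Real.rpow_mul hn'.le]; norm_num
  have t8 : (n : ℝ) ^ (1 / 3 : ℝ) = t ^ 8 := by
    rw [ht, ← Real.rpow_natCast, ← Real.rpow_mul hn'.le]; norm_num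
  have ht0 : 0 < t := by linarith
  rw [t8] at hy hb ⊢
  have hkM : M ≤ k := by
    have : K₂ * M ≤ K₂ * k := by linarith
    exact le_of_mul_le_mul_left this hK₂
  have hx : 1 ≤ ε * k := by
    have : 1 / ε ≤ k := hMε.trans hkM
    rwa [div_le_iff₀ hε0, mul_comm] at this
  have hk2 : 2 ≤ k := by
    have : (2 : ℝ) ≤ k := hM2.trans hkM
    exact_mod_cast this
  have hL : 0 < totalWeight (w n) := by
    have : (2 : ℝ) ≤ k := hM2.trans hkM
    linarith
  have hy0 : 0 < y := lt_of_lt_of_le (by positivity) hy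
  have hπ : 4 * ((n : ℝ) + 1) ^ 2 * Real.exp (-(ε ^ 2 * k / (16 * B ^ 2)))
      + 4 * Real.exp (-(ε * k / (24 * t ^ 2))) ≤ θ / B * Real.exp (-(y / t ^ 8)) := by
    have := hexp y k hy hyK
    rw [t24] at this
    refine le_trans (le_of_eq ?_) this
    congr 3
    · congr 1; ring
    · congr 1; field_simp
  have hexp1 : Real.exp (-(y / t ^ 8)) ≤ 1 := Real.exp_le_one_iff.2 (by
    have : 0 ≤ y / t ^ 8 := by positivity
    linarith)
  have main := hμ.late_window_tail (hw.pos n) hL hmom.2.2.1 (κ := κ) (B := B)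
    (b := θ / (2 * K₂) * t ^ 8) (θ := θ) (t := t) hmom.2.2.2 hB1 (by positivity) hb hlk hk hθ0 hθ1
    le_rfl hk2 (by linarith) hx ((le_max_left _ _).trans hMt) (by
      calc (n : ℝ) * (B * Real.exp (-(θ * t))) = B * (t ^ 24 * Real.exp (-(θ * t))) := by
            rw [t24]; ring
        _ ≤ B * (θ / B) := by gcongr
        _ = θ := by field_simp
        _ ≤ _ := hθ1.trans hx) hπ (mul_le_of_le_one_right (by positivity) hexp1)
  have hlast : Real.exp (-(θ * k / (2 * (θ / (2 * K₂) * t ^ 8)))) ≤ Real.exp (-(y / t ^ 8)) := by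
    refine Real.exp_le_exp.2 (neg_le_neg ?_)
    calc y / t ^ 8 ≤ K₂ * k / t ^ 8 := by gcongr
      _ = _ := by field_simp
  refine (measureReal_mono ?_).trans (main.trans ?_)
  · rintro a ⟨u, hu, hau⟩
    refine ⟨u, hu, lt_of_lt_of_le ?_ hau⟩
    have : 7 * θ * k ≤ 7 * θ * (K₁ * y) := by gcongr
    have e : 7 * θ * (K₁ * y) = 7 / 16 * y := by rw [hθ]; field_simp
    linarith
  · have : θ / B * Real.exp (-(y / t ^ 8)) ≤ Real.exp (-(y / t ^ 8)) :=
      mul_le_of_le_one_left (Real.exp_pos _).le hρθ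
    linarith

end LateAsymptotics


/-! ### Reduction of the supremum to windows with a fixed left end. -/

section Deviation

variable {n : ℕ} {w : Fin n → ℝ} {Ω : Type*} {v : Fin n → Ω → Fin n}

theorem sum_range_drawnWeight {ω : Ω} (hω : Function.Injective fun k => v k ω) {j : ℕ}
    (hj : j ≤ n) :
    ∑ k ∈ Finset.range (j + 1), drawnWeight w v k ω = cum w j fun k => v k ω := by
  induction j with
  | zero => simp [drawnWeight]
  | succ j ih =>
    rw [Finset.sum_range_succ, ih (by omega), cum_succ hω w ⟨j, hj⟩]
    simp only [drawnWeight, dif_pos (show j < n by omega)]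

/-- For `i = 0` the truncated `i - 1` is again 0, consistently with the zero weight given to index
0. -/
theorem sum_Icc_drawnWeight {ω : Ω} (hω : Function.Injective fun k => v k ω) {i j : ℕ}
    (hij : i ≤ j) (hj : j ≤ n) :
    ∑ k ∈ Finset.Icc i j, drawnWeight w v k ω
      = cum w j (fun k => v k ω) - cum w (i - 1) fun k => v k ω := by
  have hIcc : Finset.Icc i j = Finset.Ico i (j + 1) := by
    ext x; simp only [Finset.mem_Icc, Finset.mem_Ico]; omega
  rw [hIcc, Finset.sum_Ico_eq_sub _ (by omega), sum_range_drawnWeight hω hj]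
  rcases i with _ | i
  · simp
  · rw [sum_range_drawnWeight hω (by omega), Nat.add_sub_cancel]

variable [MeasurableSpace Ω] {P : Measure Ω}

/-- A large deviation in some window forces one in some window starting at the left end. -/
theorem IsSizeBiasedOrder.maxDeviation_le [IsProbabilityMeasure P] (h : IsSizeBiasedOrder w P v)
    {l m : ℕ} (hlm : l ≤ m) (hmn : m ≤ n) (y : ℝ) :
    P.real {ω | y ≤ maxDeviation w P v l m ω} ≤
      (P.map fun ω k => v k ω).real {a | ∃ j, l - 1 ≤ j ∧ j ≤ m ∧ y / 2 ≤
        |cum w j a - cum w (l - 1) a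
          - ∫ a', (cum w j a' - cum w (l - 1) a') ∂(P.map fun ω k => v k ω)|} := by
  have hm : Measurable fun ω k => v k ω := measurable_pi_lambda _ h.measurable
  set μ := P.map fun ω k => v k ω with hμ
  have : IsProbabilityMeasure μ := Measure.isProbabilityMeasure_map hm.aemeasurable
  have hinj : ∀ᵐ ω ∂P, Function.Injective fun k => v k ω :=
    ae_of_ae_map hm.aemeasurable h.map_path.ae_injective
  have hint : ∀ i j, i ≤ j → j ≤ n → ∫ ω, ∑ k ∈ Finset.Icc i j, drawnWeight w v k ω ∂P
      = ∫ a, (cum w j a - cum w (i - 1) a) ∂μ := by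
    intro i j hij hj
    rw [hμ, integral_map hm.aemeasurable (integrable_path _).aestronglyMeasurable]
    refine integral_congr_ae ?_
    filter_upwards [hinj] with ω hω
    exact sum_Icc_drawnWeight hω hij hj
  rw [hμ, map_measureReal_apply hm (Set.toFinite _).measurableSet, ← hμ, measureReal_def,
    measureReal_def]
  refine ENNReal.toReal_mono (measure_ne_top _ _) (measure_mono_ae ?_)
  filter_upwards [hinj] with ω hω (hy : y ≤ maxDeviation w P v l m ω)
  have hfin : Finite {p : ℕ × ℕ // l ≤ p.1 ∧ p.1 ≤ p.2 ∧ p.2 ≤ m} :=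
    ((Set.finite_Iic (m, m)).subset fun p hp =>
      Prod.mk_le_mk.2 ⟨hp.2.1.trans hp.2.2, hp.2.2⟩).to_subtype
  have hne : Nonempty {p : ℕ × ℕ // l ≤ p.1 ∧ p.1 ≤ p.2 ∧ p.2 ≤ m} :=
    ⟨⟨(l, l), le_rfl, le_rfl, hlm⟩⟩
  obtain ⟨⟨⟨i, j⟩, hli, hij, hjm⟩, hp⟩ := exists_eq_ciSup_of_finite
    (f := fun p : {p : ℕ × ℕ // l ≤ p.1 ∧ p.1 ≤ p.2 ∧ p.2 ≤ m} =>
      |centredSum w P v p.1.1 p.1.2 ω|)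
  simp only at hp hli hij hjm
  rw [maxDeviation, ← hp, centredSum, sum_Icc_drawnWeight hω hij (by omega),
    hint i j hij (by omega)] at hy
  set a := fun k => v k ω
  have e : ∫ a, (cum w j a - cum w (i - 1) a) ∂μ
      = ∫ a', (cum w j a' - cum w (l - 1) a') ∂μ
        - ∫ a', (cum w (i - 1) a' - cum w (l - 1) a') ∂μ := by
    rw [← integral_sub (integrable_path _) (integrable_path _)]
    congr 1; ext a; ring
  change ∃ j, l - 1 ≤ j ∧ j ≤ m ∧ y / 2 ≤ |cum w j a - cum w (l - 1) a
          - ∫ a', (cum w j a' - cum w (l - 1) a') ∂μ|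
  -- The window from `i` to `j` is the difference of those from `l` to `j` and from `l` to `i - 1`;
  -- if both deviated by less than `y / 2`, it would deviate by less than `y`.
  by_contra! hcon
  have c1 := hcon j (by omega) hjm
  have c2 := hcon (i - 1) (by omega) (by omega)
  rw [abs_lt] at c1 c2
  rcases le_abs.1 hy with hy | hy <;> linarith

end Deviation

/-! ### The two deviation inequalities. -/

theorem mul_exp_le_mul_exp {c A y V Z : ℝ} (hc : c ≤ A) (hV : 0 < V) (hVZ : V ≤ Z) (hA : 0 ≤ A) :
    c * Real.exp (-y ^ 2 / V) ≤ A * Real.exp (-y ^ 2 / Z) := by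
  refine mul_le_mul hc (Real.exp_le_exp.2 ?_) (Real.exp_pos _).le hA
  rw [neg_div, neg_div]
  exact neg_le_neg (div_le_div_of_nonneg_left (sq_nonneg y) hV hVZ)


variable {ν : Measure ℝ} {w : (n : ℕ) → Fin n → ℝ}

/-- The constant in the deviation inequalities. -/
noncomputable def deviationConst (ν : Measure ℝ) : ℝ := 6 + 4096 * cubeRatio ν

/-- Since `m = o(n)`, the window is eventually early, and `m ^ 2 = O(y L)` is the condition required
there. -/
theorem WeightConditions.initial_deviation (hν : IsLimitLaw ν) (hw : WeightConditions ν w)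
    {Abar : ℝ} (m : ℕ → ℕ) (y : ℕ → ℝ)
    (hR : Regime Abar (fun n => totalWeight (w n)) (fun n => (m n : ℝ)) y) :
    ∀ᶠ n : ℕ in atTop, ∀ (Ω : Type*) [MeasurableSpace Ω] (P : Measure Ω) [IsProbabilityMeasure P]
      (v : Fin n → Ω → Fin n), IsSizeBiasedOrder (w n) P v →
      P.real {ω | y n ≤ maxDeviation (w n) P v 0 (m n) ω} ≤
        deviationConst ν * Real.exp (-(y n) ^ 2 /
          (deviationConst ν * (y n * (n : ℝ) ^ (1 / 3 : ℝ) + (m n : ℝ)))) := by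
  have hκ := hν.one_le_cubeRatio
  have hμ1 := hν.mean_pos
  obtain ⟨C, hC0, hC⟩ := hR.a_sq_isBigO.exists_pos
  obtain ⟨δ, hδ0, hδ⟩ := hw.eventually_early_window_tail hν hC0
  filter_upwards [hC.bound, hδ, hw.eventually_moments hν, hR.tendsto_a.eventually_gt_atTop 0,
    hR.tendsto_b.eventually_gt_atTop 0, hR.a_isLittleO.bound hδ0, hR.a_isLittleO.bound one_pos,
    eventually_gt_atTop 0] with n h1 h2 hmom hm0 hy0 hmδ hmn hn Ω _ P _ v hv
  have hn' : (0 : ℝ) < n := by exact_mod_cast hn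
  have hL : 0 < totalWeight (w n) := lt_of_lt_of_le (by positivity) hmom.1
  rw [Real.norm_of_nonneg (by positivity), Real.norm_of_nonneg (by positivity)] at hmδ hmn h1
  have hmn' : m n ≤ n := by rw [one_mul] at hmn; exact_mod_cast hmn
  have hm0' : 0 < m n := by exact_mod_cast hm0
  have hm : Measurable fun ω k => v k ω := measurable_pi_lambda _ hv.measurable
  have : IsProbabilityMeasure (P.map fun ω k => v k ω) :=
    Measure.isProbabilityMeasure_map hm.aemeasurable
  have main := h2 0 (m n) (y n) hm0' hmn' hmδ hy0 (by
    rw [Nat.cast_zero, sub_zero, ← sq]; exact h1) _ hv.map_path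
  rw [Nat.cast_zero, sub_zero] at main
  refine (hv.maxDeviation_le (Nat.zero_le _) hmn' _).trans (main.trans ?_)
  refine mul_exp_le_mul_exp ?_ (by positivity) ?_ ?_ <;> rw [deviationConst]
  · linarith
  · gcongr; linarith
  · positivity

/-- The regime for `√(m (m - l))` says `m (m - l) = O(y L)` and `m (m - l) = o(n ^ 2)`. For `m ≤ δ
n` the early estimate applies; otherwise these relations make the window short and comparable in
length to `y`. -/
theorem WeightConditions.window_deviation (hν : IsLimitLaw ν) (hw : WeightConditions ν w)
    {Abar : ℝ} (l m : ℕ → ℕ) (y : ℕ → ℝ) (hlm : ∀ᶠ n : ℕ in atTop, 1 ≤ l n ∧ l n ≤ m n ∧ m n ≤ n)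
    (hR : Regime Abar (fun n => totalWeight (w n))
      (fun n => Real.sqrt ((m n : ℝ) * ((m n : ℝ) - (l n : ℝ)))) y)
    (hk : Tendsto (fun n => (m n : ℝ) - (l n : ℝ)) atTop atTop)
    (hyk : y =O[atTop] (fun n => (m n : ℝ) - (l n : ℝ))) :
    ∀ᶠ n : ℕ in atTop, ∀ (Ω : Type*) [MeasurableSpace Ω] (P : Measure Ω) [IsProbabilityMeasure P]
      (v : Fin n → Ω → Fin n), IsSizeBiasedOrder (w n) P v →
      P.real {ω | y n ≤ maxDeviation (w n) P v (l n) (m n) ω} ≤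
        deviationConst ν * Real.exp (-(y n) ^ 2 /
          (deviationConst ν * (y n * (n : ℝ) ^ (1 / 3 : ℝ) + ((m n : ℝ) - (l n : ℝ))))) := by
  have hκ := hν.one_le_cubeRatio
  have hμ1 := hν.mean_pos
  have hA : 6 ≤ deviationConst ν := by rw [deviationConst]; linarith
  obtain ⟨C, hC0, hC⟩ := hR.a_sq_isBigO.exists_pos
  obtain ⟨K₂, hK₂0, hK₂⟩ := hyk.exists_pos
  obtain ⟨δ, hδ0, hδ⟩ := hw.eventually_early_window_tail hν (C := 2 * C) (by positivity)
  set μ1 := ∫ x, x ∂ν with hμ1def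
  -- For `m > δ n` the relation `m k ≤ C y L` with `L ≤ 2 * μ1 * n` gives `k ≤ 2 * C * μ1 / δ * y`,
  -- and the window has length `k + 1 ≤ 2 * k`.
  set K₁ := 1 + 4 * C * μ1 / δ with hK₁
  have hK₁1 : 1 ≤ K₁ := by
    have : 0 ≤ 4 * C * μ1 / δ := by positivity
    linarith
  -- Chosen so that `m > δ n` implies `k ≤ μ1 * n / 32`, hence `8 * (k + 1) ≤ L`, as the late
  -- estimate requires.
  set ε := Real.sqrt (δ * μ1 / 32) with hε
  have hε0 : 0 < ε := Real.sqrt_pos.2 (by positivity)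
  have hε2 : ε ^ 2 = δ * μ1 / 32 := Real.sq_sqrt (by positivity)
  filter_upwards [hC.bound, hK₂.bound, hδ, hw.eventually_late_window_tail hν hK₁1 hK₂0,
    hw.eventually_moments hν, hlm, hk.eventually_ge_atTop 1,
    hR.tendsto_b.eventually_gt_atTop 0, hR.a_isLittleO.bound hε0, eventually_gt_atTop 0]
    with n h1 hyK hearly hlate hmom hlmn hk1 hy0 hao hn Ω _ P _ v hv
  obtain ⟨hl1, hlm', hmn⟩ := hlmn
  have hn' : (0 : ℝ) < n := by exact_mod_cast hn
  have hL : 0 < totalWeight (w n) := lt_of_lt_of_le (by positivity) hmom.1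
  have hm0 : (0 : ℝ) ≤ m n := Nat.cast_nonneg _
  set k := (m n : ℝ) - l n with hkdef
  have hk0 : 0 < k := by linarith
  rw [Real.norm_of_nonneg (by positivity), Real.norm_of_nonneg (by positivity),
    Real.sq_sqrt (by positivity)] at h1
  rw [Real.norm_of_nonneg hy0.le, Real.norm_of_nonneg hk0.le] at hyK
  rw [Real.norm_of_nonneg (by positivity), Real.norm_of_nonneg (by positivity)] at hao
  have hao2 : m n * k ≤ δ * μ1 / 32 * (n : ℝ) ^ 2 := by
    have := pow_le_pow_left₀ (Real.sqrt_nonneg _) hao 2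
    rwa [Real.sq_sqrt (by positivity), mul_pow, hε2] at this
  have hm : Measurable fun ω k => v k ω := measurable_pi_lambda _ hv.measurable
  have : IsProbabilityMeasure (P.map fun ω k => v k ω) :=
    Measure.isProbabilityMeasure_map hm.aemeasurable
  have hl' : ((l n - 1 : ℕ) : ℝ) = l n - 1 := by rw [Nat.cast_sub hl1, Nat.cast_one]
  have hk' : (m n : ℝ) - (l n - 1 : ℕ) = k + 1 := by rw [hl', hkdef]; ring
  have hr0 : (0 : ℝ) < (n : ℝ) ^ (1 / 3 : ℝ) := by positivity
  set r := (n : ℝ) ^ (1 / 3 : ℝ)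
  rcases le_or_gt (m n : ℝ) (δ * n) with hmδ | hmδ
  · have main := hearly (l n - 1) (m n) (y n) (by omega) hmn hmδ hy0 (by
      rw [hk']
      calc m n * (k + 1) ≤ m n * (2 * k) := by gcongr; linarith
        _ = 2 * (m n * k) := by ring
        _ ≤ 2 * (C * (y n * totalWeight (w n))) := by gcongr
        _ = _ := by ring) _ hv.map_path
    rw [hk'] at main
    refine (hv.maxDeviation_le hlm' hmn _).trans (main.trans ?_)
    refine mul_exp_le_mul_exp hA (by positivity) ?_ (by linarith)
    -- The draw numbered `l` is included, so the window has `k + 1` draws; this doubles 2048 to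
    -- 4096.
    calc 2048 * cubeRatio ν * (y n * r + (k + 1)) ≤ 2048 * cubeRatio ν * (2 * (y n * r + k)) := by
          have : 0 < y n * r := by positivity
          gcongr; linarith
      _ = 4096 * cubeRatio ν * (y n * r + k) := by ring
      _ ≤ _ := by gcongr; rw [deviationConst]; linarith
  have hexp : y n ^ 2 / (deviationConst ν * (y n * r + k)) ≤ y n / (deviationConst ν * r) := by
    rw [div_le_div_iff₀ (by positivity) (by positivity)]
    have : 0 ≤ deviationConst ν * (y n * k) := by positivity
    calc y n ^ 2 * (deviationConst ν * r) = deviationConst ν * (y n ^ 2 * r) := by ring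
      _ ≤ deviationConst ν * (y n ^ 2 * r) + deviationConst ν * (y n * k) := by linarith
      _ = _ := by ring
  rcases le_or_gt r (y n) with hyr | hyr
  · have hkn : δ * n * k ≤ m n * k := by gcongr
    have main := hlate (l n - 1) (m n - (l n - 1)) (y n) (by omega) ?_ hyr ?_ ?_ _ hv.map_path
    · refine (hv.maxDeviation_le hlm' hmn _).trans ((measureReal_mono ?_).trans (main.trans ?_))
      · rintro a ⟨j, hj1, hj2, hj⟩
        refine ⟨j - (l n - 1), by omega, ?_⟩
        rwa [Nat.add_sub_cancel' hj1]
      · refine mul_le_mul (by linarith) (Real.exp_le_exp.2 ?_) (Real.exp_pos _).le (by linarith)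
        rw [neg_div]
        refine neg_le_neg (hexp.trans ?_)
        exact div_le_div_of_nonneg_left hy0.le hr0 (le_mul_of_one_le_left hr0.le (by linarith))
    all_goals rw [Nat.cast_sub (by omega), hk']
    · have h3 : δ * n * k ≤ δ * n * (μ1 / 32 * n) := by linarith
      have h4 : k ≤ μ1 / 32 * n := le_of_mul_le_mul_left h3 (by positivity)
      linarith [hmom.1]
    · have h3 : δ * n * k ≤ δ * n * (2 * C * μ1 / δ * y n) := by
        calc δ * n * k ≤ C * (y n * totalWeight (w n)) := hkn.trans h1
          _ ≤ C * (y n * (2 * μ1 * n)) := by gcongr; exact hmom.2.1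
          _ = _ := by field_simp
      have h4 : k ≤ 2 * C * μ1 / δ * y n := le_of_mul_le_mul_left h3 (by positivity)
      calc k + 1 ≤ 2 * k := by linarith
        _ ≤ 2 * (2 * C * μ1 / δ * y n) := by gcongr
        _ = 4 * C * μ1 / δ * y n := by ring
        _ ≤ K₁ * y n := by gcongr; linarith
    · exact hyK.trans (by gcongr; linarith)
  -- For `y < n ^ (1/3)` the exponent is at least -1, and the constant is at least `6 > e`, so the
  -- bound exceeds 1.
  · refine measureReal_le_one.trans ?_
    have h1 : Real.exp (-1) ≤ Real.exp (-y n ^ 2 / (deviationConst ν * (y n * r + k))) := by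
      refine Real.exp_le_exp.2 ?_
      rw [neg_div]
      refine neg_le_neg (hexp.trans ?_)
      rw [div_le_one (by positivity)]
      exact hyr.le.trans (le_mul_of_one_le_left hr0.le (by linarith))
    have h2 : 1 ≤ deviationConst ν * Real.exp (-1) := by
      have e1 := Real.exp_one_lt_d9
      rw [Real.exp_neg, ← div_eq_mul_inv, le_div_iff₀ (Real.exp_pos _)]
      linarith
    exact h2.trans (by gcongr)

end SizeBiased

theorem mainTheorem7 (ν : Measure ℝ) (hν : SizeBiased.IsLimitLaw ν) :
    ∃ A : ℝ, 0 < A ∧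
      ∀ Abar : ℝ, 0 < Abar →
      ∀ w : (n : ℕ) → Fin n → ℝ, SizeBiased.WeightConditions ν w →
        (∀ (m : ℕ → ℕ) (y : ℕ → ℝ),
          SizeBiased.Regime Abar (fun n => SizeBiased.totalWeight (w n))
            (fun n => (m n : ℝ)) y →
          ∀ᶠ n : ℕ in atTop,
            ∀ (Ω : Type*) [MeasurableSpace Ω] (P : Measure Ω) [IsProbabilityMeasure P]
              (v : Fin n → Ω → Fin n), SizeBiased.IsSizeBiasedOrder (w n) P v →
              P.real {ω | y n ≤ SizeBiased.maxDeviation (w n) P v 0 (m n) ω} ≤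
                A * Real.exp (-(y n) ^ 2 /
                  (A * (y n * (n : ℝ) ^ (1 / 3 : ℝ) + (m n : ℝ))))) ∧
        (∀ (l m : ℕ → ℕ) (y : ℕ → ℝ),
          (∀ᶠ n : ℕ in atTop, 1 ≤ l n ∧ l n ≤ m n ∧ m n ≤ n) →
          SizeBiased.Regime Abar (fun n => SizeBiased.totalWeight (w n))
            (fun n => Real.sqrt ((m n : ℝ) * ((m n : ℝ) - (l n : ℝ)))) y →
          Tendsto (fun n => (m n : ℝ) - (l n : ℝ)) atTop atTop →
          y =O[atTop] (fun n => (m n : ℝ) - (l n : ℝ)) →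
          ∀ᶠ n : ℕ in atTop,
            ∀ (Ω : Type*) [MeasurableSpace Ω] (P : Measure Ω) [IsProbabilityMeasure P]
              (v : Fin n → Ω → Fin n), SizeBiased.IsSizeBiasedOrder (w n) P v →
              P.real {ω | y n ≤ SizeBiased.maxDeviation (w n) P v (l n) (m n) ω} ≤
                A * Real.exp (-(y n) ^ 2 /
                  (A * (y n * (n : ℝ) ^ (1 / 3 : ℝ) + ((m n : ℝ) - (l n : ℝ)))))) := by
  have hκ := hν.one_le_cubeRatio
  refine ⟨SizeBiased.deviationConst ν, ?_, fun Abar _ w hw => ⟨fun m y hR => ?_,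
    fun l m y hlm hR hk hyk => ?_⟩⟩
  · rw [SizeBiased.deviationConst]; linarith
  · exact hw.initial_deviation hν m y hR
  · exact hw.window_deviation hν l m y hlm hR hk hyk
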